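/- Let $u \in W^{1,2}([0,1];\mathbb{C})$ (taken as a continuous function) and $u_y \in L^2([0,1];\mathbb{C})$ with $u(0)=u(1)$. For $\lambda\in\mathbb{C}^*$ put $$\alpha_\lambda = \tfrac14\begin{pmatrix} i\,u_y & -e^{u/2}-\lambda^{-1}e^{-u/2}\\ e^{u/2}+\lambda e^{-u/2} & -i\,u_y\end{pmatrix},$$ let $F_\lambda$ be the (absolutely continuous) solution of $F_\lambda'=\alpha_\lambda F_\lambda$, $F_\lambda(0)=1$ on $[0,1]$, let $M(\lambda)=F_\lambda(1)=\begin{pmatrix} a(\lambda)&b(\lambda)\\c(\lambda)&d(\lambda)\end{pmatrix}$ be the monodromy and $\Delta=\operatorname{tr}M$. Let $\Sigma=\{(\lambda,\mu)\in\mathbb{C}^*\times\mathbb{C} : \det(M(\lambda)-\mu)=0\}$ be the spectral curve, with structure sheaf $\mathcal{O}$. The spectral divisor $D$ is the generalized divisor $\mathcal{O}+\mathcal{O}\cdot\frac{\mu-d}{c}$ on $\Sigma$, the multiplicity of a point $p$ in $D$ being the dimension of $\bigl(\mathcal{O}_p+\mathcal{O}_p\frac{\mu-d}{c}\bigr)/\mathcal{O}_p$;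 at a regular point of $\Sigma$ this is the order of the pole of $\frac{\mu-d}{c}$, so that $D$ is the polar divisor of $\frac{\mu-d}{c}$ if its support consists of regular points. Put $\zeta(\lambda)=\frac14(\lambda^{1/2}+\lambda^{-1/2})$, $\lambda_{k,0}=8\pi^2k^2+4\pi k\sqrt{4\pi^2k^2-1}-1$ and $\mu_{k,0}=(-1)^k$ for $k\in\mathbb{Z}$. Let $S_k\subset\mathbb{C}^*$ be given by $(|k|-\frac12)\pi\le|\zeta(\lambda)|\le(|k|+\frac12)\pi$, together with $|\lambda|>1$ for $k>0$ and $|\lambda|<1$ for $k<0$, and by $|\zeta(\lambda)|\le\frac\pi2$ for $k=0$. Let $\ell^2_{n,m}$ be the space of complex sequences $(a_k)_{k\in\mathbb{Z}}$ with $\sum_{k<0}\bigl||k|^m a_k\bigr|^2+|a_0|^2+\sum_{k>0}|k^na_k|^2<\infty$, and $\ell^2=\ell^2_{0,0}$. One says that there are asymptotically and totally exactly $r$ points in every $S_k$ if for some $N\in\mathbb{N}$ there are exactly $r$ points in $S_k$ for every $|k|>N$, and exactly $r(2N+1)$ points in $\bigcup_{|k|\le N}S_k$. Then: (1) $\Delta^2-4$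 has asymptotically and totally exactly two zeros in every $S_k$, counted with multiplicities. Its zeros in $\mathbb{C}^*$ are the points over which $\Sigma\to\mathbb{C}^*$ is branched or $\Sigma$ has a singularity: the branch points are the zeros of odd order, and the singularities lie over the zeros of order at least $2$. The zeros can be enumerated, with multiplicities, by two sequences $(\varkappa_{k,1})_{k\in\mathbb{Z}}$, $(\varkappa_{k,2})_{k\in\mathbb{Z}}$ such that $\varkappa_{k,\nu}\in S_k$ for $|k|$ large, and for every such enumeration $\varkappa_{k,\nu}-\lambda_{k,0}\in\ell^2_{-1,3}$ for $\nu\in\{1,2\}$. (2) There is asymptotically and totally exactly one point $(\lambda_*,\mu_*)$ of $D$ with $\lambda_*\in S_k$, counted with multiplicity. The points of $D$ can be enumerated, with multiplicities, by a sequence $(\lambda_k,\mu_k)_{k\in\mathbb{Z}}$ such that $\lambda_k\in S_k$ for $|k|$ large, and for every such enumeration $\lambda_k-\lambda_{k,0}\in\ell^2_{-1,3}$ and $\mu_k-\mu_{k,0}\in\ell^2$. -/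

import Mathlib

open Set Filter Topology MeasureTheory
open scoped ContDiff

noncomputable section

namespace SinhGordon

/-! ### Potentials -/

/-- `v` is a weak derivative of `u` on the open interval `(0,1)`. -/
def IsWeakDeriv (u v : ℝ → ℂ) : Prop :=
  ∀ φ : ℝ → ℝ, ContDiff ℝ ∞ φ → HasCompactSupport φ → tsupport φ ⊆ Ioo 0 1 →
    ∫ x in (0 : ℝ)..1, deriv φ x • u x = -∫ x in (0 : ℝ)..1, φ x • v x

/-- Periodic potentials `(u, u_y) ∈ W^{1,2}([0,1]) × L²([0,1])` with `u(0) = u(1)`, complex valued.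
The function `u` is the continuous representative on `[0,1]` (it is then in `L²([0,1])`),
and `uy` is any representative of the class `u_y`. Values outside of `[0,1]` are irrelevant. -/
structure Pot where
  u : ℝ → ℂ
  uy : ℝ → ℂ
  continuousOn_u : ContinuousOn u (Icc 0 1)
  exists_weakDeriv : ∃ ux : ℝ → ℂ, MemLp ux 2 (volume.restrict (Icc (0 : ℝ) 1)) ∧ IsWeakDeriv u ux
  memLp_uy : MemLp uy 2 (volume.restrict (Icc (0 : ℝ) 1))
  periodic : u 0 = u 1

/-! ### The monodromy -/

/-- The `dx`-part of the connection form at spectral parameter `z`. -/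
def Pot.alpha (P : Pot) (z : ℂ) (x : ℝ) : Matrix (Fin 2) (Fin 2) ℂ :=
  (1 / 4 : ℂ) •
    !![Complex.I * P.uy x, -Complex.exp (P.u x / 2) - z⁻¹ * Complex.exp (-P.u x / 2);
       Complex.exp (P.u x / 2) + z * Complex.exp (-P.u x / 2), -(Complex.I * P.uy x)]

/-- `F` solves `F' = α F`, `F(0) = 1` on `[0,1]` in the sense of Carathéodory, i.e. `F` is a
continuous solution of the integral equation. -/
def Pot.IsExtendedFrame (P : Pot) (z : ℂ) (F : ℝ → Matrix (Fin 2) (Fin 2) ℂ) : Prop :=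
  ContinuousOn F (Icc 0 1) ∧
    ∀ x ∈ Icc (0 : ℝ) 1, ∀ i j,
      F x i j = (1 : Matrix (Fin 2) (Fin 2) ℂ) i j + ∫ t in (0 : ℝ)..x, (P.alpha z t * F t) i j

/-- The solution of `F' = α F`, `F(0) = 1` (it exists, and it is unique on `[0,1]`). -/
def Pot.extendedFrame (P : Pot) (z : ℂ) : ℝ → Matrix (Fin 2) (Fin 2) ℂ :=
  Classical.epsilon (P.IsExtendedFrame z)

/-- The monodromy `M(z) = F_z(1) F_z(0)⁻¹`. -/
def Pot.monodromy (P : Pot) (z : ℂ) : Matrix (Fin 2) (Fin 2) ℂ :=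
  P.extendedFrame z 1 * (P.extendedFrame z 0)⁻¹

/-- The trace `Δ` of the monodromy. -/
def Pot.Delta (P : Pot) (z : ℂ) : ℂ := (P.monodromy z).trace

/-! ### The spectral curve -/

/-- The characteristic function `(z, μ) ↦ det (M(z) - μ)`. -/
def Pot.charFun (P : Pot) (p : ℂ × ℂ) : ℂ :=
  (P.monodromy p.1 - p.2 • (1 : Matrix (Fin 2) (Fin 2) ℂ)).det

/-- The spectral curve `Σ ⊆ ℂ* × ℂ`. -/
def Pot.curve (P : Pot) : Set (ℂ × ℂ) := {p | p.1 ≠ 0 ∧ P.charFun p = 0}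

/-- Singular points of the plane analytic curve `Σ`: the points of `Σ` at which the differential
of the defining function vanishes. -/
def Pot.IsSingularPoint (P : Pot) (p : ℂ × ℂ) : Prop :=
  p ∈ P.curve ∧ HasFDerivAt P.charFun (0 : ℂ × ℂ →L[ℂ] ℂ) p

/-- `Σ` is branched over `z ∈ ℂ*`: the two sheets `μ^{±1}` of `Σ → ℂ*` cannot be separated near `z`,
i.e. the projection `Σ → ℂ*` has no holomorphic section on a neighbourhood of `z`. -/
def Pot.IsBranchValue (P : Pot) (z : ℂ) : Prop :=
  z ≠ 0 ∧ ¬ ∃ m : ℂ → ℂ, AnalyticAt ℂ m z ∧ ∀ᶠ w in 𝓝 z, (w, m w) ∈ P.curve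

/-! ### The spectral divisor -/

/-- Germs at `p` of functions on `Σ \ {p}`. -/
abbrev Pot.PuncturedGerm (P : Pot) (p : ℂ × ℂ) : Type := Germ (𝓝[P.curve \ {p}] p) ℂ

/-- The section `(μ - d(z)) / c(z)` of the eigenvector bundle, where `M = (a b; c d)`. -/
def Pot.eigenSection (P : Pot) (q : ℂ × ℂ) : ℂ :=
  (q.2 - P.monodromy q.1 1 1) / P.monodromy q.1 1 0

/-- The stalk at `p` of the structure sheaf `O` of `Σ`: restrictions to `Σ` of functions that are
holomorphic near `p` in `ℂ²`. -/
def Pot.structureStalk (P : Pot) (p : ℂ × ℂ) : Submodule ℂ (P.PuncturedGerm p) :=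
  Submodule.span ℂ {g | ∃ h : ℂ × ℂ → ℂ, AnalyticAt ℂ h p ∧ g = (h : P.PuncturedGerm p)}

/-- The stalk at `p` of the `O`-module that is generated by `1` and `(μ - d)/c`. -/
def Pot.divisorStalk (P : Pot) (p : ℂ × ℂ) : Submodule ℂ (P.PuncturedGerm p) :=
  Submodule.span ℂ {g | ∃ h₁ h₂ : ℂ × ℂ → ℂ, AnalyticAt ℂ h₁ p ∧ AnalyticAt ℂ h₂ p ∧
    g = ((fun q => h₁ q + h₂ q * P.eigenSection q : ℂ × ℂ → ℂ) : P.PuncturedGerm p)}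

/-- The multiplicity of `p ∈ Σ` in the spectral divisor `D`. The divisor `D` is the (generalized)
divisor `O + O · (μ - d)/c`, and its multiplicity at `p` is the dimension of the quotient of the
stalks of `O + O · (μ - d)/c` and of `O`. At a regular point of `Σ`, with local parameter `t`,
`(μ - d)/c` having a pole of order `m`, that quotient is `t⁻ᵐ O / O`, so that the multiplicity is
the pole order `m`, and `D` is the polar divisor of `(μ - d)/c`. -/
def Pot.spectralDivisor (P : Pot) (p : ℂ × ℂ) : ℕ∞ :=
  Cardinal.toENat (Module.rank ℂ
    (P.divisorStalk p ⧸ (P.structureStalk p).submoduleOf (P.divisorStalk p)))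

/-! ### Comparison with the vacuum, asymptotics -/

/-- `ζ(z) = (z^{1/2} + z^{-1/2}) / 4`; only `|ζ|` is used, which does not depend on the branch. -/
def zeta (z : ℂ) : ℂ := (z ^ (1 / 2 : ℂ) + z ^ (-(1 / 2) : ℂ)) / 4

/-- The annuli `S_k`. -/
def annulus (k : ℤ) : Set ℂ :=
  if 0 < k then
    {z | z ≠ 0 ∧ ((k : ℝ) - 1 / 2) * Real.pi ≤ ‖zeta z‖ ∧
      ‖zeta z‖ ≤ ((k : ℝ) + 1 / 2) * Real.pi ∧ 1 < ‖z‖}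
  else if k = 0 then
    {z | z ≠ 0 ∧ ‖zeta z‖ ≤ Real.pi / 2}
  else
    {z | z ≠ 0 ∧ (-(k : ℝ) - 1 / 2) * Real.pi ≤ ‖zeta z‖ ∧
      ‖zeta z‖ ≤ (-(k : ℝ) + 1 / 2) * Real.pi ∧ ‖z‖ < 1}

/-- `λ_{k,0}`; for `k = 0` the factor `k` kills the square root, and the value is `-1`. -/
def lamVac (k : ℤ) : ℝ :=
  8 * Real.pi ^ 2 * k ^ 2 + 4 * Real.pi * k * Real.sqrt (4 * Real.pi ^ 2 * k ^ 2 - 1) - 1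

/-- `μ_{k,0} = (-1)^k`. -/
def muVac (k : ℤ) : ℂ := (-1) ^ k

/-- The weight of `ℓ²_{n,m}`: `|k|^m` for `k < 0`, `1` for `k = 0`, `k^n` for `k > 0`. -/
def ellWeight (n m k : ℤ) : ℝ :=
  if k < 0 then |(k : ℝ)| ^ m else if k = 0 then 1 else (k : ℝ) ^ n

/-- Membership in the weighted sequence space `ℓ²_{n,m}`. -/
def MemEll (n m : ℤ) (a : ℤ → ℂ) : Prop :=
  Summable fun k => (ellWeight n m k * ‖a k‖) ^ 2

/-- There are asymptotically and totally exactly `r` points in every `S_k`, where `count A` is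
the number of points over `A`. -/
def AsymptoticallyAndTotally (r : ℕ) (count : Set ℂ → ℕ∞) : Prop :=
  ∃ N : ℕ, (∀ k : ℤ, (N : ℤ) < |k| → count (annulus k) = r) ∧
    count (⋃ k : {k : ℤ // |k| ≤ (N : ℤ)}, annulus k) = (r * (2 * N + 1) : ℕ)

/-- The number of zeros in `A` of `Δ² - 4`, counted with multiplicities. A value different from `0`
means that there are only finitely many zeros in `A`. -/
def Pot.zeroCount (P : Pot) (A : Set ℂ) : ℕ∞ :=
  ∑ᶠ z ∈ A, analyticOrderAt (fun w => P.Delta w ^ 2 - 4) z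

/-- The number of points of the spectral divisor over `A`, counted with multiplicities. A value
different from `0` means that there are only finitely many points of the divisor over `A`. -/
def Pot.divisorCount (P : Pot) (A : Set ℂ) : ℕ∞ :=
  ∑ᶠ p ∈ {p : ℂ × ℂ | p ∈ P.curve ∧ p.1 ∈ A}, P.spectralDivisor p

/-- The two sequences `κ_{k,ν}` enumerate the zeros of `Δ² - 4` on `ℂ*` with multiplicities, and
`κ_{k,ν} ∈ S_k` holds for `|k|` large. -/
def Pot.EnumeratesZeros (P : Pot) (κ : ℤ → Fin 2 → ℂ) : Prop :=
  (∀ k ν, κ k ν ≠ 0) ∧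
    (∀ z : ℂ, z ≠ 0 → {i : ℤ × Fin 2 | κ i.1 i.2 = z}.encard =
      analyticOrderAt (fun w => P.Delta w ^ 2 - 4) z) ∧
    ∃ N : ℕ, ∀ k : ℤ, (N : ℤ) < |k| → ∀ ν, κ k ν ∈ annulus k

/-- The sequence `(λ_k, μ_k)` enumerates the points of the spectral divisor with multiplicities,
and `λ_k ∈ S_k` holds for `|k|` large. -/
def Pot.EnumeratesDivisor (P : Pot) (pt : ℤ → ℂ × ℂ) : Prop :=
  (∀ k, pt k ∈ P.curve) ∧
    (∀ p ∈ P.curve, {k : ℤ | pt k = p}.encard = P.spectralDivisor p) ∧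
    ∃ N : ℕ, ∀ k : ℤ, (N : ℤ) < |k| → (pt k).1 ∈ annulus k

end SinhGordon

end

/-! The theorem compares an arbitrary potential with the vacuum u = 0, u_y = 0. With s² = λ and ζ =
(s + s⁻¹)/4 the vacuum monodromy is a = d = cos ζ, c = s sin ζ, b = -s⁻¹ sin ζ (`vac_monodromy`).
Hence c has simple zeros exactly at the λ_{k,0}, and Δ² - 4 = -4λ⁻¹c² has double zeros there.

For λ near ∞, the gauge diag(e^{-u/4}, e^{u/4}) and a diagonalization of the leading part turn the
system into diag(0, -2iζ) plus the off-diagonal term v = (i u_y - u_x)/4 plus O(1/|s|)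
(`Pot.hasPrim_gaugeCoord`). The function v is only square integrable and not small; small are its
integrals against e^{±2iζt}. Duhamel's formula, Cauchy-Schwarz and Gronwall bound the deviation η of
the normalized monodromy from the vacuum by the quadratic mean of these integrals
(`duhamel_estimate`, `Pot.exists_nearVacuum`). Bessel's inequality for the truncations of v to [0,t]
makes that bound summable in k for ζ near kπ (`summable_oscBound`, `oscSq_le_oscBound`); away from
the real axis it decays by itself. The symmetry λ ↦ λ⁻¹, u_y ↦ -u_y, which exchanges b and c up to
sign, carries everything over to λ near 0 (`Pot.monodromy_flip`).

Two consequences are drawn. On the circles |s| = 4π(n + 1/2) the deviation is smaller than the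
vacuum function itself, so Rouché's theorem on annuli counts one zero of c and two of Δ² - 4 between
consecutive circles (`Pot.exists_count`). At a zero of c or of Δ² - 4 the normalized sine is O(η);
for the discriminant this uses Δ² - 4 = (a - d)² + 4bc. Therefore ζ - kπ = O(η), λ - λ_{k,0} = O(kη)
and a - (-1)^k = O(η) with η in ℓ² (`Pot.exists_zero_asymptotics`).

The divisor is reduced to c: the multiplicity of (λ, μ) is the order of c at λ if μ = a(λ), and 0
otherwise, also at singular points (`Pot.spectralDivisor_eq`). With e = (μ - d)/c both ce = μ - d
and (μ - a)e = b are holomorphic, and functions on the curve have the form H(λ) + (μ - a)g(λ), so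
the quotient of stalks is the ring of germs in λ modulo c. Branch points and singularities are read
off from (2μ - Δ)² = Δ² - 4. Enumerations come from matching finite fibres of equal cardinality
(`exists_enumeration`). -/

namespace SinhGordon

/-! ### Functions on `[0,1]` with an integrable derivative -/

/-- `f` is a primitive on `[0,1]` of the integrable function `f'`. -/
structure HasPrim (f f' : ℝ → ℂ) : Prop where
  integrable : IntervalIntegrable f' volume 0 1
  eq_add_integral : ∀ x ∈ Icc (0 : ℝ) 1, f x = f 0 + ∫ t in (0 : ℝ)..x, f' t

theorem intervalIntegrable_zero_of_mem {f : ℝ → ℂ} (h : IntervalIntegrable f volume 0 1)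
    {x : ℝ} (hx : x ∈ Icc (0 : ℝ) 1) : IntervalIntegrable f volume 0 x :=
  h.mono_set (by rw [uIcc_of_le hx.1, uIcc_of_le zero_le_one]; exact Icc_subset_Icc_right hx.2)

/-- Absolute continuity concerns only sums of oscillations, so domination of oscillations transfers
it. Used with `g` the primitive of `‖f'‖`, and for composition with a Lipschitz map. -/
theorem absolutelyContinuousOnInterval_of_dist_le {X Y : Type*} [PseudoMetricSpace X]
    [PseudoMetricSpace Y] {f : ℝ → X} {g : ℝ → Y} {a b K : ℝ}
    (hg : AbsolutelyContinuousOnInterval g a b)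
    (h : ∀ x ∈ uIcc a b, ∀ y ∈ uIcc a b, dist (f x) (f y) ≤ K * dist (g x) (g y)) :
    AbsolutelyContinuousOnInterval f a b := by
  have hK := Filter.Tendsto.const_mul K
    (show Tendsto _ _ _ from by unfold AbsolutelyContinuousOnInterval at hg; exact hg)
  rw [mul_zero] at hK
  unfold AbsolutelyContinuousOnInterval
  refine squeeze_zero' (Eventually.of_forall fun E => Finset.sum_nonneg fun i _ => dist_nonneg)
    ?_ hK
  have : ∀ᶠ E in AbsolutelyContinuousOnInterval.totalLengthFilter ⊓
      𝓟 (AbsolutelyContinuousOnInterval.disjWithin a b),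
      E ∈ AbsolutelyContinuousOnInterval.disjWithin a b :=
    Filter.mem_inf_of_right (Filter.mem_principal_self _)
  filter_upwards [this] with E hE
  rw [Finset.mul_sum]
  exact Finset.sum_le_sum fun i hi => h _ (hE.1 i hi).1 _ (hE.1 i hi).2

namespace HasPrim

variable {f f' g g' : ℝ → ℂ}

theorem absolutelyContinuous (h : HasPrim f f') : AbsolutelyContinuousOnInterval f 0 1 := by
  have hG : AbsolutelyContinuousOnInterval (fun x => ∫ t in (0 : ℝ)..x, ‖f' t‖) 0 1 :=
    h.integrable.norm.absolutelyContinuousOnInterval_intervalIntegral (by simp)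
  refine absolutelyContinuousOnInterval_of_dist_le (K := 1) hG fun x hx y hy => ?_
  rw [uIcc_of_le zero_le_one] at hx hy
  rw [dist_eq_norm, Real.dist_eq, h.eq_add_integral x hx, h.eq_add_integral y hy, add_sub_add_left_eq_sub,
    intervalIntegral.integral_interval_sub_left (intervalIntegrable_zero_of_mem h.integrable hx)
      (intervalIntegrable_zero_of_mem h.integrable hy),
    intervalIntegral.integral_interval_sub_left (intervalIntegrable_zero_of_mem h.integrable hx).norm
      (intervalIntegrable_zero_of_mem h.integrable hy).norm, one_mul]
  exact intervalIntegral.norm_integral_le_abs_integral_norm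

theorem continuousOn (h : HasPrim f f') : ContinuousOn f (Icc 0 1) := by
  simpa [uIcc_of_le (zero_le_one' ℝ)] using h.absolutelyContinuous.continuousOn

theorem ae_hasDerivAt (h : HasPrim f f') : ∀ᵐ x, x ∈ uIcc (0 : ℝ) 1 → HasDerivAt f (f' x) x := by
  -- The endpoints are discarded: `f` is tied to its primitive only on `[0,1]`, which is no
  -- neighbourhood of them.
  have h0 : ∀ᵐ x : ℝ, x ≠ 0 := by simp [ae_iff, measure_singleton]
  have h1 : ∀ᵐ x : ℝ, x ≠ 1 := by simp [ae_iff, measure_singleton]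
  filter_upwards [h.integrable.ae_hasDerivAt_integral, h0, h1] with x hx hx0 hx1 hmem
  have hd := (hx hmem 0 (by simp)).const_add (f 0)
  rw [uIcc_of_le zero_le_one] at hmem
  refine hd.congr_of_eventuallyEq ?_
  filter_upwards [Icc_mem_nhds (lt_of_le_of_ne hmem.1 (Ne.symm hx0)) (lt_of_le_of_ne hmem.2 hx1)]
    with y hy using h.eq_add_integral y hy

/-- The difference of `f` and the primitive of `f'` is absolutely continuous with derivative zero
almost everywhere, hence constant. Product and chain rules for primitives of integrable functions
follow. -/
theorem of_absolutelyContinuous (h : AbsolutelyContinuousOnInterval f 0 1)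
    (hi : IntervalIntegrable f' volume 0 1)
    (hd : ∀ᵐ x, x ∈ uIcc (0 : ℝ) 1 → HasDerivAt f (f' x) x) : HasPrim f f' := by
  have hp : HasPrim (fun x => ∫ t in (0 : ℝ)..x, f' t) f' := ⟨hi, fun x _ => by simp⟩
  obtain ⟨C, hC⟩ := (h.sub hp.absolutelyContinuous).const_of_ae_hasDerivAt_zero (by
    filter_upwards [hd, hp.ae_hasDerivAt] with x h1 h2 hx
    simpa using (h1 hx).sub (h2 hx))
  refine ⟨hi, fun x hx => ?_⟩
  have e0 := hC 0 (by simp)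
  have ex := hC x (by rwa [uIcc_of_le zero_le_one])
  simp only [Pi.sub_apply, intervalIntegral.integral_same, sub_zero] at e0 ex
  rw [e0, ← ex]; ring

theorem congr (h : HasPrim f f') (hfg : ∀ x ∈ Icc (0 : ℝ) 1, g x = f x) (hfg' : ∀ x ∈ Icc (0 : ℝ) 1, g' x = f' x) :
    HasPrim g g' := by
  have hi : ∀ x ∈ Icc (0 : ℝ) 1, EqOn f' g' (uIcc 0 x) := fun x hx t ht => by
    rw [uIcc_of_le hx.1] at ht
    exact (hfg' t ⟨ht.1, ht.2.trans hx.2⟩).symm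
  refine ⟨(intervalIntegrable_congr ((hi 1 (by simp)).mono uIoc_subset_uIcc)).1 h.integrable, fun x hx => ?_⟩
  rw [hfg x hx, hfg 0 (by simp), h.eq_add_integral x hx, intervalIntegral.integral_congr (hi x hx)]

theorem mul (hf : HasPrim f f') (hg : HasPrim g g') :
    HasPrim (fun x => f x * g x) (fun x => f' x * g x + f x * g' x) := by
  refine of_absolutelyContinuous (hf.absolutelyContinuous.smul hg.absolutelyContinuous) ?_ ?_
  · exact (hf.integrable.mul_continuousOn hg.absolutelyContinuous.continuousOn).add
      (hg.integrable.continuousOn_mul hf.absolutelyContinuous.continuousOn)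
  · filter_upwards [hf.ae_hasDerivAt, hg.ae_hasDerivAt] with x h1 h2 hx
    exact (h1 hx).mul (h2 hx)

theorem add (hf : HasPrim f f') (hg : HasPrim g g') :
    HasPrim (fun x => f x + g x) (fun x => f' x + g' x) := by
  refine of_absolutelyContinuous (hf.absolutelyContinuous.add hg.absolutelyContinuous)
    (hf.integrable.add hg.integrable) ?_
  filter_upwards [hf.ae_hasDerivAt, hg.ae_hasDerivAt] with x h1 h2 hx
  exact (h1 hx).add (h2 hx)

theorem const (c : ℂ) : HasPrim (fun _ => c) (fun _ => 0) := ⟨by simp, by simp⟩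

theorem const_mul (hf : HasPrim f f') (c : ℂ) :
    HasPrim (fun x => c * f x) (fun x => c * f' x) :=
  ((const c).mul hf).congr (fun _ _ => rfl) (by simp)

theorem sub (hf : HasPrim f f') (hg : HasPrim g g') :
    HasPrim (fun x => f x - g x) (fun x => f' x - g' x) :=
  (hf.add (hg.const_mul (-1))).congr (fun _ _ => by ring) (fun _ _ => by ring)

theorem of_hasDerivAt (hd : ∀ x, HasDerivAt f (f' x) x) (hc : Continuous f') : HasPrim f f' :=
  ⟨hc.intervalIntegrable _ _, fun x _ => by
    rw [intervalIntegral.integral_eq_sub_of_hasDerivAt (fun t _ => hd t)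
      (hc.intervalIntegrable _ _)]; ring⟩

theorem cexp (hf : HasPrim f f') :
    HasPrim (fun x => Complex.exp (f x)) (fun x => f' x * Complex.exp (f x)) := by
  obtain ⟨C, hC⟩ := hf.absolutelyContinuous.exists_bound
  -- The exponential is Lipschitz on a ball that contains the range of `f`.
  have hcd : ContDiffOn ℝ 1 Complex.exp (Metric.closedBall 0 C) :=
    Complex.contDiff_exp.contDiffOn
  obtain ⟨K, hK⟩ := hcd.exists_lipschitzOnWith (by decide) (convex_closedBall _ _)
    (isCompact_closedBall _ _)
  refine of_absolutelyContinuous ?_ ?_ ?_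
  · refine absolutelyContinuousOnInterval_of_dist_le (K := K) hf.absolutelyContinuous
      fun x hx y hy => ?_
    exact hK.dist_le_mul _ (by simpa using hC x hx) _ (by simpa using hC y hy)
  · exact hf.integrable.mul_continuousOn
      (Complex.continuous_exp.comp_continuousOn hf.absolutelyContinuous.continuousOn)
  · filter_upwards [hf.ae_hasDerivAt] with x h1 hx
    simpa [mul_comm] using (h1 hx).cexp

end HasPrim

/-! ### Weak derivatives -/

/-- The primitive that starts at 0 vanishes to the left of the support of `θ`, and to its right it
equals the total integral, which is zero. -/
theorem exists_antideriv_test {θ : ℝ → ℝ} (hθ : ContDiff ℝ ∞ θ) (hc : HasCompactSupport θ)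
    (hs : tsupport θ ⊆ Ioo 0 1) (hint : ∫ x in (0 : ℝ)..1, θ x = 0) :
    ∃ φ : ℝ → ℝ, ContDiff ℝ ∞ φ ∧ HasCompactSupport φ ∧ tsupport φ ⊆ Ioo 0 1 ∧ deriv φ = θ := by
  have hcont := hθ.continuous
  have hder : ∀ x, HasDerivAt (fun x => ∫ t in (0 : ℝ)..x, θ t) (θ x) x := fun x =>
    intervalIntegral.integral_hasDerivAt_right (hcont.intervalIntegrable _ _)
      (hcont.stronglyMeasurableAtFilter _ _) hcont.continuousAt
  obtain ⟨a, b, ha, hb, hab⟩ : ∃ a b : ℝ, 0 < a ∧ b < 1 ∧ tsupport θ ⊆ Icc a b := by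
    rcases (tsupport θ).eq_empty_or_nonempty with h | h
    · exact ⟨1/2, 1/2, by norm_num, by norm_num, by simp [h]⟩
    · have hK : IsCompact (tsupport θ) := hc
      exact ⟨sInf (tsupport θ), sSup (tsupport θ), (hs (hK.sInf_mem h)).1, (hs (hK.sSup_mem h)).2,
        fun x hx => ⟨csInf_le hK.bddBelow hx, le_csSup hK.bddAbove hx⟩⟩
  have hz : ∀ t, t ∉ Icc a b → θ t = 0 := fun t ht => by
    by_contra h
    exact ht (hab (subset_tsupport _ h))
  have hsupp : Function.support (fun x => ∫ t in (0 : ℝ)..x, θ t) ⊆ Icc a b := by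
    intro x hx
    by_contra hxab
    apply hx
    rw [mem_Icc, not_and_or, not_le, not_le] at hxab
    rcases hxab with h | h
    · refine intervalIntegral.integral_zero_ae (Eventually.of_forall fun t ht => hz t fun h' => ?_)
      have := (mem_uIoc.1 ht)
      rcases this with h2 | h2 <;> linarith [h'.1, h2.2]
    · have : ∫ t in (1 : ℝ)..x, θ t = 0 :=
        intervalIntegral.integral_zero_ae (Eventually.of_forall fun t ht => hz t fun h' => by
          rcases mem_uIoc.1 ht with h2 | h2 <;> linarith [h'.2, h2.1])
      show ∫ t in (0 : ℝ)..x, θ t = 0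
      rw [← intervalIntegral.integral_add_adjacent_intervals (hcont.intervalIntegrable 0 1)
        (hcont.intervalIntegrable 1 x), hint, this, add_zero]
  have hderiv : deriv (fun x => ∫ t in (0 : ℝ)..x, θ t) = θ := funext fun x => (hder x).deriv
  refine ⟨fun x => ∫ t in (0 : ℝ)..x, θ t, ?_, HasCompactSupport.intro isCompact_Icc (K := Icc a b) ?_, ?_, hderiv⟩
  · rw [contDiff_infty_iff_deriv, hderiv]
    exact ⟨fun x => (hder x).differentiableAt, hθ⟩
  · intro x hx
    by_contra h
    exact hx (hsupp h)
  · exact (closure_minimal hsupp isClosed_Icc).trans fun x hx =>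
      ⟨ha.trans_le hx.1, hx.2.trans_lt hb⟩

theorem HasPrim.integral_deriv_smul {U ux : ℝ → ℂ} (h : HasPrim U ux) {φ : ℝ → ℝ}
    (hφ : ContDiff ℝ ∞ φ) (hs : tsupport φ ⊆ Ioo 0 1) :
    ∫ x in (0 : ℝ)..1, deriv φ x • U x = -∫ x in (0 : ℝ)..1, φ x • ux x := by
  have hd : ∀ x, HasDerivAt (fun x => (φ x : ℂ)) ((deriv φ x : ℝ) : ℂ) x := fun x =>
    ((hφ.differentiable (by simp)) x).hasDerivAt.ofReal_comp
  have hφ' : Continuous (deriv φ) := hφ.continuous_deriv (by simp)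
  have hp : HasPrim (fun x => (φ x : ℂ)) (fun x => ((deriv φ x : ℝ) : ℂ)) :=
    HasPrim.of_hasDerivAt hd (Complex.continuous_ofReal.comp hφ')
  have hz : ∀ x, x ∉ Ioo (0 : ℝ) 1 → φ x = 0 := fun x hx => by
    by_contra h
    exact hx (hs (subset_tsupport _ h))
  have e := (hp.mul h).eq_add_integral 1 (by simp)
  rw [hz 0 (by simp), hz 1 (by simp), intervalIntegral.integral_add
    (hp.integrable.mul_continuousOn h.absolutelyContinuous.continuousOn)
    (h.integrable.continuousOn_mul hp.absolutelyContinuous.continuousOn)] at e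
  simp only [Complex.ofReal_zero, zero_mul, zero_add] at e
  simp only [Complex.real_smul]
  exact eq_neg_of_add_eq_zero_left e.symm

theorem ContDiff.exists_bump_Ioo : ∃ ψ : ℝ → ℝ, ContDiff ℝ ∞ ψ ∧ HasCompactSupport ψ ∧
    tsupport ψ ⊆ Ioo 0 1 ∧ ∫ x in (0 : ℝ)..1, ψ x = 1 := by
  let B : ContDiffBump (1 / 2 : ℝ) := ⟨1 / 8, 1 / 4, by norm_num, by norm_num⟩
  have hts : tsupport (B.normed volume) ⊆ Ioo 0 1 := by
    rw [B.tsupport_normed_eq]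
    intro x hx
    rw [Metric.mem_closedBall, Real.dist_eq, abs_le] at hx
    exact ⟨by linarith [hx.1], by linarith [hx.2]⟩
  refine ⟨B.normed volume, B.contDiff_normed, B.hasCompactSupport_normed, hts, ?_⟩
  rw [intervalIntegral.integral_of_le zero_le_one, setIntegral_eq_integral_of_forall_compl_eq_zero,
    B.integral_normed]
  intro x hx
  by_contra h
  exact hx (Ioo_subset_Ioc_self (hts (subset_tsupport _ h)))

/-- Lemma of du Bois-Reymond: subtracting the primitive `U` of `ux` leaves a function with weak
derivative zero, which must be constant. -/
theorem IsWeakDeriv.hasPrim {u ux : ℝ → ℂ} (hu : ContinuousOn u (Icc 0 1))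
    (hux : IntervalIntegrable ux volume 0 1) (h : IsWeakDeriv u ux) : HasPrim u ux := by
  set U : ℝ → ℂ := fun x => ∫ t in (0 : ℝ)..x, ux t with hU
  have hUp : HasPrim U ux := ⟨hux, fun x _ => by simp [hU]⟩
  set d : ℝ → ℂ := fun x => u x - U x with hd
  have hdc : ContinuousOn d (Icc 0 1) := hu.sub hUp.continuousOn
  have hii : ∀ {φ : ℝ → ℝ} {w : ℝ → ℂ}, Continuous φ → ContinuousOn w (Icc 0 1) →
      IntervalIntegrable (fun x => φ x • w x) volume 0 1 := fun hφ hw =>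
    ContinuousOn.intervalIntegrable (by
      rw [uIcc_of_le zero_le_one]; exact hφ.continuousOn.smul hw)
  have hker : ∀ φ : ℝ → ℝ, ContDiff ℝ ∞ φ → HasCompactSupport φ → tsupport φ ⊆ Ioo 0 1 →
      ∫ x in (0 : ℝ)..1, deriv φ x • d x = 0 := by
    intro φ h1 h2 h3
    have hφ' : Continuous (deriv φ) := h1.continuous_deriv (by simp)
    simp only [hd, smul_sub]
    rw [intervalIntegral.integral_sub (hii hφ' hu) (hii hφ' hUp.continuousOn), h φ h1 h2 h3,
      hUp.integral_deriv_smul h1 h3, sub_self]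
  obtain ⟨ψ₀, p1, p2, p3, p4⟩ := ContDiff.exists_bump_Ioo
  set c : ℂ := ∫ x in (0 : ℝ)..1, ψ₀ x • d x with hc
  have hae : ∀ᵐ x : ℝ, x ∈ Ioo (0 : ℝ) 1 → d x - c = 0 := by
    refine isOpen_Ioo.ae_eq_zero_of_integral_contDiff_smul_eq_zero ?_ ?_
    · exact ((hdc.mono Ioo_subset_Icc_self).sub continuousOn_const).locallyIntegrableOn measurableSet_Ioo
    · intro ψ q1 q2 q3
      set m : ℝ := ∫ x in (0 : ℝ)..1, ψ x with hm
      have hθs : tsupport (fun x => ψ x - m * ψ₀ x) ⊆ Ioo 0 1 := by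
        have h1 : tsupport (fun x => m * ψ₀ x) ⊆ tsupport ψ₀ :=
          closure_mono (Function.support_mul_subset_right _ _)
        exact (tsupport_sub ψ (fun x => m * ψ₀ x)).trans (union_subset q3 (h1.trans p3))
      -- Removing the mean by a multiple of the fixed bump `ψ₀` makes any test function a
      -- derivative; the multiple accounts for the constant `c`.
      obtain ⟨φ, r1, r2, r3, r4⟩ := exists_antideriv_test (θ := fun x => ψ x - m * ψ₀ x)
        (q1.sub (contDiff_const.mul p1)) (HasCompactSupport.sub q2 (p2.mul_left)) hθs (by
          rw [intervalIntegral.integral_sub (q1.continuous.intervalIntegrable _ _)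
            ((p1.continuous.const_mul m).intervalIntegrable _ _),
            intervalIntegral.integral_const_mul, p4]; simp [hm])
      have hk := hker φ r1 r2 r3
      rw [r4] at hk
      have hz : ∀ x, x ∉ Ioc (0 : ℝ) 1 → ψ x • (d x - c) = 0 := fun x hx => by
        have : ψ x = 0 := by
          by_contra h
          exact hx (Ioo_subset_Ioc_self (q3 (subset_tsupport _ h)))
        rw [this, zero_smul]
      rw [← setIntegral_eq_integral_of_forall_compl_eq_zero hz,
        ← intervalIntegral.integral_of_le zero_le_one]
      have e1 : ∀ x, (ψ x - m * ψ₀ x) • d x = ψ x • d x - (m : ℂ) * (ψ₀ x • d x) := fun x => by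
        simp only [Complex.real_smul]; push_cast; ring
      simp only [e1] at hk
      rw [intervalIntegral.integral_sub (hii q1.continuous hdc)
        ((hii p1.continuous hdc).const_mul _), intervalIntegral.integral_const_mul, ← hc] at hk
      simp only [smul_sub]
      rw [intervalIntegral.integral_sub (hii q1.continuous hdc)
        (hii q1.continuous continuousOn_const), intervalIntegral.integral_smul_const, ← hm,
        Complex.real_smul]
      exact hk
  have heq : EqOn d (fun _ => c) (Icc 0 1) := by
    refine Measure.eqOn_Icc_of_ae_eq volume (by norm_num) ?_ hdc continuousOn_const
    rw [← restrict_Ioo_eq_restrict_Icc, Filter.EventuallyEq, ae_restrict_iff' measurableSet_Ioo]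
    filter_upwards [hae] with x hx hx' using sub_eq_zero.1 (hx hx')
  refine ⟨hux, fun x hx => ?_⟩
  have e0 := heq (x := 0) (by simp)
  have ex := heq hx
  simp only [hd, hU, intervalIntegral.integral_same, sub_zero] at e0 ex
  rw [e0, ← ex]; ring

theorem intervalIntegrable_of_memLp {f : ℝ → ℂ}
    (h : MemLp f 2 (volume.restrict (Icc (0 : ℝ) 1))) : IntervalIntegrable f volume 0 1 := by
  rw [intervalIntegrable_iff_integrableOn_Icc_of_le zero_le_one]
  exact h.integrable (by norm_num)

theorem Pot.exists_hasPrim (P : Pot) :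
    ∃ ux : ℝ → ℂ, MemLp ux 2 (volume.restrict (Icc (0 : ℝ) 1)) ∧ HasPrim P.u ux := by
  obtain ⟨ux, h1, h2⟩ := P.exists_weakDeriv
  exact ⟨ux, h1, h2.hasPrim P.continuousOn_u (intervalIntegrable_of_memLp h1)⟩

end SinhGordon

namespace SinhGordon

/-! ### Square integrable functions on `[0,1]` -/

/-- Square integrability on `[0,1]`. -/
abbrev SqInt (f : ℝ → ℂ) : Prop := MemLp f 2 (volume.restrict (Icc (0 : ℝ) 1))

/-- The square of the norm of `L²([0,1])`. -/
noncomputable def sqNorm (f : ℝ → ℂ) : ℝ := ∫ t in (0 : ℝ)..1, ‖f t‖ ^ 2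

theorem sqNorm_nonneg (f : ℝ → ℂ) : 0 ≤ sqNorm f :=
  intervalIntegral.integral_nonneg zero_le_one fun _ _ => sq_nonneg _

theorem sqInt_of_continuousOn {f : ℝ → ℂ} (hf : ContinuousOn f (Icc 0 1)) : SqInt f := by
  obtain ⟨C, hC⟩ := isCompact_Icc.exists_bound_of_continuousOn hf
  exact MemLp.of_bound (hf.aestronglyMeasurable measurableSet_Icc) C
    ((ae_restrict_iff' measurableSet_Icc).2 (Eventually.of_forall hC))

theorem SqInt.restrict {a : ℝ → ℂ} (ha : SqInt a) {x : ℝ} (hx : x ∈ Icc (0 : ℝ) 1) :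
    MemLp a 2 (volume.restrict (Ioc 0 x)) :=
  ha.mono_measure (Measure.restrict_mono
    (Ioc_subset_Icc_self.trans (Icc_subset_Icc_right hx.2)) le_rfl)

theorem SqInt.intervalIntegrable_sq {a : ℝ → ℂ} (ha : SqInt a) :
    IntervalIntegrable (fun t => ‖a t‖ ^ 2) volume 0 1 := by
  rw [intervalIntegrable_iff_integrableOn_Icc_of_le zero_le_one]
  exact ha.integrable_norm_pow (by norm_num)

theorem sq_integral_norm_mul_norm_le {a f : ℝ → ℂ} (ha : SqInt a) (hf : SqInt f) {x : ℝ}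
    (hx : x ∈ Icc (0 : ℝ) 1) :
    (∫ t in (0 : ℝ)..x, ‖a t‖ * ‖f t‖) ^ 2 ≤ sqNorm a * ∫ t in (0 : ℝ)..x, ‖f t‖ ^ 2 := by
  have h := integral_mul_le_Lp_mul_Lq_of_nonneg (μ := volume.restrict (Ioc 0 x))
    (p := 2) (q := 2) (by constructor <;> norm_num) (f := fun t => ‖a t‖) (g := fun t => ‖f t‖)
    (Eventually.of_forall fun t => norm_nonneg _) (Eventually.of_forall fun t => norm_nonneg _)
    (by simpa using (ha.restrict hx).norm) (by simpa using (hf.restrict hx).norm)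
  have hA : (0 : ℝ) ≤ ∫ t in Ioc 0 x, ‖a t‖ ^ 2 := integral_nonneg fun _ => sq_nonneg _
  have hF : (0 : ℝ) ≤ ∫ t in Ioc 0 x, ‖f t‖ ^ 2 := integral_nonneg fun _ => sq_nonneg _
  simp only [Real.rpow_ofNat, ← Real.sqrt_eq_rpow] at h
  have h0 : (0 : ℝ) ≤ ∫ t in Ioc 0 x, ‖a t‖ * ‖f t‖ := integral_nonneg fun _ => by positivity
  have hmono : ∫ t in Ioc 0 x, ‖a t‖ ^ 2 ≤ sqNorm a := by
    rw [sqNorm, intervalIntegral.integral_of_le zero_le_one]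
    refine setIntegral_mono_set ?_ (Eventually.of_forall fun _ => sq_nonneg _)
      (Ioc_subset_Ioc_right hx.2).eventuallyLE
    exact (intervalIntegrable_iff_integrableOn_Ioc_of_le zero_le_one).1 ha.intervalIntegrable_sq
  rw [intervalIntegral.integral_of_le hx.1, intervalIntegral.integral_of_le hx.1]
  calc _ ≤ (√(∫ t in Ioc 0 x, ‖a t‖ ^ 2) * √(∫ t in Ioc 0 x, ‖f t‖ ^ 2)) ^ 2 :=
        pow_le_pow_left₀ h0 h 2
    _ = (∫ t in Ioc 0 x, ‖a t‖ ^ 2) * ∫ t in Ioc 0 x, ‖f t‖ ^ 2 := by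
        rw [mul_pow, Real.sq_sqrt hA, Real.sq_sqrt hF]
    _ ≤ _ := mul_le_mul_of_nonneg_right hmono hF

theorem sq_norm_integral_mul_le {a f : ℝ → ℂ} (ha : SqInt a) (hf : SqInt f) {x : ℝ}
    (hx : x ∈ Icc (0 : ℝ) 1) :
    ‖∫ t in (0 : ℝ)..x, a t * f t‖ ^ 2 ≤ sqNorm a * ∫ t in (0 : ℝ)..x, ‖f t‖ ^ 2 := by
  refine le_trans (pow_le_pow_left₀ (norm_nonneg _) ?_ 2) (sq_integral_norm_mul_norm_le ha hf hx)
  refine (intervalIntegral.norm_integral_le_integral_norm hx.1).trans_eq ?_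
  simp only [norm_mul]

/-! ### Volterra operators -/

/-- The unit interval `[0,1]`. -/
abbrev UI : Type := Icc (0 : ℝ) 1

/-- The continuous extension to the real line of a continuous function on `[0,1]`. -/
noncomputable def extUI (f : C(UI, ℂ)) : ℝ → ℂ := IccExtend zero_le_one f

theorem continuous_extUI (f : C(UI, ℂ)) : Continuous (extUI f) := f.continuous.Icc_extend'

theorem norm_extUI_le (f : C(UI, ℂ)) (t : ℝ) : ‖extUI f t‖ ≤ ‖f‖ := f.norm_coe_le_norm _

theorem extUI_of_mem (f : C(UI, ℂ)) {t : ℝ} (ht : t ∈ Icc (0 : ℝ) 1) : extUI f t = f ⟨t, ht⟩ :=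
  IccExtend_of_mem _ _ ht

theorem intervalIntegrable_mul_extUI {a : ℝ → ℂ} (ha : SqInt a) (f : C(UI, ℂ)) :
    IntervalIntegrable (fun t => a t * extUI f t) volume 0 1 :=
  (intervalIntegrable_of_memLp ha).mul_continuousOn (continuous_extUI f).continuousOn

theorem hasPrim_integral {w : ℝ → ℂ} (hw : IntervalIntegrable w volume 0 1) :
    HasPrim (fun x => ∫ t in (0 : ℝ)..x, w t) w := ⟨hw, fun x _ => by simp⟩

/-- The Volterra operator `f ↦ (x ↦ ∫₀ˣ a f)` on `C([0,1])`. -/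
noncomputable def volterra (a : ℝ → ℂ) (ha : SqInt a) : C(UI, ℂ) →L[ℂ] C(UI, ℂ) :=
  LinearMap.mkContinuous
    { toFun := fun f => ⟨fun x => ∫ t in (0 : ℝ)..x, a t * extUI f t, by
        exact (hasPrim_integral (intervalIntegrable_mul_extUI ha f)).continuousOn.comp_continuous
          continuous_subtype_val fun x => x.2⟩
      map_add' := fun f g => by
        ext x
        simp only [ContinuousMap.add_apply]
        change ∫ t in (0 : ℝ)..x, a t * extUI (f + g) t =
          (∫ t in (0 : ℝ)..x, a t * extUI f t) + ∫ t in (0 : ℝ)..x, a t * extUI g t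
        rw [← intervalIntegral.integral_add
          (intervalIntegrable_zero_of_mem (intervalIntegrable_mul_extUI ha f) x.2)
          (intervalIntegrable_zero_of_mem (intervalIntegrable_mul_extUI ha g) x.2)]
        simp only [extUI, IccExtend, Function.comp, ContinuousMap.add_apply, mul_add]
      map_smul' := fun c f => by
        ext x
        simp only [ContinuousMap.smul_apply, RingHom.id_apply, smul_eq_mul]
        change ∫ t in (0 : ℝ)..x, a t * extUI (c • f) t = c * ∫ t in (0 : ℝ)..x, a t * extUI f t
        rw [← intervalIntegral.integral_const_mul]
        simp only [extUI, IccExtend, Function.comp, ContinuousMap.smul_apply, smul_eq_mul]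
        congr 1; ext t; ring }
    (∫ t in (0 : ℝ)..1, ‖a t‖) fun f => by
      have hn : IntervalIntegrable (fun t => ‖a t‖) volume 0 1 :=
        (intervalIntegrable_of_memLp ha).norm
      have h0 : 0 ≤ ∫ t in (0 : ℝ)..1, ‖a t‖ :=
        intervalIntegral.integral_nonneg zero_le_one fun _ _ => norm_nonneg _
      rw [ContinuousMap.norm_le _ (mul_nonneg h0 (norm_nonneg _))]
      intro x
      simp only [LinearMap.coe_mk, AddHom.coe_mk]
      calc ‖∫ t in (0 : ℝ)..x, a t * extUI f t‖
          ≤ ∫ t in (0 : ℝ)..x, ‖a t * extUI f t‖ :=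
            intervalIntegral.norm_integral_le_integral_norm x.2.1
        _ ≤ ∫ t in (0 : ℝ)..1, ‖a t * extUI f t‖ :=
            intervalIntegral.integral_mono_interval le_rfl x.2.1 x.2.2
              (Eventually.of_forall fun _ => norm_nonneg _)
              (intervalIntegrable_mul_extUI ha f).norm
        _ ≤ ∫ t in (0 : ℝ)..1, ‖a t‖ * ‖f‖ := by
            refine intervalIntegral.integral_mono_on zero_le_one
              (intervalIntegrable_mul_extUI ha f).norm (hn.mul_const _) fun t _ => ?_
            rw [norm_mul]
            exact mul_le_mul_of_nonneg_left (norm_extUI_le f t) (norm_nonneg _)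
        _ = _ := intervalIntegral.integral_mul_const _ _

theorem volterra_apply {a : ℝ → ℂ} (ha : SqInt a) (f : C(UI, ℂ)) (x : UI) :
    volterra a ha f x = ∫ t in (0 : ℝ)..x, a t * extUI f t := rfl

/-- Cauchy-Schwarz replaces a supremum bound of `a`, which is only square integrable. Each
application raises the power of `x` by one and divides by the new exponent, so iteration produces a
factorial. -/
theorem sq_norm_volterra_apply_le {a : ℝ → ℂ} (ha : SqInt a) {f : C(UI, ℂ)} {K : ℝ} {n : ℕ}
    (hf : ∀ x : UI, ‖f x‖ ^ 2 ≤ K * (x : ℝ) ^ n) (x : UI) :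
    ‖volterra a ha f x‖ ^ 2 ≤ sqNorm a * (K * (x : ℝ) ^ (n + 1) / (n + 1)) := by
  rw [volterra_apply]
  refine (sq_norm_integral_mul_le ha (sqInt_of_continuousOn (continuous_extUI f).continuousOn)
    x.2).trans (mul_le_mul_of_nonneg_left ?_ (sqNorm_nonneg a))
  calc ∫ t in (0 : ℝ)..x, ‖extUI f t‖ ^ 2 ≤ ∫ t in (0 : ℝ)..x, K * t ^ n := by
        refine intervalIntegral.integral_mono_on x.2.1
          (((continuous_extUI f).norm.pow 2).intervalIntegrable _ _)
          ((continuous_const.mul (continuous_pow n)).intervalIntegrable _ _) fun t ht => ?_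
        rw [extUI_of_mem f ⟨ht.1, ht.2.trans x.2.2⟩]
        exact hf _
    _ = _ := by rw [intervalIntegral.integral_const_mul, integral_pow]; simp; ring

/-- Pairs of continuous functions on `[0,1]`. -/
abbrev VecUI : Type := Fin 2 → C(UI, ℂ)

/-- The Volterra operator with a matrix of coefficients. -/
noncomputable def matVolterra (a : Fin 2 → Fin 2 → ℝ → ℂ) (ha : ∀ i j, SqInt (a i j)) :
    VecUI →L[ℂ] VecUI :=
  ContinuousLinearMap.pi fun i => ∑ j, (volterra (a i j) (ha i j)).comp
    (ContinuousLinearMap.proj (R := ℂ) (φ := fun _ : Fin 2 => C(UI, ℂ)) j)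

theorem matVolterra_apply {a : Fin 2 → Fin 2 → ℝ → ℂ} (ha : ∀ i j, SqInt (a i j)) (f : VecUI)
    (i : Fin 2) : matVolterra a ha f i =
      volterra (a i 0) (ha i 0) (f 0) + volterra (a i 1) (ha i 1) (f 1) := by
  simp [matVolterra, Fin.sum_univ_two]

/-- Iterates the scalar estimate; the factor 2 in the constant is that of |p + q|² ≤ 2(|p|² + |q|²)
for the two terms in a row. -/
theorem sq_norm_matVolterra_pow_le {a : Fin 2 → Fin 2 → ℝ → ℂ} (ha : ∀ i j, SqInt (a i j))
    (f : VecUI) (n : ℕ) (i : Fin 2) (x : UI) :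
    ‖((matVolterra a ha) ^ n) f i x‖ ^ 2 ≤
      (2 * ∑ i, ∑ j, sqNorm (a i j)) ^ n / n.factorial * ‖f‖ ^ 2 * (x : ℝ) ^ n := by
  set W := 2 * ∑ i, ∑ j, sqNorm (a i j) with hW
  induction n generalizing i x with
  | zero =>
    simp only [pow_zero, Nat.factorial_zero, Nat.cast_one, div_one, one_mul, mul_one]
    exact pow_le_pow_left₀ (norm_nonneg _)
      (((f i).norm_coe_le_norm x).trans (norm_le_pi_norm f i)) 2
  | succ n ih =>
    rw [pow_succ' (matVolterra a ha), mul_apply_eq_comp, matVolterra_apply,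
      ContinuousMap.add_apply]
    have h0 := sq_norm_volterra_apply_le (ha i 0) (ih 0) x
    have h1 := sq_norm_volterra_apply_le (ha i 1) (ih 1) x
    set z0 := volterra (a i 0) (ha i 0) ((matVolterra a ha ^ n) f 0) x
    set z1 := volterra (a i 1) (ha i 1) ((matVolterra a ha ^ n) f 1) x
    have hz : ‖z0 + z1‖ ^ 2 ≤ 2 * (‖z0‖ ^ 2 + ‖z1‖ ^ 2) := by
      have := norm_add_le z0 z1
      have h3 : ‖z0 + z1‖ ^ 2 ≤ (‖z0‖ + ‖z1‖) ^ 2 := pow_le_pow_left₀ (norm_nonneg _) this 2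
      nlinarith [sq_nonneg (‖z0‖ - ‖z1‖)]
    have hWi : 2 * (sqNorm (a i 0) + sqNorm (a i 1)) ≤ W := by
      have h00 := sqNorm_nonneg (a 0 0)
      have h01 := sqNorm_nonneg (a 0 1)
      have h10 := sqNorm_nonneg (a 1 0)
      have h11 := sqNorm_nonneg (a 1 1)
      simp only [hW, Fin.sum_univ_two]
      fin_cases i <;> simp <;> linarith
    have hW0 : 0 ≤ W := by
      have := Finset.sum_nonneg fun i (_ : i ∈ Finset.univ) =>
        Finset.sum_nonneg fun j (_ : j ∈ Finset.univ) => sqNorm_nonneg (a i j)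
      linarith
    set B := W ^ n / n.factorial * ‖f‖ ^ 2 * (x : ℝ) ^ (n + 1) / (n + 1) with hB
    have hB0 : 0 ≤ B := by
      have := x.2.1
      positivity
    calc ‖z0 + z1‖ ^ 2 ≤ 2 * (sqNorm (a i 0) + sqNorm (a i 1)) * B := by linarith
      _ ≤ W * B := mul_le_mul_of_nonneg_right hWi hB0
      _ = _ := by
        rw [hB, Nat.factorial_succ]; push_cast
        field_simp
        ring

theorem isUnit_one_sub_of_isUnit_one_sub_pow {R : Type*} [Ring R] {V : R} {n : ℕ}
    (hu : IsUnit (1 - V ^ n)) : IsUnit (1 - V) := by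
  have hc : Commute (1 - V) (∑ i ∈ Finset.range n, V ^ i) :=
    Commute.sum_right _ _ _ fun i _ => (Commute.one_left _).sub_left (Commute.self_pow V i)
  have he : (1 - V) * ∑ i ∈ Finset.range n, V ^ i = 1 - V ^ n := by
    rw [← neg_sub V 1, neg_mul, mul_geom_sum, neg_sub]
  rw [← he, hc.isUnit_mul_iff] at hu
  exact hu.1

/-- The coefficients need not be small: by the factorial some power `V ^ n` is a contraction, and `1
- V` divides `1 - V ^ n`. -/
theorem isUnit_one_sub_matVolterra {a : Fin 2 → Fin 2 → ℝ → ℂ} (ha : ∀ i j, SqInt (a i j)) :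
    IsUnit (1 - matVolterra a ha) := by
  set V := matVolterra a ha
  set W := 2 * ∑ i, ∑ j, sqNorm (a i j) with hW
  -- The estimate is one of squared norms, so 1/4 gives operator norm at most 1/2.
  obtain ⟨n, hn⟩ : ∃ n : ℕ, W ^ n / n.factorial < 1 / 4 :=
    ((FloorSemiring.tendsto_pow_div_factorial_atTop W).eventually_lt_const (by norm_num)).exists
  have hVn : ‖V ^ n‖ < 1 := by
    refine lt_of_le_of_lt (ContinuousLinearMap.opNorm_le_bound _ (M := 1 / 2) (by norm_num)
      fun f => ?_) (by norm_num)
    rw [pi_norm_le_iff_of_nonneg (by positivity)]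
    intro i
    rw [ContinuousMap.norm_le _ (by positivity)]
    intro x
    refine abs_le_of_sq_le_sq' (a := ‖(V ^ n) f i x‖) ?_ (by positivity) |>.2
    refine (sq_norm_matVolterra_pow_le ha f n i x).trans ?_
    have hx : (x : ℝ) ^ n ≤ 1 := pow_le_one₀ x.2.1 x.2.2
    have hx0 : 0 ≤ (x : ℝ) ^ n := pow_nonneg x.2.1 _
    have hf := sq_nonneg ‖f‖
    have : (W ^ n / n.factorial) * ‖f‖ ^ 2 ≤ 1 / 4 * ‖f‖ ^ 2 :=
      mul_le_mul_of_nonneg_right hn.le hf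
    calc _ ≤ (1 / 4 * ‖f‖ ^ 2) * (x : ℝ) ^ n := mul_le_mul_of_nonneg_right this hx0
      _ ≤ (1 / 4 * ‖f‖ ^ 2) * 1 := mul_le_mul_of_nonneg_left hx (by positivity)
      _ = _ := by ring
  exact isUnit_one_sub_of_isUnit_one_sub_pow (isUnit_one_sub_of_norm_lt_one (R := VecUI →L[ℂ] VecUI) hVn)

/-! ### Linear systems -/

/-- `y` solves the linear system `y' = a y` on `[0,1]`. -/
def IsVecSol (a : Fin 2 → Fin 2 → ℝ → ℂ) (y : Fin 2 → ℝ → ℂ) : Prop :=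
  ∀ i, HasPrim (y i) fun t => a i 0 t * y 0 t + a i 1 t * y 1 t

/-- The solution of `y' = a y` with initial value `c`, as a pair of continuous functions. -/
noncomputable def vecSol (a : Fin 2 → Fin 2 → ℝ → ℂ) (ha : ∀ i j, SqInt (a i j)) (c : Fin 2 → ℂ) :
    VecUI :=
  Ring.inverse (1 - matVolterra a ha) fun i => ContinuousMap.const _ (c i)

theorem one_sub_matVolterra_vecSol {a : Fin 2 → Fin 2 → ℝ → ℂ} (ha : ∀ i j, SqInt (a i j))
    (c : Fin 2 → ℂ) : (1 - matVolterra a ha) (vecSol a ha c) = fun i => ContinuousMap.const _ (c i) := by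
  rw [vecSol, ← mul_apply_eq_comp,
    Ring.mul_inverse_cancel _ (isUnit_one_sub_matVolterra ha), one_apply_eq_self]

theorem vecSol_apply {a : Fin 2 → Fin 2 → ℝ → ℂ} (ha : ∀ i j, SqInt (a i j)) (c : Fin 2 → ℂ)
    (i : Fin 2) (x : UI) : vecSol a ha c i x = c i + ∫ t in (0 : ℝ)..x,
      (a i 0 t * extUI (vecSol a ha c 0) t + a i 1 t * extUI (vecSol a ha c 1) t) := by
  have h := congrArg (fun f : VecUI => f i x) (one_sub_matVolterra_vecSol ha c)
  simp only [sub_apply, one_apply_eq_self, Pi.sub_apply,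
    ContinuousMap.sub_apply, matVolterra_apply, ContinuousMap.add_apply, volterra_apply,
    ContinuousMap.const_apply] at h
  rw [intervalIntegral.integral_add
    (intervalIntegrable_zero_of_mem (intervalIntegrable_mul_extUI (ha i 0) _) x.2)
    (intervalIntegrable_zero_of_mem (intervalIntegrable_mul_extUI (ha i 1) _) x.2), ← h]
  ring

theorem isVecSol_vecSol {a : Fin 2 → Fin 2 → ℝ → ℂ} (ha : ∀ i j, SqInt (a i j)) (c : Fin 2 → ℂ) :
    IsVecSol a fun i => extUI (vecSol a ha c i) := by
  intro i
  refine ⟨(intervalIntegrable_mul_extUI (ha i 0) _).add (intervalIntegrable_mul_extUI (ha i 1) _),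
    fun x hx => ?_⟩
  beta_reduce
  rw [extUI_of_mem _ hx, extUI_of_mem _ (show (0 : ℝ) ∈ Icc (0 : ℝ) 1 by simp),
    vecSol_apply ha c i ⟨x, hx⟩, vecSol_apply ha c i ⟨0, by simp⟩]
  simp

theorem extUI_vecSol_zero {a : Fin 2 → Fin 2 → ℝ → ℂ} (ha : ∀ i j, SqInt (a i j)) (c : Fin 2 → ℂ)
    (i : Fin 2) : extUI (vecSol a ha c i) 0 = c i := by
  rw [extUI_of_mem _ (show (0 : ℝ) ∈ Icc (0 : ℝ) 1 by simp), vecSol_apply ha c i ⟨0, by simp⟩]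
  simp

/-- Uniqueness: the integral equation says that the invertible operator `1 - V` maps the solution to
the constant initial value. -/
theorem IsVecSol.eq_vecSol {a : Fin 2 → Fin 2 → ℝ → ℂ} (ha : ∀ i j, SqInt (a i j))
    {y : Fin 2 → ℝ → ℂ} (hy : IsVecSol a y) (i : Fin 2) {x : ℝ} (hx : x ∈ Icc (0 : ℝ) 1) :
    y i x = vecSol a ha (fun i => y i 0) i ⟨x, hx⟩ := by
  let f : VecUI := fun i => ⟨fun x : UI => y i x,
    (hy i).continuousOn.comp_continuous continuous_subtype_val fun x => x.2⟩
  have hf : (1 - matVolterra a ha) f = fun i => ContinuousMap.const _ (y i 0) := by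
    ext i x
    simp only [sub_apply, one_apply_eq_self, Pi.sub_apply,
      ContinuousMap.sub_apply, matVolterra_apply, ContinuousMap.add_apply, volterra_apply,
      ContinuousMap.const_apply]
    have e := (hy i).eq_add_integral x x.2
    have hfe : ∀ j, ∀ t ∈ uIcc (0 : ℝ) x, extUI (f j) t = y j t := fun j t ht => by
      rw [uIcc_of_le x.2.1] at ht
      rw [extUI_of_mem _ ⟨ht.1, ht.2.trans x.2.2⟩]; rfl
    rw [← intervalIntegral.integral_add
      (intervalIntegrable_zero_of_mem (intervalIntegrable_mul_extUI (ha i 0) _) x.2)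
      (intervalIntegrable_zero_of_mem (intervalIntegrable_mul_extUI (ha i 1) _) x.2),
      show f i x = y i x from rfl, e, sub_eq_iff_eq_add, add_right_inj]
    refine intervalIntegral.integral_congr fun t ht => ?_
    rw [hfe 0 t ht, hfe 1 t ht]
  have hinv : f = vecSol a ha fun i => y i 0 := by
    rw [vecSol, ← hf, ← mul_apply_eq_comp,
      Ring.inverse_mul_cancel _ (isUnit_one_sub_matVolterra ha), one_apply_eq_self]
  exact congrArg (fun f : VecUI => f i ⟨x, hx⟩) hinv

end SinhGordon

namespace SinhGordon

theorem IsVecSol.eq_at_one {a : Fin 2 → Fin 2 → ℝ → ℂ} (ha : ∀ i j, SqInt (a i j))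
    {y w : Fin 2 → ℝ → ℂ} (hy : IsVecSol a y) (hw : IsVecSol a w) (h0 : ∀ i, y i 0 = w i 0)
    (i : Fin 2) : y i 1 = w i 1 := by
  rw [hy.eq_vecSol ha i (x := 1) (by simp), hw.eq_vecSol ha i (x := 1) (by simp), funext h0]

theorem IsVecSol.combination {a : Fin 2 → Fin 2 → ℝ → ℂ} {y w : Fin 2 → ℝ → ℂ}
    (hy : IsVecSol a y) (hw : IsVecSol a w) (p q : ℂ) :
    IsVecSol a fun i t => p * y i t + q * w i t := fun i =>
  (((hy i).const_mul p).add ((hw i).const_mul q)).congr (fun _ _ => rfl) fun _ _ => by ring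

namespace Pot

variable (P : Pot)

/-! ### The monodromy as a holomorphic function -/

/-- The entries of the connection form. -/
noncomputable def coef (z : ℂ) (i j : Fin 2) (t : ℝ) : ℂ := P.alpha z t i j

/-- The coefficients of `z ^ n` in the entries of the connection form. -/
noncomputable def coefPart (n : ℤ) (i j : Fin 2) (t : ℝ) : ℂ :=
  if n = 0 then
    (1 / 4 : ℂ) * (!![Complex.I * P.uy t, -Complex.exp (P.u t / 2); Complex.exp (P.u t / 2),
      -(Complex.I * P.uy t)] : Matrix (Fin 2) (Fin 2) ℂ) i j
  else if n = 1 then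
    (1 / 4 : ℂ) * (!![0, 0; Complex.exp (-P.u t / 2), 0] : Matrix (Fin 2) (Fin 2) ℂ) i j
  else (1 / 4 : ℂ) * (!![0, -Complex.exp (-P.u t / 2); 0, 0] : Matrix (Fin 2) (Fin 2) ℂ) i j

/-- Makes the Volterra operator a Laurent polynomial A + zB + z⁻¹C with fixed operators; holomorphy
in `z` rests on this. -/
theorem coef_eq (z : ℂ) (i j : Fin 2) (t : ℝ) :
    P.coef z i j t = P.coefPart 0 i j t + z * P.coefPart 1 i j t + z⁻¹ * P.coefPart (-1) i j t := by
  fin_cases i <;> fin_cases j <;> simp [coef, coefPart, alpha] <;> ring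

theorem continuousOn_exp_mul (c : ℂ) : ContinuousOn (fun t => Complex.exp (c * P.u t)) (Icc 0 1) :=
  Complex.continuous_exp.comp_continuousOn (continuousOn_const.mul P.continuousOn_u)

theorem sqInt_coefPart (n : ℤ) (i j : Fin 2) : SqInt (P.coefPart n i j) := by
  have h1 := sqInt_of_continuousOn (P.continuousOn_exp_mul (1 / 2))
  have h2 := sqInt_of_continuousOn (P.continuousOn_exp_mul (-1 / 2))
  have e1 : ∀ t, Complex.exp (P.u t / 2) = Complex.exp (1 / 2 * P.u t) := fun t => by
    congr 1; ring
  have e2 : ∀ t, Complex.exp (-P.u t / 2) = Complex.exp (-1 / 2 * P.u t) := fun t => by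
    congr 1; ring
  have hy : SqInt P.uy := P.memLp_uy
  have h0 : SqInt fun _ => 0 := MemLp.zero'
  have k1 := h1.const_mul (1 / 4 : ℂ)
  have k2 := h2.const_mul (1 / 4 : ℂ)
  have k3 := h1.const_mul (-1 / 4 : ℂ)
  have k4 := h2.const_mul (-1 / 4 : ℂ)
  have ky := hy.const_mul (Complex.I / 4)
  have ky' := hy.const_mul (-Complex.I / 4)
  unfold coefPart
  simp only [e1, e2]
  split_ifs <;> fin_cases i <;> fin_cases j <;> simp only [Matrix.of_apply, Matrix.cons_val',
    Matrix.cons_val_zero, Matrix.cons_val_one, Matrix.cons_val_fin_one, Fin.zero_eta, Fin.mk_one,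
    mul_zero]
  all_goals first
    | exact h0
    | exact k1
    | exact k2
    | (refine (memLp_congr_ae (ae_of_all _ fun t => ?_)).1 k3; ring1)
    | (refine (memLp_congr_ae (ae_of_all _ fun t => ?_)).1 k4; ring1)
    | (refine (memLp_congr_ae (ae_of_all _ fun t => ?_)).1 ky; ring1)
    | (refine (memLp_congr_ae (ae_of_all _ fun t => ?_)).1 ky'; ring1)

theorem sqInt_coef (z : ℂ) (i j : Fin 2) : SqInt (P.coef z i j) := by
  refine (memLp_congr_ae (ae_of_all _ fun t => (P.coef_eq z i j t).symm)).1 ?_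
  exact ((P.sqInt_coefPart 0 i j).add ((P.sqInt_coefPart 1 i j).const_mul z)).add
    ((P.sqInt_coefPart (-1) i j).const_mul z⁻¹)

theorem isExtendedFrame_iff (z : ℂ) (F : ℝ → Matrix (Fin 2) (Fin 2) ℂ) :
    P.IsExtendedFrame z F ↔ ∀ j, IsVecSol (P.coef z) (fun i t => F t i j) ∧
      ∀ i, F 0 i j = (1 : Matrix (Fin 2) (Fin 2) ℂ) i j := by
  have hmul : ∀ t i j, (P.alpha z t * F t) i j =
      P.coef z i 0 t * F t 0 j + P.coef z i 1 t * F t 1 j := fun t i j => by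
    simp [Matrix.mul_apply, Fin.sum_univ_two, coef]
  constructor
  · rintro ⟨hc, h⟩ j
    have hcij : ∀ i, ContinuousOn (fun t => F t i j) (Icc 0 1) := fun i => by
      have : Continuous fun A : Matrix (Fin 2) (Fin 2) ℂ => A i j := by fun_prop
      exact this.comp_continuousOn hc
    have h0 : ∀ i, F 0 i j = (1 : Matrix (Fin 2) (Fin 2) ℂ) i j := fun i => by
      simpa using h 0 (by simp) i j
    refine ⟨fun i => ⟨?_, fun x hx => ?_⟩, h0⟩
    · refine IntervalIntegrable.add ?_ ?_ <;>
      · refine (intervalIntegrable_of_memLp (P.sqInt_coef z _ _)).mul_continuousOn ?_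
        rw [uIcc_of_le zero_le_one]
        exact hcij _
    · change F x i j = F 0 i j + ∫ t in (0 : ℝ)..x,
        (P.coef z i 0 t * F t 0 j + P.coef z i 1 t * F t 1 j)
      rw [h x hx i j, h0 i]
      simp only [hmul]
  · intro h
    refine ⟨?_, fun x hx i j => ?_⟩
    · exact continuousOn_pi.2 fun i => continuousOn_pi.2 fun j => ((h j).1 i).continuousOn
    · have e := ((h j).1 i).eq_add_integral x hx
      beta_reduce at e
      rw [(h j).2 i] at e
      simpa only [hmul] using e

/-- The Volterra operator of the connection form. -/
noncomputable def volterraOp (z : ℂ) : VecUI →L[ℂ] VecUI := matVolterra (P.coef z) (P.sqInt_coef z)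

theorem isExtendedFrame_extendedFrame (z : ℂ) : P.IsExtendedFrame z (P.extendedFrame z) := by
  refine Classical.epsilon_spec (p := P.IsExtendedFrame z) ⟨fun t => Matrix.of fun i j =>
    extUI (vecSol (P.coef z) (P.sqInt_coef z) (fun i => (1 : Matrix (Fin 2) (Fin 2) ℂ) i j) i) t, ?_⟩
  rw [isExtendedFrame_iff]
  exact fun j => ⟨isVecSol_vecSol (P.sqInt_coef z) _, fun i =>
    extUI_vecSol_zero (P.sqInt_coef z) _ i⟩

theorem isVecSol_extendedFrame (z : ℂ) (j : Fin 2) :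
    IsVecSol (P.coef z) fun i t => P.extendedFrame z t i j :=
  (((P.isExtendedFrame_iff z _).1 (P.isExtendedFrame_extendedFrame z)) j).1

theorem extendedFrame_zero (z : ℂ) : P.extendedFrame z 0 = 1 := by
  ext i j
  exact (((P.isExtendedFrame_iff z _).1 (P.isExtendedFrame_extendedFrame z)) j).2 i

theorem monodromy_eq (z : ℂ) : P.monodromy z = P.extendedFrame z 1 := by
  rw [monodromy, extendedFrame_zero, inv_one, mul_one]

theorem exists_isVecSol (z p q : ℂ) : ∃ y, IsVecSol (P.coef z) y ∧ y 0 0 = p ∧ y 1 0 = q :=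
  ⟨_, (P.isVecSol_extendedFrame z 0).combination (P.isVecSol_extendedFrame z 1) p q, by
    simp [extendedFrame_zero], by simp [extendedFrame_zero]⟩

/-- All later information on the monodromy is extracted through this: any solution, with whatever
initial value is convenient, gives linear relations between its entries. -/
theorem _root_.SinhGordon.IsVecSol.monodromy_mul {z : ℂ} {y : Fin 2 → ℝ → ℂ}
    (hy : IsVecSol (P.coef z) y) (i : Fin 2) :
    y i 1 = P.monodromy z i 0 * y 0 0 + P.monodromy z i 1 * y 1 0 := by
  rw [hy.eq_at_one (P.sqInt_coef z) ((P.isVecSol_extendedFrame z 0).combination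
    (P.isVecSol_extendedFrame z 1) (y 0 0) (y 1 0)) (fun i => by
      fin_cases i <;> simp [extendedFrame_zero]) i, monodromy_eq]
  ring

/-- The connection form is trace free, so the Wronskian of the two columns is constant. -/
theorem det_monodromy (z : ℂ) : (P.monodromy z).det = 1 := by
  have h0 := P.isVecSol_extendedFrame z 0
  have h1 := P.isVecSol_extendedFrame z 1
  have h := ((h0 0).mul (h1 1)).sub ((h1 0).mul (h0 1))
  have e := h.eq_add_integral 1 (by simp)
  rw [intervalIntegral.integral_zero_ae (Eventually.of_forall fun t _ => by
    simp only [coef, alpha]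
    simp
    ring)] at e
  rw [monodromy_eq, Matrix.det_fin_two]
  simpa [extendedFrame_zero] using e

theorem monodromy_apply_eq_vecSol (z : ℂ) (i j : Fin 2) : P.monodromy z i j =
    (Ring.inverse (1 - P.volterraOp z) fun i => ContinuousMap.const _
      ((1 : Matrix (Fin 2) (Fin 2) ℂ) i j)) i ⟨1, by simp⟩ := by
  have := (P.isVecSol_extendedFrame z j).eq_vecSol (P.sqInt_coef z) i (x := 1) (by simp)
  rw [monodromy_eq, this, extendedFrame_zero]
  rfl

theorem volterraOp_eq (z : ℂ) : P.volterraOp z =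
    matVolterra (P.coefPart 0) (P.sqInt_coefPart 0) +
      z • matVolterra (P.coefPart 1) (P.sqInt_coefPart 1) +
      z⁻¹ • matVolterra (P.coefPart (-1)) (P.sqInt_coefPart (-1)) := by
  have key : ∀ i j (f : C(UI, ℂ)) (x : UI), volterra (P.coef z i j) (P.sqInt_coef z i j) f x =
      volterra (P.coefPart 0 i j) (P.sqInt_coefPart 0 i j) f x +
      z * volterra (P.coefPart 1 i j) (P.sqInt_coefPart 1 i j) f x +
      z⁻¹ * volterra (P.coefPart (-1) i j) (P.sqInt_coefPart (-1) i j) f x := fun i j f x => by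
    have hi : ∀ n, IntervalIntegrable (fun t => P.coefPart n i j t * extUI f t) volume 0 x :=
      fun n => intervalIntegrable_zero_of_mem
        (intervalIntegrable_mul_extUI (P.sqInt_coefPart n i j) f) x.2
    simp only [volterra_apply, coef_eq]
    rw [← intervalIntegral.integral_const_mul, ← intervalIntegral.integral_const_mul,
      ← intervalIntegral.integral_add (hi 0) ((hi 1).const_mul z),
      ← intervalIntegral.integral_add ((hi 0).add ((hi 1).const_mul z)) ((hi (-1)).const_mul z⁻¹)]
    refine intervalIntegral.integral_congr fun t _ => ?_
    ring
  refine ContinuousLinearMap.ext fun f => funext fun i => ContinuousMap.ext fun x => ?_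
  simp only [volterraOp, add_apply, smul_apply, Pi.add_apply, Pi.smul_apply,
    ContinuousMap.add_apply, ContinuousMap.smul_apply, matVolterra_apply, smul_eq_mul, key]
  ring

theorem differentiableAt_clm_inverse_one_sub_laurent {R : Type*} [NormedRing R] [NormedAlgebra ℂ R]
    [CompleteSpace R] (A B C : R) {z : ℂ} (hz : z ≠ 0)
    (hu : IsUnit (1 - (A + z • B + z⁻¹ • C))) (E : R →L[ℂ] ℂ) :
    DifferentiableAt ℂ (fun z : ℂ => E (Ring.inverse (1 - (A + z • B + z⁻¹ • C)))) z :=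
  E.differentiableAt.comp z <| DifferentiableAt.inverse ((differentiableAt_const _).sub (((differentiableAt_const _).add
    (differentiableAt_id.smul_const _)).add ((differentiableAt_inv hz).smul_const _))) hu

/-- The entry is a continuous linear functional of the inverse of `1 - V(z)`, where `V(z)` is a
Laurent polynomial in `z`; inversion is holomorphic on units. -/
theorem differentiableOn_monodromy (i j : Fin 2) :
    DifferentiableOn ℂ (fun z => P.monodromy z i j) {0}ᶜ := by
  intro z hz
  refine DifferentiableAt.differentiableWithinAt ?_
  simp only [monodromy_apply_eq_vecSol]
  let v : VecUI := fun i => ContinuousMap.const _ ((1 : Matrix (Fin 2) (Fin 2) ℂ) i j)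
  let E : (VecUI →L[ℂ] VecUI) →L[ℂ] ℂ :=
    ((ContinuousMap.evalCLM ℂ (⟨1, by simp⟩ : UI)).comp
      (ContinuousLinearMap.proj (R := ℂ) (φ := fun _ : Fin 2 => C(UI, ℂ)) i)).comp
      (ContinuousLinearMap.apply ℂ VecUI v)
  have hu : IsUnit (1 - P.volterraOp z) := isUnit_one_sub_matVolterra (P.sqInt_coef z)
  change DifferentiableAt ℂ (fun z => E (Ring.inverse (1 - P.volterraOp z))) z
  rw [volterraOp_eq] at hu
  simp only [volterraOp_eq]
  exact differentiableAt_clm_inverse_one_sub_laurent (R := VecUI →L[ℂ] VecUI) _ _ _ hz hu E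

theorem analyticAt_monodromy {z : ℂ} (hz : z ≠ 0) (i j : Fin 2) :
    AnalyticAt ℂ (fun z => P.monodromy z i j) z :=
  (P.differentiableOn_monodromy i j).analyticAt (isOpen_compl_singleton.mem_nhds hz)

/-! ### The symmetry `z ↦ z⁻¹` -/

/-- The potential `(u, -u_y)`. -/
def flip : Pot where
  u := P.u
  uy := fun x => -P.uy x
  continuousOn_u := P.continuousOn_u
  exists_weakDeriv := P.exists_weakDeriv
  memLp_uy := P.memLp_uy.neg
  periodic := P.periodic

/-- The rotation by a right angle conjugates the connection form of (u, -u_y) at z⁻¹ into that of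
(u, u_y) at z. -/
theorem isVecSol_flip {z : ℂ} {y : Fin 2 → ℝ → ℂ} (hy : IsVecSol (P.flip.coef z⁻¹) y) :
    IsVecSol (P.coef z) ![fun t => -y 1 t, y 0] := by
  intro i
  fin_cases i
  · refine ((hy 1).const_mul (-1)).congr (fun t _ => by simp) (fun t _ => ?_)
    simp [coef, alpha, flip]
    ring
  · refine (hy 0).congr (fun t _ => by simp) (fun t _ => ?_)
    simp [coef, alpha, flip]
    ring

/-- Transports the asymptotics at ∞ to 0. Since c at `z` becomes b at `z⁻¹`, every estimate at ∞ has
to cover b as well. -/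
theorem monodromy_flip (z : ℂ) : P.monodromy z 0 0 = P.flip.monodromy z⁻¹ 1 1 ∧
    P.monodromy z 0 1 = -P.flip.monodromy z⁻¹ 1 0 ∧ P.monodromy z 1 0 = -P.flip.monodromy z⁻¹ 0 1 ∧
    P.monodromy z 1 1 = P.flip.monodromy z⁻¹ 0 0 := by
  obtain ⟨y, hy, y0, y1⟩ := P.flip.exists_isVecSol z⁻¹ 1 0
  obtain ⟨w, hw, w0, w1⟩ := P.flip.exists_isVecSol z⁻¹ 0 1
  have a0 := hy.monodromy_mul P.flip 0
  have a1 := hy.monodromy_mul P.flip 1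
  have b0 := hw.monodromy_mul P.flip 0
  have b1 := hw.monodromy_mul P.flip 1
  have c0 := (P.isVecSol_flip hy).monodromy_mul P 0
  have c1 := (P.isVecSol_flip hy).monodromy_mul P 1
  have d0 := (P.isVecSol_flip hw).monodromy_mul P 0
  have d1 := (P.isVecSol_flip hw).monodromy_mul P 1
  simp [y0, y1, w0, w1] at a0 a1 b0 b1 c0 c1 d0 d1
  refine ⟨?_, ?_, ?_, ?_⟩
  · linear_combination b1 - d0
  · linear_combination -c0 - a1
  · linear_combination d1 - b0
  · linear_combination -c1 + a0

end Pot

end SinhGordon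

namespace SinhGordon

/-! ### A Duhamel estimate for nearly diagonal systems -/

/-- The function ∫b - e^{-Lt}∫S is nondecreasing, because its derivative is at least (1 - e^{-Lt})b.
This bounds ∫S over `[0,1]` by e^L ∫b, and the hypothesis at `t = 1` finishes. -/
theorem gronwall_integral {S b : ℝ → ℝ} {L : ℝ} (hL : 0 ≤ L) (hS : ContinuousOn S (Icc 0 1))
    (hb : ContinuousOn b (Icc 0 1)) (hb0 : ∀ t ∈ Icc (0 : ℝ) 1, 0 ≤ b t)
    (h : ∀ t ∈ Icc (0 : ℝ) 1, S t ≤ b t + L * ∫ τ in (0 : ℝ)..t, S τ) :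
    S 1 ≤ b 1 + L * Real.exp L * ∫ τ in (0 : ℝ)..1, b τ := by
  -- Constant continuation beyond the endpoints makes the primitives differentiable on the whole
  -- line.
  wlog hc : Continuous S ∧ Continuous b generalizing S b
  · let S' := IccExtend zero_le_one ((Icc (0 : ℝ) 1).domRestrict S)
    let b' := IccExtend zero_le_one ((Icc (0 : ℝ) 1).domRestrict b)
    have eS : ∀ t ∈ Icc (0 : ℝ) 1, S' t = S t := fun t ht => IccExtend_of_mem _ _ ht
    have eb : ∀ t ∈ Icc (0 : ℝ) 1, b' t = b t := fun t ht => IccExtend_of_mem _ _ ht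
    have hS' : Continuous S' := (continuousOn_iff_continuous_domRestrict.1 hS).Icc_extend'
    have hb' : Continuous b' := (continuousOn_iff_continuous_domRestrict.1 hb).Icc_extend'
    have iS : ∀ t ∈ Icc (0 : ℝ) 1, ∫ τ in (0 : ℝ)..t, S' τ = ∫ τ in (0 : ℝ)..t, S τ := fun t ht =>
      intervalIntegral.integral_congr fun τ hτ => eS τ (by
        rw [uIcc_of_le ht.1] at hτ; exact ⟨hτ.1, hτ.2.trans ht.2⟩)
    have ib : ∫ τ in (0 : ℝ)..1, b' τ = ∫ τ in (0 : ℝ)..1, b τ :=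
      intervalIntegral.integral_congr fun τ hτ => eb τ (by
        rwa [uIcc_of_le zero_le_one] at hτ)
    have := @this S' b' hS'.continuousOn hb'.continuousOn
      (fun t ht => by rw [eb t ht]; exact hb0 t ht)
      (fun t ht => by rw [eS t ht, eb t ht, iS t ht]; exact h t ht) ⟨hS', hb'⟩
    rwa [eS 1 (by simp), eb 1 (by simp), ib] at this
  obtain ⟨cS, cb⟩ := hc
  have dS : ∀ t, HasDerivAt (fun t => ∫ τ in (0 : ℝ)..t, S τ) (S t) t := fun t =>
    intervalIntegral.integral_hasDerivAt_right (cS.intervalIntegrable _ _)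
      (cS.stronglyMeasurableAtFilter _ _) cS.continuousAt
  have db : ∀ t, HasDerivAt (fun t => ∫ τ in (0 : ℝ)..t, b τ) (b t) t := fun t =>
    intervalIntegral.integral_hasDerivAt_right (cb.intervalIntegrable _ _)
      (cb.stronglyMeasurableAtFilter _ _) cb.continuousAt
  have dQ : ∀ t, HasDerivAt
      (fun t => (∫ τ in (0 : ℝ)..t, b τ) - Real.exp (-L * t) * ∫ τ in (0 : ℝ)..t, S τ)
      (b t - (Real.exp (-L * t) * (-L) * (∫ τ in (0 : ℝ)..t, S τ) + Real.exp (-L * t) * S t)) t :=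
    fun t => (db t).sub ((((hasDerivAt_id t).const_mul (-L)).exp.congr_deriv (by simp)).mul (dS t))
  have hmono : MonotoneOn
      (fun t => (∫ τ in (0 : ℝ)..t, b τ) - Real.exp (-L * t) * ∫ τ in (0 : ℝ)..t, S τ)
      (Icc 0 1) := by
    refine monotoneOn_of_deriv_nonneg (convex_Icc 0 1)
      (fun t _ => (dQ t).continuousAt.continuousWithinAt)
      (fun t _ => (dQ t).differentiableAt.differentiableWithinAt) fun t ht => ?_
    rw [interior_Icc] at ht
    have ht' := Ioo_subset_Icc_self ht
    rw [(dQ t).deriv]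
    have he : Real.exp (-L * t) ≤ 1 := Real.exp_le_one_iff.2 (by nlinarith [ht.1])
    have he0 := Real.exp_pos (-L * t)
    nlinarith [h t ht', hb0 t ht', mul_le_mul_of_nonneg_left (h t ht') he0.le,
      mul_le_mul_of_nonneg_right he (hb0 t ht')]
  have h01 := hmono (show (0 : ℝ) ∈ Icc (0 : ℝ) 1 by simp) (show (1 : ℝ) ∈ Icc (0 : ℝ) 1 by simp)
    zero_le_one
  simp only [intervalIntegral.integral_same, mul_zero, sub_zero, mul_one] at h01
  have hG : ∫ τ in (0 : ℝ)..1, S τ ≤ Real.exp L * ∫ τ in (0 : ℝ)..1, b τ := by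
    have h2 := mul_le_mul_of_nonneg_left h01 (Real.exp_pos L).le
    rw [mul_zero, mul_sub, ← mul_assoc, ← Real.exp_add] at h2
    simp only [add_neg_cancel, Real.exp_zero, one_mul] at h2
    linarith
  calc S 1 ≤ b 1 + L * ∫ τ in (0 : ℝ)..1, S τ := h 1 (by simp)
    _ ≤ b 1 + L * (Real.exp L * ∫ τ in (0 : ℝ)..1, b τ) := by gcongr
    _ = _ := by ring

/-- The oscillatory integrals that control the first order perturbation. -/
noncomputable def osc (v : ℝ → ℂ) (κ : ℂ) (t : ℝ) : ℝ :=
  ‖∫ τ in (0 : ℝ)..t, v τ * Complex.exp (κ * τ)‖ +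
    ‖Complex.exp (κ * t) * ∫ τ in (0 : ℝ)..t, v τ * Complex.exp (-κ * τ)‖

/-- The quadratic mean of the oscillatory integrals. -/
noncomputable def oscSq (v : ℝ → ℂ) (κ : ℂ) : ℝ :=
  osc v κ 1 ^ 2 + ∫ t in (0 : ℝ)..1, osc v κ t ^ 2

theorem continuous_cexp_mul (κ : ℂ) : Continuous fun t : ℝ => Complex.exp (κ * t) := by fun_prop

theorem intervalIntegrable_mul_cexp {v : ℝ → ℂ} (hv : SqInt v) (κ : ℂ) :
    IntervalIntegrable (fun τ => v τ * Complex.exp (κ * τ)) volume 0 1 :=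
  (intervalIntegrable_of_memLp hv).mul_continuousOn (continuous_cexp_mul κ).continuousOn

theorem continuousOn_osc {v : ℝ → ℂ} (hv : SqInt v) (κ : ℂ) : ContinuousOn (osc v κ) (Icc 0 1) :=
  ((hasPrim_integral (intervalIntegrable_mul_cexp hv κ)).continuousOn.norm).add
    (((continuous_cexp_mul κ).continuousOn.mul
      (hasPrim_integral (intervalIntegrable_mul_cexp hv (-κ))).continuousOn).norm)

theorem osc_nonneg (v : ℝ → ℂ) (κ : ℂ) (t : ℝ) : 0 ≤ osc v κ t := by unfold osc; positivity

theorem oscSq_nonneg (v : ℝ → ℂ) (κ : ℂ) : 0 ≤ oscSq v κ :=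
  add_nonneg (sq_nonneg _) (intervalIntegral.integral_nonneg zero_le_one fun _ _ => sq_nonneg _)

theorem hasPrim_cexp_mul (κ : ℂ) :
    HasPrim (fun t : ℝ => Complex.exp (κ * t)) fun t => κ * Complex.exp (κ * t) := by
  refine HasPrim.of_hasDerivAt (fun t => ?_) (by fun_prop)
  have h := ((Complex.ofRealCLM.hasDerivAt (x := t)).const_mul κ).cexp
  simpa [mul_comm] using h

/-- The combined kernel e^{κ(t-τ)} has modulus at most 1 for τ ≤ t, although e^{-κτ} alone may be
large. -/
theorem norm_cexp_mul_integral_le {κ : ℂ} (hκ : κ.re ≤ 0) {h : ℝ → ℂ} {t : ℝ} (ht : 0 ≤ t)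
    (hh : IntervalIntegrable h volume 0 t) :
    ‖Complex.exp (κ * t) * ∫ τ in (0 : ℝ)..t, Complex.exp (-κ * τ) * h τ‖ ≤
      ∫ τ in (0 : ℝ)..t, ‖h τ‖ := by
  rw [← intervalIntegral.integral_const_mul]
  refine intervalIntegral.norm_integral_le_of_norm_le ht (ae_of_all _ fun τ hτ => ?_) hh.norm
  rw [← mul_assoc, ← Complex.exp_add, norm_mul, Complex.norm_exp]
  refine mul_le_of_le_one_left (norm_nonneg _) (Real.exp_le_one_iff.2 ?_)
  have : (κ * t + -κ * τ).re = κ.re * (t - τ) := by simp; ring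
  rw [this]
  exact mul_nonpos_of_nonpos_of_nonneg hκ (sub_nonneg.2 hτ.2)

theorem norm_cexp_mul_le_one {κ : ℂ} (hκ : κ.re ≤ 0) {t : ℝ} (ht : 0 ≤ t) :
    ‖Complex.exp (κ * t)‖ ≤ 1 := by
  rw [Complex.norm_exp]
  exact Real.exp_le_one_iff.2 (by simpa using mul_nonpos_of_nonpos_of_nonneg hκ ht)

theorem sqNorm_add_le {v w : ℝ → ℂ} (hv : SqInt v) (hw : SqInt w) :
    sqNorm (fun t => v t + w t) ≤ 2 * sqNorm v + 2 * sqNorm w := by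
  unfold sqNorm
  rw [← intervalIntegral.integral_const_mul, ← intervalIntegral.integral_const_mul,
    ← intervalIntegral.integral_add (hv.intervalIntegrable_sq.const_mul _)
      (hw.intervalIntegrable_sq.const_mul _)]
  refine intervalIntegral.integral_mono_on zero_le_one (SqInt.intervalIntegrable_sq (hv.add hw))
    ((hv.intervalIntegrable_sq.const_mul _).add (hw.intervalIntegrable_sq.const_mul _))
    fun t _ => ?_
  have h1 := pow_le_pow_left₀ (norm_nonneg _) (norm_add_le (v t) (w t)) 2
  nlinarith [sq_nonneg (‖v t‖ - ‖w t‖)]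

theorem sqNorm_le_sq {r : ℝ → ℂ} (hr : SqInt r) {δ : ℝ} (h : ∀ t ∈ Icc (0 : ℝ) 1, ‖r t‖ ≤ δ) :
    sqNorm r ≤ δ ^ 2 := by
  have := intervalIntegral.integral_mono_on zero_le_one hr.intervalIntegrable_sq
    (intervalIntegrable_const (c := δ ^ 2)) fun t ht => pow_le_pow_left₀ (norm_nonneg _) (h t ht) 2
  simpa [sqNorm] using this

theorem norm_add₅_le (a b c d e : ℂ) :
    ‖a + b + c + d + e‖ ≤ ‖a‖ + ‖b‖ + ‖c‖ + ‖d‖ + ‖e‖ :=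
  (norm_add_le _ _).trans (add_le_add_left norm_add₄_le _)

/-- The constant of the Duhamel estimate. -/
noncomputable def duhamelConst (K : ℝ) : ℝ :=
  48 * (1 + 6 * (2 * K + 3) * Real.exp (6 * (2 * K + 3)))

theorem sq_add_three_le (x y z : ℝ) : (x + y + z) ^ 2 ≤ 3 * (x ^ 2 + y ^ 2 + z ^ 2) := by
  nlinarith [sq_nonneg (x - y), sq_nonneg (y - z), sq_nonneg (x - z)]

/-- The comparison is with the diagonal solution (x₁(0), e^{κt}x₂(0)). As `v` is not small, its
action on this solution is kept as an oscillatory integral; all terms that contain the deviations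
`D₁`, `D₂` are left to Gronwall. Squares are used because `v` is only square integrable. -/
theorem duhamel_estimate {x₁ x₂ v r r' : ℝ → ℂ} {κ : ℂ} {δ : ℝ} (hv : SqInt v) (hr : SqInt r)
    (hr' : SqInt r') (hκ : κ.re ≤ 0) (hδ : δ ≤ 1) (hrδ : ∀ t ∈ Icc (0 : ℝ) 1, ‖r t‖ ≤ δ)
    (hrδ' : ∀ t ∈ Icc (0 : ℝ) 1, ‖r' t‖ ≤ δ)
    (h₁ : HasPrim x₁ fun t => r t * x₁ t + (v t + r' t) * x₂ t)
    (h₂ : HasPrim x₂ fun t => (v t - r' t) * x₁ t + (κ - r t) * x₂ t)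
    (hx₁ : ‖x₁ 0‖ ≤ 1) (hx₂ : ‖x₂ 0‖ ≤ 1) :
    ‖x₁ 1 - x₁ 0‖ ^ 2 + ‖x₂ 1 - Complex.exp κ * x₂ 0‖ ^ 2 ≤
      duhamelConst (sqNorm v) * (oscSq v κ + δ ^ 2) := by
  have hδ0 : 0 ≤ δ := (norm_nonneg _).trans (hrδ 0 (by simp))
  set D₁ : ℝ → ℂ := fun t => x₁ t - x₁ 0 with hD₁
  set D₂ : ℝ → ℂ := fun t => x₂ t - Complex.exp (κ * t) * x₂ 0 with hD₂
  have cD₁ : ContinuousOn D₁ (Icc 0 1) := h₁.continuousOn.sub continuousOn_const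
  have cD₂ : ContinuousOn D₂ (Icc 0 1) :=
    h₂.continuousOn.sub ((continuous_cexp_mul κ).continuousOn.mul continuousOn_const)
  have sD₁ := sqInt_of_continuousOn cD₁
  have sD₂ := sqInt_of_continuousOn cD₂
  set w₁ : ℝ → ℂ := fun t => v t + r' t with hw₁
  set w₂ : ℝ → ℂ := fun t => v t + -r' t with hw₂
  have sw₁ : SqInt w₁ := hv.add hr'
  have sr'n : SqInt (fun t => -r' t) := hr'.neg
  have sw₂ : SqInt w₂ := hv.add sr'n
  set K := sqNorm v
  have hK0 : 0 ≤ K := sqNorm_nonneg v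
  have nr : sqNorm r ≤ 1 := (sqNorm_le_sq hr hrδ).trans (by nlinarith)
  have nr' : sqNorm r' ≤ 1 := (sqNorm_le_sq hr' hrδ').trans (by nlinarith)
  have nw₁ : sqNorm w₁ ≤ 2 * K + 2 := (sqNorm_add_le hv hr').trans (by linarith)
  have nw₂ : sqNorm w₂ ≤ 2 * K + 2 := (sqNorm_add_le hv sr'n).trans (by
    have : sqNorm (fun t => -r' t) = sqNorm r' := by simp [sqNorm]
    linarith)
  have iprod : ∀ {a f : ℝ → ℂ}, SqInt a → ContinuousOn f (Icc 0 1) → ∀ t ∈ Icc (0 : ℝ) 1,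
      IntervalIntegrable (fun τ => a τ * f τ) volume 0 t := fun ha hf t ht =>
    intervalIntegrable_zero_of_mem ((intervalIntegrable_of_memLp ha).mul_continuousOn (by
      rwa [uIcc_of_le zero_le_one])) ht
  have cE : ContinuousOn (fun t : ℝ => Complex.exp (κ * t)) (Icc 0 1) :=
    (continuous_cexp_mul κ).continuousOn
  have cE' : ContinuousOn (fun t : ℝ => Complex.exp (-κ * t)) (Icc 0 1) :=
    (continuous_cexp_mul (-κ)).continuousOn
  have hint_le : ∀ {a : ℝ → ℂ}, SqInt a → (∀ t ∈ Icc (0 : ℝ) 1, ‖a t‖ ≤ δ) →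
      ∀ t ∈ Icc (0 : ℝ) 1, ∫ τ in (0 : ℝ)..t, ‖a τ‖ ≤ δ := fun ha hb t ht => by
    have h1 := intervalIntegral.integral_mono_on ht.1
      (intervalIntegrable_zero_of_mem (intervalIntegrable_of_memLp ha) ht).norm
      (intervalIntegrable_const (c := δ)) fun τ hτ => hb τ ⟨hτ.1, hτ.2.trans ht.2⟩
    refine h1.trans ?_
    simp only [intervalIntegral.integral_const, sub_zero, smul_eq_mul]
    exact mul_le_of_le_one_left hδ0 ht.2
  -- pointwise estimates
  have e₁ : ∀ t ∈ Icc (0 : ℝ) 1, ‖D₁ t‖ ≤ (osc v κ t + 2 * δ) +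
      (∫ τ in (0 : ℝ)..t, ‖r τ‖ * ‖D₁ τ‖) + ∫ τ in (0 : ℝ)..t, ‖w₁ τ‖ * ‖D₂ τ‖ := by
    intro t ht
    have ir := intervalIntegrable_zero_of_mem (intervalIntegrable_of_memLp hr) ht
    have ivE := iprod hv cE t ht
    have irE := iprod hr' cE t ht
    have irD := iprod hr cD₁ t ht
    have iwD := iprod sw₁ cD₂ t ht
    have heq : D₁ t = (∫ τ in (0 : ℝ)..t, r τ) * x₁ 0 +
        (∫ τ in (0 : ℝ)..t, v τ * Complex.exp (κ * τ)) * x₂ 0 +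
        (∫ τ in (0 : ℝ)..t, r' τ * Complex.exp (κ * τ)) * x₂ 0 +
        (∫ τ in (0 : ℝ)..t, r τ * D₁ τ) + ∫ τ in (0 : ℝ)..t, w₁ τ * D₂ τ := by
      rw [← intervalIntegral.integral_mul_const, ← intervalIntegral.integral_mul_const,
        ← intervalIntegral.integral_mul_const,
        ← intervalIntegral.integral_add (ir.mul_const _) (ivE.mul_const _),
        ← intervalIntegral.integral_add ((ir.mul_const _).add (ivE.mul_const _)) (irE.mul_const _),
        ← intervalIntegral.integral_add (((ir.mul_const _).add (ivE.mul_const _)).add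
          (irE.mul_const _)) irD,
        ← intervalIntegral.integral_add ((((ir.mul_const _).add (ivE.mul_const _)).add
          (irE.mul_const _)).add irD) iwD]
      simp only [hD₁]
      rw [h₁.eq_add_integral t ht, add_sub_cancel_left]
      refine intervalIntegral.integral_congr fun τ _ => ?_
      simp only [hw₁, hD₂]
      ring
    have b1 : ‖(∫ τ in (0 : ℝ)..t, r τ) * x₁ 0‖ ≤ δ := by
      rw [norm_mul]
      refine (mul_le_of_le_one_right (norm_nonneg _) hx₁).trans ?_
      exact (intervalIntegral.norm_integral_le_integral_norm ht.1).trans (hint_le hr hrδ t ht)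
    have b2 : ‖(∫ τ in (0 : ℝ)..t, v τ * Complex.exp (κ * τ)) * x₂ 0‖ ≤ osc v κ t := by
      rw [norm_mul]
      exact (mul_le_of_le_one_right (norm_nonneg _) hx₂).trans
        (le_add_of_nonneg_right (norm_nonneg _))
    have b3 : ‖(∫ τ in (0 : ℝ)..t, r' τ * Complex.exp (κ * τ)) * x₂ 0‖ ≤ δ := by
      rw [norm_mul]
      refine (mul_le_of_le_one_right (norm_nonneg _) hx₂).trans ?_
      refine (intervalIntegral.norm_integral_le_integral_norm ht.1).trans
        (le_trans ?_ (hint_le hr' hrδ' t ht))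
      refine intervalIntegral.integral_mono_on ht.1 irE.norm
        (intervalIntegrable_zero_of_mem (intervalIntegrable_of_memLp hr') ht).norm fun τ hτ => ?_
      rw [norm_mul]
      exact mul_le_of_le_one_right (norm_nonneg _) (norm_cexp_mul_le_one hκ hτ.1)
    have b4 : ‖∫ τ in (0 : ℝ)..t, r τ * D₁ τ‖ ≤ ∫ τ in (0 : ℝ)..t, ‖r τ‖ * ‖D₁ τ‖ :=
      (intervalIntegral.norm_integral_le_integral_norm ht.1).trans_eq (by simp only [norm_mul])
    have b5 : ‖∫ τ in (0 : ℝ)..t, w₁ τ * D₂ τ‖ ≤ ∫ τ in (0 : ℝ)..t, ‖w₁ τ‖ * ‖D₂ τ‖ :=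
      (intervalIntegral.norm_integral_le_integral_norm ht.1).trans_eq (by simp only [norm_mul])
    rw [heq]
    refine (norm_add₅_le _ _ _ _ _).trans ?_
    linarith
  have e₂ : ∀ t ∈ Icc (0 : ℝ) 1, ‖D₂ t‖ ≤ (osc v κ t + 2 * δ) +
      (∫ τ in (0 : ℝ)..t, ‖w₂ τ‖ * ‖D₁ τ‖) + ∫ τ in (0 : ℝ)..t, ‖r τ‖ * ‖D₂ τ‖ := by
    intro t ht
    have irE := iprod hr cE t ht
    have iwD := iprod sw₂ cD₁ t ht
    have irD := iprod hr cD₂ t ht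
    have ir' := intervalIntegrable_zero_of_mem (intervalIntegrable_of_memLp hr') ht
    have iE : ∀ {f : ℝ → ℂ}, IntervalIntegrable f volume 0 t →
        IntervalIntegrable (fun τ => Complex.exp (-κ * τ) * f τ) volume 0 t := fun hf =>
      hf.continuousOn_mul (continuous_cexp_mul (-κ)).continuousOn
    have irDn : IntervalIntegrable (fun τ => -(r τ * D₂ τ)) volume 0 t := irD.neg
    have i1 := iprod hv cE' t ht
    have hp := ((hasPrim_cexp_mul (-κ)).mul h₂).eq_add_integral t ht
    have hEE : Complex.exp (κ * t) * Complex.exp (-κ * t) = 1 := by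
      rw [← Complex.exp_add]; simp
    -- Variation of constants: in the derivative of e^{-κτ}x₂ the terms with κ cancel, and x₁, x₂
    -- are expanded around the unperturbed solution.
    have hsplit : ∫ τ in (0 : ℝ)..t, (-κ * Complex.exp (-κ * τ) * x₂ τ + Complex.exp (-κ * τ) *
          ((v τ - r' τ) * x₁ τ + (κ - r τ) * x₂ τ)) =
        (∫ τ in (0 : ℝ)..t, v τ * Complex.exp (-κ * τ)) * x₁ 0 +
        (∫ τ in (0 : ℝ)..t, Complex.exp (-κ * τ) * (r' τ * -x₁ 0)) +
        (∫ τ in (0 : ℝ)..t, Complex.exp (-κ * τ) * (r τ * Complex.exp (κ * τ) * -x₂ 0)) +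
        (∫ τ in (0 : ℝ)..t, Complex.exp (-κ * τ) * (w₂ τ * D₁ τ)) +
        ∫ τ in (0 : ℝ)..t, Complex.exp (-κ * τ) * (-(r τ * D₂ τ)) := by
      rw [← intervalIntegral.integral_mul_const,
        ← intervalIntegral.integral_add (i1.mul_const _) (iE (ir'.mul_const _)),
        ← intervalIntegral.integral_add ((i1.mul_const _).add (iE (ir'.mul_const _)))
          (iE (irE.mul_const _)),
        ← intervalIntegral.integral_add (((i1.mul_const _).add (iE (ir'.mul_const _))).add
          (iE (irE.mul_const _))) (iE iwD),
        ← intervalIntegral.integral_add ((((i1.mul_const _).add (iE (ir'.mul_const _))).add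
          (iE (irE.mul_const _))).add (iE iwD)) (iE irDn)]
      refine intervalIntegral.integral_congr fun τ _ => ?_
      simp only [hw₂, hD₂, hD₁]
      ring
    rw [hsplit] at hp
    simp only [Complex.ofReal_zero, mul_zero, Complex.exp_zero, one_mul] at hp
    set I₁ := ∫ τ in (0 : ℝ)..t, v τ * Complex.exp (-κ * τ) with hI₁
    set I₂ := ∫ τ in (0 : ℝ)..t, Complex.exp (-κ * τ) * (r' τ * -x₁ 0) with hI₂
    set I₃ := ∫ τ in (0 : ℝ)..t, Complex.exp (-κ * τ) * (r τ * Complex.exp (κ * τ) * -x₂ 0) with hI₃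
    set I₄ := ∫ τ in (0 : ℝ)..t, Complex.exp (-κ * τ) * (w₂ τ * D₁ τ) with hI₄
    set I₅ := ∫ τ in (0 : ℝ)..t, Complex.exp (-κ * τ) * (-(r τ * D₂ τ)) with hI₅
    have heq : D₂ t = Complex.exp (κ * t) * I₁ * x₁ 0 + Complex.exp (κ * t) * I₂ +
        Complex.exp (κ * t) * I₃ + Complex.exp (κ * t) * I₄ + Complex.exp (κ * t) * I₅ := by
      simp only [hD₂]
      linear_combination Complex.exp (κ * t) * hp - x₂ t * hEE
    have b1 : ‖Complex.exp (κ * t) * I₁ * x₁ 0‖ ≤ osc v κ t := by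
      rw [norm_mul]
      exact (mul_le_of_le_one_right (norm_nonneg _) hx₁).trans
        (le_add_of_nonneg_left (norm_nonneg _))
    have b2 : ‖Complex.exp (κ * t) * I₂‖ ≤ δ := by
      refine (norm_cexp_mul_integral_le hκ ht.1 (ir'.mul_const _)).trans
        (le_trans ?_ (hint_le hr' hrδ' t ht))
      refine intervalIntegral.integral_mono_on ht.1 (ir'.mul_const _).norm ir'.norm fun τ _ => ?_
      rw [norm_mul, norm_neg]
      exact mul_le_of_le_one_right (norm_nonneg _) hx₁
    have b3 : ‖Complex.exp (κ * t) * I₃‖ ≤ δ := by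
      refine (norm_cexp_mul_integral_le hκ ht.1 (irE.mul_const _)).trans
        (le_trans ?_ (hint_le hr hrδ t ht))
      refine intervalIntegral.integral_mono_on ht.1 (irE.mul_const _).norm
        (intervalIntegrable_zero_of_mem (intervalIntegrable_of_memLp hr) ht).norm fun τ hτ => ?_
      rw [norm_mul, norm_neg, norm_mul]
      exact (mul_le_of_le_one_right (by positivity) hx₂).trans
        (mul_le_of_le_one_right (norm_nonneg _) (norm_cexp_mul_le_one hκ hτ.1))
    have b4 : ‖Complex.exp (κ * t) * I₄‖ ≤ ∫ τ in (0 : ℝ)..t, ‖w₂ τ‖ * ‖D₁ τ‖ :=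
      (norm_cexp_mul_integral_le hκ ht.1 iwD).trans_eq (by simp only [norm_mul])
    have b5 : ‖Complex.exp (κ * t) * I₅‖ ≤ ∫ τ in (0 : ℝ)..t, ‖r τ‖ * ‖D₂ τ‖ :=
      (norm_cexp_mul_integral_le hκ ht.1 irD.neg).trans_eq (by
        simp only [Pi.neg_apply, norm_neg, norm_mul])
    rw [heq]
    refine (norm_add₅_le _ _ _ _ _).trans ?_
    linarith
  -- Gronwall for the squares
  set L := 6 * (2 * K + 3) with hL
  have hmain := gronwall_integral (S := fun t => ‖D₁ t‖ ^ 2 + ‖D₂ t‖ ^ 2)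
    (b := fun t => 12 * osc v κ t ^ 2 + 48 * δ ^ 2) (L := L) (by positivity)
    ((cD₁.norm.pow 2).add (cD₂.norm.pow 2))
    (((continuousOn_osc hv κ).pow 2).const_mul 12 |>.add continuousOn_const)
    (fun t _ => by positivity) (fun t ht => by
      have iS₁ : IntervalIntegrable (fun τ => ‖D₁ τ‖ ^ 2) volume 0 t :=
        (ContinuousOn.intervalIntegrable (by
          rw [uIcc_of_le ht.1]
          exact (cD₁.norm.pow 2).mono (Icc_subset_Icc_right ht.2)))
      have iS₂ : IntervalIntegrable (fun τ => ‖D₂ τ‖ ^ 2) volume 0 t :=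
        (ContinuousOn.intervalIntegrable (by
          rw [uIcc_of_le ht.1]
          exact (cD₂.norm.pow 2).mono (Icc_subset_Icc_right ht.2)))
      rw [intervalIntegral.integral_add iS₁ iS₂]
      have p₁ : 0 ≤ ∫ τ in (0 : ℝ)..t, ‖D₁ τ‖ ^ 2 :=
        intervalIntegral.integral_nonneg ht.1 fun _ _ => sq_nonneg _
      have p₂ : 0 ≤ ∫ τ in (0 : ℝ)..t, ‖D₂ τ‖ ^ 2 :=
        intervalIntegral.integral_nonneg ht.1 fun _ _ => sq_nonneg _
      have c1 := sq_integral_norm_mul_norm_le hr sD₁ ht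
      have c2 := sq_integral_norm_mul_norm_le sw₁ sD₂ ht
      have c3 := sq_integral_norm_mul_norm_le sw₂ sD₁ ht
      have c4 := sq_integral_norm_mul_norm_le hr sD₂ ht
      have q1 := mul_le_mul_of_nonneg_right nr p₁
      have q2 := mul_le_mul_of_nonneg_right nw₁ p₂
      have q3 := mul_le_mul_of_nonneg_right nw₂ p₁
      have q4 := mul_le_mul_of_nonneg_right nr p₂
      have s1 := (pow_le_pow_left₀ (norm_nonneg _) (e₁ t ht) 2).trans (sq_add_three_le _ _ _)
      have s2 := (pow_le_pow_left₀ (norm_nonneg _) (e₂ t ht) 2).trans (sq_add_three_le _ _ _)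
      have s3 : (osc v κ t + 2 * δ) ^ 2 ≤ 2 * osc v κ t ^ 2 + 8 * δ ^ 2 := by
        nlinarith [sq_nonneg (osc v κ t - 2 * δ)]
      have k1 := mul_nonneg hK0 p₁
      have k2 := mul_nonneg hK0 p₂
      nlinarith)
  have iJ : IntervalIntegrable (fun t => osc v κ t ^ 2) volume 0 1 :=
    ContinuousOn.intervalIntegrable (by
      rw [uIcc_of_le zero_le_one]; exact (continuousOn_osc hv κ).pow 2)
  rw [intervalIntegral.integral_add (iJ.const_mul 12) intervalIntegrable_const,
    intervalIntegral.integral_const_mul, intervalIntegral.integral_const] at hmain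
  simp only [hD₁, hD₂, Complex.ofReal_one, mul_one, sub_zero, smul_eq_mul, one_mul] at hmain
  refine hmain.trans ?_
  rw [mul_comm (Complex.exp κ)] at *
  have hosc : 0 ≤ osc v κ 1 ^ 2 := sq_nonneg _
  have hoscI : 0 ≤ ∫ t in (0 : ℝ)..1, osc v κ t ^ 2 :=
    intervalIntegral.integral_nonneg zero_le_one fun _ _ => sq_nonneg _
  have hM : 0 ≤ L * Real.exp L := by positivity
  have hδ2 : 0 ≤ δ ^ 2 := sq_nonneg _
  unfold duhamelConst oscSq
  rw [← hL]
  nlinarith [mul_nonneg hM hosc, mul_nonneg hM hoscI, mul_nonneg hM hδ2]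

end SinhGordon

namespace SinhGordon

/-! ### Bounds of the oscillatory integrals -/

theorem integral_norm_cexp_sq_le {κ : ℂ} (hκ : κ.re < 0) {t : ℝ} :
    ∫ τ in (0 : ℝ)..t, ‖Complex.exp (κ * τ)‖ ^ 2 ≤ 1 / (2 * -κ.re) := by
  have hn : ∀ τ : ℝ, ‖Complex.exp (κ * τ)‖ ^ 2 = Real.exp (2 * κ.re * τ) := fun τ => by
    rw [Complex.norm_exp, ← Real.exp_nat_mul]
    congr 1; simp; ring
  simp only [hn]
  rw [intervalIntegral.integral_comp_mul_left (fun x => Real.exp x) (by linarith : 2 * κ.re ≠ 0)]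
  rw [integral_exp, mul_zero, Real.exp_zero, smul_eq_mul, one_div]
  have h1 := Real.exp_pos (2 * κ.re * t)
  have h2 : (2 * κ.re)⁻¹ = -(2 * -κ.re)⁻¹ := by rw [← inv_neg]; congr 1; ring
  rw [h2]
  have h3 : 0 < (2 * -κ.re)⁻¹ := inv_pos.2 (by linarith)
  nlinarith

/-- Cauchy-Schwarz against e^{κτ}, whose squared L² norm is at most 1/(2|Re κ|). The second integral
takes the same form after τ ↦ t - τ. -/
theorem osc_sq_le_of_re_neg {v : ℝ → ℂ} (hv : SqInt v) {κ : ℂ} (hκ : κ.re < 0) {t : ℝ}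
    (ht : t ∈ Icc (0 : ℝ) 1) : osc v κ t ^ 2 ≤ 2 * sqNorm v / -κ.re := by
  have hK := sqNorm_nonneg v
  have h1 : ‖∫ τ in (0 : ℝ)..t, v τ * Complex.exp (κ * τ)‖ ^ 2 ≤ sqNorm v * (1 / (2 * -κ.re)) :=
    (sq_norm_integral_mul_le hv (sqInt_of_continuousOn (continuous_cexp_mul κ).continuousOn)
      ht).trans (mul_le_mul_of_nonneg_left (integral_norm_cexp_sq_le hκ) hK)
  have h2 : ‖Complex.exp (κ * t) * ∫ τ in (0 : ℝ)..t, v τ * Complex.exp (-κ * τ)‖ ^ 2 ≤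
      sqNorm v * (1 / (2 * -κ.re)) := by
    have e : Complex.exp (κ * t) * ∫ τ in (0 : ℝ)..t, v τ * Complex.exp (-κ * τ) =
        ∫ τ in (0 : ℝ)..t, v τ * Complex.exp (κ * ((t - τ : ℝ) : ℂ)) := by
      rw [← intervalIntegral.integral_const_mul]
      refine intervalIntegral.integral_congr fun τ _ => ?_
      rw [mul_left_comm, ← Complex.exp_add]
      congr 2; push_cast; ring
    rw [e]
    have hc : Continuous fun τ : ℝ => Complex.exp (κ * ((t - τ : ℝ) : ℂ)) := by fun_prop
    refine (sq_norm_integral_mul_le hv (sqInt_of_continuousOn hc.continuousOn) ht).trans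
      (mul_le_mul_of_nonneg_left ?_ hK)
    rw [intervalIntegral.integral_comp_sub_left
      (fun x : ℝ => ‖Complex.exp (κ * (x : ℂ))‖ ^ 2) t, sub_self, sub_zero]
    exact integral_norm_cexp_sq_le hκ
  unfold osc
  have h3 : 2 * sqNorm v / -κ.re = 4 * (sqNorm v * (1 / (2 * -κ.re))) := by
    field_simp; ring
  rw [h3]
  set x := ‖∫ τ in (0 : ℝ)..t, v τ * Complex.exp (κ * τ)‖
  set y := ‖Complex.exp (κ * t) * ∫ τ in (0 : ℝ)..t, v τ * Complex.exp (-κ * τ)‖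
  nlinarith [sq_nonneg (x - y)]

theorem oscSq_le_of_le {v : ℝ → ℂ} (hv : SqInt v) {κ : ℂ} {b : ℝ → ℝ}
    (hb : IntervalIntegrable b volume 0 1)
    (h : ∀ t ∈ Icc (0 : ℝ) 1, osc v κ t ^ 2 ≤ b t) :
    oscSq v κ ≤ b 1 + ∫ t in (0 : ℝ)..1, b t :=
  add_le_add (h 1 (by simp)) (intervalIntegral.integral_mono_on zero_le_one
    (ContinuousOn.intervalIntegrable (by
      rw [uIcc_of_le zero_le_one]; exact (continuousOn_osc hv κ).pow 2)) hb h)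

theorem oscSq_le_of_re_neg {v : ℝ → ℂ} (hv : SqInt v) {κ : ℂ} (hκ : κ.re < 0) :
    oscSq v κ ≤ 4 * sqNorm v / -κ.re := by
  refine (oscSq_le_of_le hv (b := fun _ => 2 * sqNorm v / -κ.re) intervalIntegrable_const
    fun t ht => osc_sq_le_of_re_neg hv hκ ht).trans_eq ?_
  simp; ring

/-- Fourier coefficients of the restriction of `v` to `[0,t]`. -/
noncomputable def partialFourier (v : ℝ → ℂ) (n : ℤ) (t : ℝ) : ℂ :=
  ∫ τ in (0 : ℝ)..t, v τ * Complex.exp (-(2 * Real.pi * n * Complex.I) * τ)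

/-- Parseval for the truncation of `v` to (0,t]. The bound does not depend on `t`, so it can be
integrated over `t`. -/
theorem sum_sq_norm_partialFourier_le {v : ℝ → ℂ} (hv : SqInt v) {t : ℝ}
    (ht : t ∈ Icc (0 : ℝ) 1) (S : Finset ℤ) :
    ∑ n ∈ S, ‖partialFourier v n t‖ ^ 2 ≤ sqNorm v := by
  have hL : MemLp ((Ioc 0 t).indicator v) 2 (volume.restrict (Ioc (0 : ℝ) 1)) :=
    MemLp.indicator measurableSet_Ioc (hv.restrict (x := 1) (by simp))
  have h := hasSum_sq_fourierCoeffOn zero_lt_one hL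
  have hcoef : ∀ n : ℤ, fourierCoeffOn zero_lt_one ((Ioc 0 t).indicator v) n =
      partialFourier v n t := fun n => by
    rw [fourierCoeffOn_eq_integral, partialFourier, intervalIntegral.integral_of_le zero_le_one,
      intervalIntegral.integral_of_le ht.1]
    have : ∀ x : ℝ, fourier (-n) (x : AddCircle (1 - 0 : ℝ)) • (Ioc 0 t).indicator v x =
        (Ioc 0 t).indicator
          (fun τ => v τ * Complex.exp (-(2 * Real.pi * n * Complex.I) * τ)) x := fun x => by
      by_cases hx : x ∈ Ioc 0 t
      · rw [indicator_of_mem hx, indicator_of_mem hx, fourier_coe_apply, smul_eq_mul, mul_comm]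
        congr 2; push_cast; simp only [sub_zero, div_one]; ring
      · rw [indicator_of_notMem hx, indicator_of_notMem hx, smul_zero]
    simp only [this, sub_zero, div_one, one_smul]
    rw [setIntegral_indicator measurableSet_Ioc, Ioc_inter_Ioc]
    simp [ht.2]
  simp only [hcoef, sub_zero, inv_one, one_smul] at h
  refine (sum_le_hasSum S (fun _ _ => sq_nonneg _) h).trans ?_
  refine intervalIntegral.integral_mono_on zero_le_one ?_ hv.intervalIntegrable_sq fun x _ => ?_
  · rw [intervalIntegrable_iff_integrableOn_Ioc_of_le zero_le_one]
    exact hL.integrable_norm_pow (by norm_num)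
  · exact pow_le_pow_left₀ (norm_nonneg _) (norm_indicator_le_norm_self _ _) 2

theorem hasPrim_partialFourier {v : ℝ → ℂ} (hv : SqInt v) (n : ℤ) :
    HasPrim (partialFourier v n)
      fun τ => v τ * Complex.exp (-(2 * Real.pi * n * Complex.I) * τ) :=
  hasPrim_integral (intervalIntegrable_mul_cexp hv _)

theorem sum_sqNorm_partialFourier_le {v : ℝ → ℂ} (hv : SqInt v) (S : Finset ℤ) :
    ∑ n ∈ S, sqNorm (partialFourier v n) ≤ sqNorm v := by
  have hi : ∀ n, IntervalIntegrable (fun t => ‖partialFourier v n t‖ ^ 2) volume 0 1 := fun n =>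
    (sqInt_of_continuousOn (hasPrim_partialFourier hv n).continuousOn).intervalIntegrable_sq
  have h := intervalIntegral.integral_mono_on zero_le_one
    (IntervalIntegrable.sum S (f := fun n t => ‖partialFourier v n t‖ ^ 2) fun n _ => hi n)
    (intervalIntegrable_const (c := sqNorm v)) fun t ht => by
      simpa using sum_sq_norm_partialFourier_le hv ht S
  rw [intervalIntegral.integral_const, sub_zero, one_smul] at h
  refine le_trans (le_of_eq ?_) h
  unfold sqNorm
  rw [← intervalIntegral.integral_finsetSum fun n _ => hi n]
  simp

/-- A summable bound of the oscillatory integrals near `k π`. -/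
noncomputable def oscBound (v : ℝ → ℂ) (k : ℤ) : ℝ :=
  (‖partialFourier v k 1‖ ^ 2 + 3 * sqNorm (partialFourier v k)) +
    (‖partialFourier v (-k) 1‖ ^ 2 + 3 * sqNorm (partialFourier v (-k)))

theorem oscBound_nonneg (v : ℝ → ℂ) (k : ℤ) : 0 ≤ oscBound v k := by
  have h1 := sqNorm_nonneg (partialFourier v k)
  have h2 := sqNorm_nonneg (partialFourier v (-k))
  unfold oscBound; positivity

theorem summable_oscBound {v : ℝ → ℂ} (hv : SqInt v) : Summable (oscBound v) := by
  have h1 : Summable fun k : ℤ => ‖partialFourier v k 1‖ ^ 2 + 3 * sqNorm (partialFourier v k) :=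
    (summable_of_sum_le (fun _ => sq_nonneg _)
      fun S => sum_sq_norm_partialFourier_le hv (t := 1) (by simp) S).add
    ((summable_of_sum_le (fun _ => sqNorm_nonneg _) fun S =>
      sum_sqNorm_partialFourier_le hv S).mul_left 3)
  exact h1.add ((Equiv.neg ℤ).summable_iff.2 h1)

/-- Partial integration puts the derivative on the slowly varying factor e^{dτ}, so frequencies near
a lattice point are controlled by the partial Fourier integrals at that lattice point. -/
theorem norm_integral_mul_cexp_le {v : ℝ → ℂ} (hv : SqInt v) (n : ℤ) {d : ℂ} {ρ : ℝ}
    (hd : ‖d‖ ≤ ρ) {t : ℝ} (ht : t ∈ Icc (0 : ℝ) 1) :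
    ‖∫ τ in (0 : ℝ)..t, v τ * Complex.exp ((-(2 * Real.pi * n * Complex.I) + d) * τ)‖ ≤
      (1 + ρ) * Real.exp ρ *
        (‖partialFourier v n t‖ + ∫ τ in (0 : ℝ)..1, ‖partialFourier v n τ‖) := by
  have hρ : 0 ≤ ρ := (norm_nonneg d).trans hd
  have hF := hasPrim_partialFourier hv n
  have hp := (hF.mul (hasPrim_cexp_mul d)).eq_add_integral t ht
  have hFi : IntervalIntegrable (fun τ => ‖partialFourier v n τ‖) volume 0 1 :=
    ContinuousOn.intervalIntegrable (by rw [uIcc_of_le zero_le_one]; exact hF.continuousOn.norm)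
  have i2 : IntervalIntegrable (fun τ : ℝ => partialFourier v n τ * (d * Complex.exp (d * τ)))
      volume 0 1 := ContinuousOn.intervalIntegrable (by
    rw [uIcc_of_le zero_le_one]
    exact hF.continuousOn.mul (by fun_prop))
  have i1 : IntervalIntegrable (fun τ : ℝ => v τ * Complex.exp
      (-(2 * Real.pi * n * Complex.I) * τ) * Complex.exp (d * τ)) volume 0 1 :=
    hF.integrable.mul_continuousOn (continuous_cexp_mul d).continuousOn
  rw [intervalIntegral.integral_add (intervalIntegrable_zero_of_mem i1 ht)
    (intervalIntegrable_zero_of_mem i2 ht)] at hp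
  have h0 : partialFourier v n 0 = 0 := by simp [partialFourier]
  have e : ∫ τ in (0 : ℝ)..t, v τ * Complex.exp ((-(2 * Real.pi * n * Complex.I) + d) * τ) =
      ∫ τ in (0 : ℝ)..t, v τ * Complex.exp (-(2 * Real.pi * n * Complex.I) * τ) *
        Complex.exp (d * τ) :=
    intervalIntegral.integral_congr fun τ _ => by
      rw [mul_assoc (v τ), ← Complex.exp_add, add_mul]
  have hE : ∀ τ ∈ Icc (0 : ℝ) 1, ‖Complex.exp (d * τ)‖ ≤ Real.exp ρ := fun τ hτ => by
    refine (Complex.norm_exp_le_exp_norm _).trans (Real.exp_le_exp.2 ?_)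
    rw [norm_mul, Complex.norm_real, Real.norm_of_nonneg hτ.1]
    exact (mul_le_of_le_one_right (norm_nonneg _) hτ.2).trans hd
  have hb : ‖∫ τ in (0 : ℝ)..t, partialFourier v n τ * (d * Complex.exp (d * τ))‖ ≤
      ρ * Real.exp ρ * ∫ τ in (0 : ℝ)..1, ‖partialFourier v n τ‖ := by
    refine (intervalIntegral.norm_integral_le_integral_norm ht.1).trans ?_
    refine (intervalIntegral.integral_mono_interval le_rfl ht.1 ht.2
      (Eventually.of_forall fun _ => norm_nonneg _) i2.norm).trans ?_
    rw [← intervalIntegral.integral_const_mul]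
    refine intervalIntegral.integral_mono_on zero_le_one i2.norm (hFi.const_mul _) fun τ hτ => ?_
    rw [norm_mul, norm_mul, mul_comm]
    exact mul_le_mul_of_nonneg_right (mul_le_mul hd (hE τ hτ) (norm_nonneg _) hρ) (norm_nonneg _)
  have hI : 0 ≤ ∫ τ in (0 : ℝ)..1, ‖partialFourier v n τ‖ :=
    intervalIntegral.integral_nonneg zero_le_one fun _ _ => norm_nonneg _
  have hEt := hE t ht
  have hexp := Real.exp_pos ρ
  rw [h0, zero_mul, zero_add] at hp
  rw [e, eq_sub_of_add_eq hp.symm]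
  refine (norm_sub_le _ _).trans ?_
  rw [norm_mul]
  have h1 := mul_le_mul_of_nonneg_left hEt (norm_nonneg (partialFourier v n t))
  have h2 : 0 ≤ ρ * Real.exp ρ * ‖partialFourier v n t‖ := by positivity
  have h3 : 0 ≤ Real.exp ρ * ∫ τ in (0 : ℝ)..1, ‖partialFourier v n τ‖ := by positivity
  nlinarith

theorem sq_integral_norm_le {f : ℝ → ℂ} (hf : SqInt f) :
    (∫ τ in (0 : ℝ)..1, ‖f τ‖) ^ 2 ≤ sqNorm f := by
  have h := sq_integral_norm_mul_norm_le (a := fun _ => 1)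
    (sqInt_of_continuousOn continuousOn_const) hf (x := 1) (by simp)
  simpa [sqNorm] using h

/-- Here κ = -2πik + d with |d| ≤ 2ρ. The second part of `osc` contains -κ, hence the index `-k`;
its outer factor e^{κt} is bounded by e^{2ρ}, since -2πik is imaginary. -/
theorem oscSq_le_oscBound {v : ℝ → ℂ} (hv : SqInt v) {ρ : ℝ} {k : ℤ} {ζ : ℂ}
    (h : ‖ζ - k * Real.pi‖ ≤ ρ) : oscSq v (-2 * Complex.I * ζ) ≤
      4 * ((1 + 2 * ρ) * Real.exp (2 * ρ) * Real.exp (2 * ρ)) ^ 2 * oscBound v k := by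
  have hρ : 0 ≤ ρ := (norm_nonneg _).trans h
  set A := (1 + 2 * ρ) * Real.exp (2 * ρ) * Real.exp (2 * ρ) with hA
  have hA0 : 0 ≤ A := by positivity
  set κ := -2 * Complex.I * ζ with hκ
  set d := -2 * Complex.I * (ζ - k * Real.pi) with hd
  have hdn : ‖d‖ ≤ 2 * ρ := by
    rw [hd, norm_mul, norm_mul]
    simp only [norm_neg, Complex.norm_I, mul_one, Complex.norm_ofNat]
    linarith
  have hκd : κ = -(2 * Real.pi * k * Complex.I) + d := by rw [hκ, hd]; ring
  have hκd' : -κ = -(2 * Real.pi * (-k : ℤ) * Complex.I) + -d := by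
    rw [hκd]; push_cast; ring
  have sF : ∀ n, SqInt (partialFourier v n) := fun n =>
    sqInt_of_continuousOn (hasPrim_partialFourier hv n).continuousOn
  set I := fun n => ∫ τ in (0 : ℝ)..1, ‖partialFourier v n τ‖ with hI
  have hI0 : ∀ n, 0 ≤ I n := fun n =>
    intervalIntegral.integral_nonneg zero_le_one fun _ _ => norm_nonneg _
  have hIs : ∀ n, I n ^ 2 ≤ sqNorm (partialFourier v n) := fun n => sq_integral_norm_le (sF n)
  have hexp1 : 1 ≤ Real.exp (2 * ρ) := Real.one_le_exp (by positivity)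
  set a := (1 + 2 * ρ) * Real.exp (2 * ρ) with ha
  have ha0 : 0 ≤ a := by positivity
  have haA : a ≤ A := le_mul_of_one_le_right ha0 hexp1
  have hosc : ∀ t ∈ Icc (0 : ℝ) 1, osc v κ t ≤ A * ((‖partialFourier v k t‖ + I k) +
      (‖partialFourier v (-k) t‖ + I (-k))) := fun t ht => by
    have h1 := norm_integral_mul_cexp_le hv k hdn ht
    have h2 := norm_integral_mul_cexp_le hv (-k) (d := -d) (ρ := 2 * ρ) (by rwa [norm_neg]) ht
    rw [← hκd] at h1
    rw [← hκd'] at h2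
    have hEt : ‖Complex.exp (κ * t)‖ ≤ Real.exp (2 * ρ) := by
      have e1 : (κ * t).re = (d * t).re := by rw [hκd]; simp
      rw [Complex.norm_exp, e1, ← Complex.norm_exp]
      refine (Complex.norm_exp_le_exp_norm _).trans (Real.exp_le_exp.2 ?_)
      rw [norm_mul, Complex.norm_real, Real.norm_of_nonneg ht.1]
      exact (mul_le_of_le_one_right (norm_nonneg _) ht.2).trans hdn
    have g1 : 0 ≤ ‖partialFourier v k t‖ + I k := add_nonneg (norm_nonneg _) (hI0 k)
    have g2 : 0 ≤ ‖partialFourier v (-k) t‖ + I (-k) := add_nonneg (norm_nonneg _) (hI0 _)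
    unfold osc
    rw [norm_mul, mul_add]
    refine add_le_add (h1.trans (mul_le_mul_of_nonneg_right haA g1)) ?_
    calc _ ≤ Real.exp (2 * ρ) * (a * (‖partialFourier v (-k) t‖ + I (-k))) :=
          mul_le_mul hEt h2 (norm_nonneg _) (Real.exp_pos _).le
      _ = _ := by rw [hA]; ring
  have hb := oscSq_le_of_le hv (κ := κ) (b := fun t => 4 * A ^ 2 *
      ((‖partialFourier v k t‖ ^ 2 + sqNorm (partialFourier v k)) +
        (‖partialFourier v (-k) t‖ ^ 2 + sqNorm (partialFourier v (-k)))))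
    (((((sF k).intervalIntegrable_sq).add intervalIntegrable_const).add
      (((sF (-k)).intervalIntegrable_sq).add intervalIntegrable_const)).const_mul _) fun t ht => by
      refine (pow_le_pow_left₀ (osc_nonneg _ _ _) (hosc t ht) 2).trans ?_
      rw [mul_pow, mul_comm 4, mul_assoc]
      refine mul_le_mul_of_nonneg_left ?_ (sq_nonneg A)
      have j1 := hIs k
      have j2 := hIs (-k)
      set x := ‖partialFourier v k t‖
      set y := ‖partialFourier v (-k) t‖
      nlinarith [sq_nonneg (x - I k), sq_nonneg (y - I (-k)), sq_nonneg (x - y),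
        sq_nonneg (x - I (-k)), sq_nonneg (y - I k), sq_nonneg (I k - I (-k))]
  refine hb.trans ?_
  rw [intervalIntegral.integral_const_mul, intervalIntegral.integral_add
    (((sF k).intervalIntegrable_sq).add intervalIntegrable_const)
    (((sF (-k)).intervalIntegrable_sq).add intervalIntegrable_const),
    intervalIntegral.integral_add ((sF k).intervalIntegrable_sq) intervalIntegrable_const,
    intervalIntegral.integral_add ((sF (-k)).intervalIntegrable_sq) intervalIntegrable_const]
  simp only [intervalIntegral.integral_const, sub_zero, one_smul]
  unfold oscBound
  have e : ∀ n, ∫ t in (0 : ℝ)..1, ‖partialFourier v n t‖ ^ 2 = sqNorm (partialFourier v n) :=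
    fun n => rfl
  rw [e, e]
  apply le_of_eq
  ring

theorem exists_round (ζ : ℂ) : ∃ k : ℤ, |ζ.re - k * Real.pi| ≤ Real.pi / 2 := by
  refine ⟨round (ζ.re / Real.pi), ?_⟩
  have h := abs_sub_round (ζ.re / Real.pi)
  have e : ζ.re - round (ζ.re / Real.pi) * Real.pi =
      (ζ.re / Real.pi - round (ζ.re / Real.pi)) * Real.pi := by
    field_simp
  rw [e, abs_mul, abs_of_pos Real.pi_pos]
  nlinarith [Real.pi_pos]

/-- A Riemann-Lebesgue lemma, uniform on the closed lower half-plane. Far below the real axis the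
decay in Im ζ suffices; in the remaining strip ζ is at bounded distance from some kπ, and the
summable bound is small for all but finitely many `k`. -/
theorem exists_forall_oscSq_le {v : ℝ → ℂ} (hv : SqInt v) {ε : ℝ} (hε : 0 < ε) :
    ∃ R : ℝ, ∀ ζ : ℂ, ζ.im ≤ 0 → R ≤ ‖ζ‖ → oscSq v (-2 * Complex.I * ζ) ≤ ε := by
  have hK := sqNorm_nonneg v
  -- At depth ρ₀ one has |Re κ| = 2ρ₀, and 4‖v‖²/(2ρ₀) ≤ ε.
  set ρ₀ := 2 * sqNorm v / ε + 1 with hρ₀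
  have hρ₀1 : 1 ≤ ρ₀ := by
    have : 0 ≤ 2 * sqNorm v / ε := by positivity
    linarith
  set ρ := Real.pi / 2 + ρ₀ with hρ
  set A := 4 * ((1 + 2 * ρ) * Real.exp (2 * ρ) * Real.exp (2 * ρ)) ^ 2 with hA
  have hA0 : 0 ≤ A := by positivity
  have ht := ((summable_oscBound hv).mul_left A).tendsto_cofinite_zero
  have hfin : {k : ℤ | ¬ A * oscBound v k < ε}.Finite := by
    have := ht.eventually_lt_const hε
    exact this
  obtain ⟨m, hm⟩ : ∃ m : ℝ, ∀ k ∈ {k : ℤ | ¬ A * oscBound v k < ε}, |(k : ℝ)| ≤ m := by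
    obtain ⟨m, hm⟩ := (hfin.image fun k : ℤ => |(k : ℝ)|).bddAbove
    exact ⟨m, fun k hk => hm ⟨k, hk, rfl⟩⟩
  -- Within the strip, |ζ| of this size forces |k| > m, beyond the exceptional indices.
  refine ⟨ρ₀ + Real.pi / 2 + m * Real.pi + 1, fun ζ him hR => ?_⟩
  have hre : (-2 * Complex.I * ζ).re = 2 * ζ.im := by simp
  by_cases hlarge : ρ₀ ≤ -ζ.im
  · have hneg : (-2 * Complex.I * ζ).re < 0 := by rw [hre]; linarith
    refine (oscSq_le_of_re_neg hv hneg).trans ?_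
    rw [hre, div_le_iff₀ (by linarith)]
    have h1 : 2 * sqNorm v / ε * ε = 2 * sqNorm v := div_mul_cancel₀ _ hε.ne'
    have h2 : ε * ρ₀ ≤ ε * -ζ.im := mul_le_mul_of_nonneg_left hlarge hε.le
    have h3 : ε * ρ₀ = 2 * sqNorm v + ε := by rw [hρ₀]; linarith
    linarith
  · push Not at hlarge
    obtain ⟨k, hk⟩ := exists_round ζ
    have him' : |ζ.im| ≤ ρ₀ := by rw [abs_of_nonpos him]; exact hlarge.le
    have hζk : ‖ζ - k * Real.pi‖ ≤ ρ := by
      refine (Complex.norm_le_abs_re_add_abs_im _).trans (add_le_add ?_ ?_)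
      · simpa using hk
      · simpa using him'
    refine (oscSq_le_oscBound hv hζk).trans ?_
    by_contra hcon
    push Not at hcon
    have hkm : |(k : ℝ)| ≤ m := hm k (by simpa [hA] using hcon.le)
    have : ‖ζ‖ ≤ |ζ.re| + |ζ.im| := Complex.norm_le_abs_re_add_abs_im _
    have hre' : |ζ.re| ≤ Real.pi / 2 + |(k : ℝ)| * Real.pi := by
      have := abs_add_le (ζ.re - k * Real.pi) (k * Real.pi)
      rw [sub_add_cancel, abs_mul, abs_of_pos Real.pi_pos] at this
      linarith
    have := mul_le_mul_of_nonneg_right hkm Real.pi_pos.le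
    linarith

end SinhGordon

namespace SinhGordon

/-! ### The gauge transformation at `λ = ∞` -/

/-- `ζ` as a function of `s = λ^{1/2}`. -/
noncomputable def zet (s : ℂ) : ℂ := (s + s⁻¹) / 4

namespace Pot

variable (P : Pot)

/-- The coordinates of a solution after gauging and diagonalization of the leading part; the sign
`ε = ±1` selects the coordinate. -/
noncomputable def gaugeCoord (s ε : ℂ) (y : Fin 2 → ℝ → ℂ) (t : ℝ) : ℂ :=
  1 / 2 * (Complex.exp (-(Complex.I * zet s) * t) *
    (Complex.exp (-1 / 4 * P.u t) * y 0 t + ε * (Complex.I * s⁻¹) * (Complex.exp (1 / 4 * P.u t) * y 1 t)))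

/-- The diagonal coefficient of the perturbation of the gauged system. -/
noncomputable def pertDiag (s : ℂ) (t : ℝ) : ℂ :=
  Complex.I / 4 * s⁻¹ * ((Complex.exp (P.u t) + Complex.exp (-P.u t)) / 2 - 1)

/-- The off-diagonal coefficient of the perturbation of the gauged system. -/
noncomputable def pertOff (s : ℂ) (t : ℝ) : ℂ :=
  Complex.I / 4 * s⁻¹ * ((Complex.exp (P.u t) - Complex.exp (-P.u t)) / 2)

/-- The pointwise identity behind `hasPrim_gaugeCoord`, with `G` for e^{u/4} and `E` for e^{-iζt} as
free variables. -/
theorem gauge_algebra {G s uy ux y0 y1 E : ℂ} (hG : G ≠ 0) (hs : s ≠ 0) (ε : ℂ) (hε : ε * ε = 1) :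
    1 / 2 * (-(Complex.I * ((s + s⁻¹) / 4)) * E * (G⁻¹ * y0 + ε * (Complex.I * s⁻¹) * (G * y1)) +
      E * ((-1 / 4 * ux * G⁻¹ * y0 + G⁻¹ * (1 / 4 * (Complex.I * uy) * y0 +
          1 / 4 * (-G ^ 2 - (s ^ 2)⁻¹ * (G⁻¹) ^ 2) * y1)) +
        ε * (Complex.I * s⁻¹) * (1 / 4 * ux * G * y1 + G * (1 / 4 * (G ^ 2 + s ^ 2 * (G⁻¹) ^ 2) * y0 +
          1 / 4 * (-(Complex.I * uy)) * y1)))) =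
    (Complex.I / 4 * s⁻¹ * ε * ((G ^ 4 + (G⁻¹) ^ 4) / 2 - 1) + (ε - 1) * (Complex.I * ((s + s⁻¹) / 4))) *
        (1 / 2 * (E * (G⁻¹ * y0 + ε * (Complex.I * s⁻¹) * (G * y1)))) +
      (1 / 4 * (Complex.I * uy - ux) + ε * (Complex.I / 4 * s⁻¹ * ((G ^ 4 - (G⁻¹) ^ 4) / 2))) *
        (1 / 2 * (E * (G⁻¹ * y0 + -ε * (Complex.I * s⁻¹) * (G * y1)))) := by
  have hε2 : ε ^ 2 = 1 := by rw [sq, hε]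
  field_simp
  ring_nf
  simp only [Complex.I_sq, hε2]
  ring

/-- Differentiating the gauge factors e^{±u/4} produces u_x, which joins i u_y off the diagonal. The
large parameter stays on the diagonal, with eigenvalue 0 for ε = 1 and -2iζ for ε = -1; the rest
carries a factor s⁻¹. -/
theorem hasPrim_gaugeCoord {ux : ℝ → ℂ} (hu : HasPrim P.u ux) {s : ℂ} (hs : s ≠ 0)
    {y : Fin 2 → ℝ → ℂ} (hy : IsVecSol (P.coef (s ^ 2)) y) {ε : ℂ} (hε : ε * ε = 1) :
    HasPrim (P.gaugeCoord s ε y) fun t =>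
      (ε * P.pertDiag s t + (ε - 1) * (Complex.I * zet s)) * P.gaugeCoord s ε y t +
      (1 / 4 * (Complex.I * P.uy t - ux t) + ε * P.pertOff s t) * P.gaugeCoord s (-ε) y t := by
  have hG := (hu.const_mul (1 / 4)).cexp
  have hH := (hu.const_mul (-1 / 4)).cexp
  have hp := ((hasPrim_cexp_mul (-(Complex.I * zet s))).mul ((hH.mul (hy 0)).add
    ((hG.mul (hy 1)).const_mul (ε * (Complex.I * s⁻¹))))).const_mul (1 / 2)
  refine hp.congr (fun t _ => rfl) fun t _ => ?_
  have hGH : Complex.exp (-1 / 4 * P.u t) = (Complex.exp (1 / 4 * P.u t))⁻¹ := by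
    rw [← Complex.exp_neg]; congr 1; ring
  have h2 : Complex.exp (P.u t / 2) = Complex.exp (1 / 4 * P.u t) ^ 2 := by
    rw [← Complex.exp_nat_mul]; congr 1; push_cast; ring
  have h2' : Complex.exp (-P.u t / 2) = (Complex.exp (1 / 4 * P.u t))⁻¹ ^ 2 := by
    rw [← Complex.exp_neg, ← Complex.exp_nat_mul]; congr 1; push_cast; ring
  have h4 : Complex.exp (P.u t) = Complex.exp (1 / 4 * P.u t) ^ 4 := by
    rw [← Complex.exp_nat_mul]; congr 1; push_cast; ring
  have h4' : Complex.exp (-P.u t) = (Complex.exp (1 / 4 * P.u t))⁻¹ ^ 4 := by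
    rw [← Complex.exp_neg, ← Complex.exp_nat_mul]; congr 1; push_cast; ring
  have key := gauge_algebra (G := Complex.exp (1 / 4 * P.u t)) (s := s) (uy := P.uy t) (ux := ux t)
    (y0 := y 0 t) (y1 := y 1 t) (E := Complex.exp (-(Complex.I * zet s) * t))
    (Complex.exp_ne_zero _) hs ε hε
  have a00 : P.coef (s ^ 2) 0 0 t = 1 / 4 * (Complex.I * P.uy t) := by simp [coef, alpha]
  have a01 : P.coef (s ^ 2) 0 1 t = 1 / 4 * (-Complex.exp (P.u t / 2) -
    (s ^ 2)⁻¹ * Complex.exp (-P.u t / 2)) := by simp [coef, alpha]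
  have a10 : P.coef (s ^ 2) 1 0 t = 1 / 4 * (Complex.exp (P.u t / 2) +
    s ^ 2 * Complex.exp (-P.u t / 2)) := by simp [coef, alpha]
  have a11 : P.coef (s ^ 2) 1 1 t = 1 / 4 * (-(Complex.I * P.uy t)) := by simp [coef, alpha]
  unfold gaugeCoord pertDiag pertOff
  rw [a00, a01, a10, a11, hGH, h2, h2', h4, h4']
  rw [show zet s = (s + s⁻¹) / 4 from rfl] at key ⊢
  linear_combination -key

theorem exists_pert_bound : ∃ C : ℝ, 0 ≤ C ∧ ∀ s : ℂ, ∀ t ∈ Icc (0 : ℝ) 1,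
    ‖P.pertDiag s t‖ ≤ C / ‖s‖ ∧ ‖P.pertOff s t‖ ≤ C / ‖s‖ := by
  obtain ⟨C, hC⟩ := isCompact_Icc.exists_bound_of_continuousOn P.continuousOn_u
  have hC0 : 0 ≤ C := (norm_nonneg _).trans (hC 0 (by simp))
  refine ⟨1 / 4 * (Real.exp C + 1), by positivity, fun s t ht => ?_⟩
  have h1 : ‖Complex.exp (P.u t)‖ ≤ Real.exp C :=
    (Complex.norm_exp_le_exp_norm _).trans (Real.exp_le_exp.2 (hC t ht))
  have h2 : ‖Complex.exp (-P.u t)‖ ≤ Real.exp C :=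
    (Complex.norm_exp_le_exp_norm _).trans (Real.exp_le_exp.2 (by rw [norm_neg]; exact hC t ht))
  have h0 : ‖Complex.I / 4 * s⁻¹‖ = 1 / 4 / ‖s‖ := by
    rw [norm_mul, norm_div, norm_inv, Complex.norm_I, Complex.norm_ofNat]; rfl
  have e : 1 / 4 * (Real.exp C + 1) / ‖s‖ = 1 / 4 / ‖s‖ * (Real.exp C + 1) := by ring
  have hexp := Real.exp_pos C
  unfold pertDiag pertOff
  rw [e, norm_mul (Complex.I / 4 * s⁻¹), norm_mul (Complex.I / 4 * s⁻¹), h0]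
  refine ⟨mul_le_mul_of_nonneg_left ?_ (by positivity),
    mul_le_mul_of_nonneg_left ?_ (by positivity)⟩
  · refine (norm_sub_le _ _).trans ?_
    rw [norm_div, Complex.norm_ofNat, norm_one]
    have := norm_add_le (Complex.exp (P.u t)) (Complex.exp (-P.u t))
    linarith
  · rw [norm_div, Complex.norm_ofNat]
    have := norm_sub_le (Complex.exp (P.u t)) (Complex.exp (-P.u t))
    linarith

theorem continuousOn_pert (s : ℂ) : ContinuousOn (P.pertDiag s) (Icc 0 1) ∧
    ContinuousOn (P.pertOff s) (Icc 0 1) := by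
  have h1 : ContinuousOn (fun t => Complex.exp (P.u t)) (Icc 0 1) :=
    Complex.continuous_exp.comp_continuousOn P.continuousOn_u
  have h2 : ContinuousOn (fun t => Complex.exp (-P.u t)) (Icc 0 1) :=
    Complex.continuous_exp.comp_continuousOn P.continuousOn_u.neg
  exact ⟨continuousOn_const.mul (((h1.add h2).div_const 2).sub continuousOn_const),
    continuousOn_const.mul ((h1.sub h2).div_const 2)⟩

/-- The deviation of the monodromy from the one of the vacuum, after normalization, is at most
`η`. -/
def NearVacuum (s : ℂ) (η : ℝ) : Prop :=
  ‖Complex.exp (-(Complex.I * zet s)) * P.monodromy (s ^ 2) 0 0 -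
    (1 + Complex.exp (-2 * Complex.I * zet s)) / 2‖ ≤ η ∧
  ‖Complex.exp (-(Complex.I * zet s)) * P.monodromy (s ^ 2) 1 1 -
    (1 + Complex.exp (-2 * Complex.I * zet s)) / 2‖ ≤ η ∧
  ‖Complex.exp (-(Complex.I * zet s)) *
    (P.monodromy (s ^ 2) 1 0 * Complex.exp (P.u 0 / 2) * s⁻¹) -
    (1 - Complex.exp (-2 * Complex.I * zet s)) / (2 * Complex.I)‖ ≤ η ∧
  ‖Complex.exp (-(Complex.I * zet s)) *
    (P.monodromy (s ^ 2) 0 1 * Complex.exp (-P.u 0 / 2) * s) +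
    (1 - Complex.exp (-2 * Complex.I * zet s)) / (2 * Complex.I)‖ ≤ η

/-- Duhamel's estimate for the two solutions that are basis vectors in the gauged coordinates at 0;
undoing gauge and diagonalization recovers the entries. -/
theorem exists_nearVacuum : ∃ v : ℝ → ℂ, SqInt v ∧ ∃ C : ℝ, 1 ≤ C ∧ ∀ s : ℂ, C ≤ ‖s‖ →
    (zet s).im ≤ 0 → ∀ η : ℝ, 0 ≤ η →
    C * (oscSq v (-2 * Complex.I * zet s) + 1 / ‖s‖ ^ 2) ≤ η ^ 2 → P.NearVacuum s η := by
  obtain ⟨ux, hux, hu⟩ := P.exists_hasPrim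
  obtain ⟨Cp, hCp0, hCp⟩ := P.exists_pert_bound
  set v : ℝ → ℂ := fun t => 1 / 4 * (Complex.I * P.uy t - ux t) with hv
  have sv : SqInt v := ((P.memLp_uy.const_mul Complex.I).sub hux).const_mul (1 / 4)
  set K := duhamelConst (sqNorm v) with hK
  have hK0 : 0 ≤ K := by
    have := sqNorm_nonneg v
    rw [hK]; unfold duhamelConst; positivity
  -- The part 1 + Cp makes δ ≤ 1; the part 4K(1 + Cp²) brings the squared deviation below η²/4.
  refine ⟨v, sv, 1 + Cp + 4 * K * (1 + Cp ^ 2), by nlinarith [mul_nonneg hK0 (sq_nonneg Cp)],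
    fun s hs him η hη0 hη => ?_⟩
  unfold NearVacuum
  have hsn : 1 + Cp ≤ ‖s‖ := by nlinarith [mul_nonneg hK0 (sq_nonneg Cp)]
  have hs0 : 0 < ‖s‖ := by linarith
  have hs1 : s ≠ 0 := norm_pos_iff.1 hs0
  set κ := -2 * Complex.I * zet s with hκ
  have hκre : κ.re ≤ 0 := by
    have : κ.re = 2 * (zet s).im := by simp [hκ]
    linarith
  set δ := Cp / ‖s‖ with hδ
  have hδ1 : δ ≤ 1 := by rw [hδ, div_le_one hs0]; linarith
  have hest : K * (oscSq v κ + δ ^ 2) ≤ η ^ 2 / 4 := by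
    have h1 : δ ^ 2 = Cp ^ 2 * (1 / ‖s‖ ^ 2) := by rw [hδ]; ring
    have h2 := oscSq_nonneg v κ
    have h3 : 0 ≤ 1 / ‖s‖ ^ 2 := by positivity
    rw [h1]
    have p1 : 0 ≤ oscSq v κ + 1 / ‖s‖ ^ 2 := by positivity
    have p2 := mul_nonneg hK0 p1
    have p3 : K * (oscSq v κ + Cp ^ 2 * (1 / ‖s‖ ^ 2)) ≤
        K * (1 + Cp ^ 2) * (oscSq v κ + 1 / ‖s‖ ^ 2) := by
      have q1 := mul_nonneg (mul_nonneg hK0 (sq_nonneg Cp)) h2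
      have q2 := mul_nonneg hK0 h3
      nlinarith
    have p4 := mul_nonneg (by linarith : 0 ≤ 1 + Cp) p1
    nlinarith
  obtain ⟨cD, cO⟩ := P.continuousOn_pert s
  have sD := sqInt_of_continuousOn cD
  have sO := sqInt_of_continuousOn cO
  have hcol : ∀ y : Fin 2 → ℝ → ℂ, IsVecSol (P.coef (s ^ 2)) y →
      ‖P.gaugeCoord s 1 y 0‖ ≤ 1 → ‖P.gaugeCoord s (-1) y 0‖ ≤ 1 →
      ‖P.gaugeCoord s 1 y 1 - P.gaugeCoord s 1 y 0‖ ≤ η / 2 ∧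
      ‖P.gaugeCoord s (-1) y 1 - Complex.exp κ * P.gaugeCoord s (-1) y 0‖ ≤ η / 2 := by
    intro y hy b1 b2
    have h1 := P.hasPrim_gaugeCoord hu hs1 hy (ε := 1) (by norm_num)
    have h2 := P.hasPrim_gaugeCoord hu hs1 hy (ε := -1) (by norm_num)
    have hd := duhamel_estimate sv sD sO hκre hδ1 (fun t ht => (hCp s t ht).1)
      (fun t ht => (hCp s t ht).2)
      (h1.congr (fun _ _ => rfl) fun t _ => by simp only [hv]; ring)
      (h2.congr (fun _ _ => rfl) fun t _ => by simp only [hv, hκ, neg_neg]; ring) b1 b2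
    have hd' := hd.trans hest
    constructor <;> refine abs_le_of_sq_le_sq' ?_ (by positivity) |>.2
    · nlinarith [sq_nonneg ‖P.gaugeCoord s (-1) y 1 - Complex.exp κ * P.gaugeCoord s (-1) y 0‖]
    · nlinarith [sq_nonneg ‖P.gaugeCoord s 1 y 1 - P.gaugeCoord s 1 y 0‖]
  set G := Complex.exp (1 / 4 * P.u 0) with hG
  have hG0 : G ≠ 0 := Complex.exp_ne_zero _
  have hGi : Complex.exp (-1 / 4 * P.u 0) = G⁻¹ := by
    rw [hG, ← Complex.exp_neg]; congr 1; ring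
  have hG2 : Complex.exp (P.u 0 / 2) = G ^ 2 := by
    rw [hG, ← Complex.exp_nat_mul]; congr 1; push_cast; ring
  have hG2' : Complex.exp (-P.u 0 / 2) = (G ^ 2)⁻¹ := by
    rw [← hG2, ← Complex.exp_neg]; congr 1; ring
  have hcoord0 : ∀ ε y, P.gaugeCoord s ε y 0 =
      1 / 2 * (G⁻¹ * y 0 0 + ε * (Complex.I * s⁻¹) * (G * y 1 0)) := fun ε y => by
    simp only [gaugeCoord, hGi, ← hG]; simp
  -- Here u(0) = u(1) enters: the gauge factors at both ends agree.
  have hcoord1 : ∀ ε y, P.gaugeCoord s ε y 1 = 1 / 2 * (Complex.exp (-(Complex.I * zet s)) *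
      (G⁻¹ * y 0 1 + ε * (Complex.I * s⁻¹) * (G * y 1 1))) := fun ε y => by
    simp only [gaugeCoord, ← P.periodic, hGi, ← hG]; simp
  -- These initial values have the gauged coordinates (1,0), and those of `w` are (0,1).
  obtain ⟨y, hy, y0, y1⟩ := P.exists_isVecSol (s ^ 2) G (-(Complex.I * s * G⁻¹))
  obtain ⟨w, hw, w0, w1⟩ := P.exists_isVecSol (s ^ 2) G (Complex.I * s * G⁻¹)
  have Y0 := hy.monodromy_mul P 0
  have Y1 := hy.monodromy_mul P 1
  have W0 := hw.monodromy_mul P 0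
  have W1 := hw.monodromy_mul P 1
  have hI := Complex.I_mul_I
  have cy1 : P.gaugeCoord s 1 y 0 = 1 := by
    rw [hcoord0, y0, y1]; field_simp; linear_combination -hI
  have cy2 : P.gaugeCoord s (-1) y 0 = 0 := by
    rw [hcoord0, y0, y1]; field_simp; linear_combination hI
  have cw1 : P.gaugeCoord s 1 w 0 = 0 := by
    rw [hcoord0, w0, w1]; field_simp; linear_combination hI
  have cw2 : P.gaugeCoord s (-1) w 0 = 1 := by
    rw [hcoord0, w0, w1]; field_simp; linear_combination -hI
  obtain ⟨d1, d2⟩ := hcol y hy (by simp [cy1]) (by simp [cy2])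
  obtain ⟨d3, d4⟩ := hcol w hw (by simp [cw1]) (by simp [cw2])
  rw [cy1] at d1
  rw [cy2, mul_zero, sub_zero] at d2
  rw [cw1, sub_zero] at d3
  rw [cw2, mul_one] at d4
  rw [hcoord1, Y0, Y1, y0, y1] at d1 d2
  rw [hcoord1, W0, W1, w0, w1] at d3 d4
  set E := Complex.exp (-(Complex.I * zet s)) with hE
  set a := P.monodromy (s ^ 2) 0 0
  set b := P.monodromy (s ^ 2) 0 1
  set c := P.monodromy (s ^ 2) 1 0
  set d := P.monodromy (s ^ 2) 1 1
  have hIne := Complex.I_ne_zero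
  -- Each normalized entry differs from the vacuum by half a signed sum of the four coordinate
  -- errors, possibly divided by i.
  have four : ∀ {p q r t : ℂ}, ‖p‖ ≤ η / 2 → ‖q‖ ≤ η / 2 → ‖r‖ ≤ η / 2 → ‖t‖ ≤ η / 2 →
      ∀ e : ℂ, ‖e‖ = 1 / 2 → ‖e * (p + q + r + t)‖ ≤ η := fun hp hq hr ht e he => by
    rw [norm_mul, he]
    have := @norm_add₄_le _ _ _ _ _ _ |>.trans (add_le_add (add_le_add (add_le_add hp hq) hr) ht)
    linarith
  have hhalf : ‖(1 / 2 : ℂ)‖ = 1 / 2 := by simp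
  have hhalf2 : ‖(1 / (2 * Complex.I) : ℂ)‖ = 1 / 2 := by simp
  have n1 := (norm_neg _).trans_le d1
  have n2 := (norm_neg _).trans_le d2
  have n3 := (norm_neg _).trans_le d3
  have n4 := (norm_neg _).trans_le d4
  have e3 := Complex.I_sq
  refine ⟨?_, ?_, ?_, ?_⟩
  · refine le_of_eq_of_le (congrArg _ ?_) (four d1 d2 d3 d4 (1 / 2) hhalf)
    field_simp
    ring
  · refine le_of_eq_of_le (congrArg _ ?_) (four d1 n2 n3 d4 (1 / 2) hhalf)
    field_simp
    ring_nf
    simp only [e3]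
    ring
  · refine le_of_eq_of_le (congrArg _ ?_) (four d1 n2 d3 n4 (1 / (2 * Complex.I)) hhalf2)
    rw [hG2]
    field_simp
    ring_nf
  · refine le_of_eq_of_le (congrArg _ ?_) (four n1 n2 d3 d4 (1 / (2 * Complex.I)) hhalf2)
    rw [hG2']
    field_simp
    ring_nf

end Pot

end SinhGordon

namespace SinhGordon

/-! ### Localization of zeros near infinity -/

/-- The principal logarithm of e^{-2iζ} is -2iζ up to a multiple of 2πi. Multiplying by i/2 turns
|log w| ≤ (3/2)|w - 1| into the constant 3/4. -/
theorem exists_int_near_of_exp_near_one {ζ : ℂ}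
    (h : ‖1 - Complex.exp (-2 * Complex.I * ζ)‖ ≤ 1 / 2) :
    ∃ j : ℤ, ‖ζ - j * Real.pi‖ ≤ ‖1 - Complex.exp (-2 * Complex.I * ζ)‖ := by
  set w := Complex.exp (-2 * Complex.I * ζ) with hw
  have h' : ‖w - 1‖ ≤ 1 / 2 := by rwa [norm_sub_rev]
  have hlog : ‖Complex.log w‖ ≤ 3 / 2 * ‖w - 1‖ := by
    have := Complex.norm_log_one_add_half_le_self h'
    rwa [add_sub_cancel] at this
  obtain ⟨n, hn⟩ := Complex.exp_eq_exp_iff_exists_int.1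
    (show Complex.exp (-2 * Complex.I * ζ) = Complex.exp (Complex.log w) by
      rw [Complex.exp_log (Complex.exp_ne_zero _)])
  refine ⟨-n, ?_⟩
  have e : ζ - ((-n : ℤ) : ℂ) * Real.pi = Complex.I / 2 * Complex.log w := by
    have hI := Complex.I_mul_I
    push_cast
    linear_combination (Complex.I / 2) * hn + (ζ + n * Real.pi) * hI
  rw [e, norm_mul, norm_div, Complex.norm_I, Complex.norm_ofNat, norm_sub_rev]
  nlinarith [norm_nonneg (w - 1)]

namespace Pot

variable (P : Pot)

/-- A consequence of det = 1. This form is quadratic in a - d, b, c, so double vacuum zeros are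
still located to first order in the deviation. -/
theorem Delta_sq_sub_four (z : ℂ) : P.Delta z ^ 2 - 4 =
    (P.monodromy z 0 0 - P.monodromy z 1 1) ^ 2 + 4 * (P.monodromy z 0 1 * P.monodromy z 1 0) := by
  have h := P.det_monodromy z
  rw [Matrix.det_fin_two] at h
  rw [Delta, Matrix.trace_fin_two]
  linear_combination 4 * h

variable {P}

/-- At a zero of c or b the normalized sine σ is itself one of the errors. At a zero of the
discriminant, |σ|² ≤ 2η² + 2|σ|η, whence |σ| ≤ (1 + √3)η. -/
theorem NearVacuum.exp_near_one {s : ℂ} {η : ℝ} (h : P.NearVacuum s η) (hs : s ≠ 0)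
    (hz : P.monodromy (s ^ 2) 1 0 = 0 ∨ P.monodromy (s ^ 2) 0 1 = 0 ∨ P.Delta (s ^ 2) ^ 2 - 4 = 0) :
    ‖1 - Complex.exp (-2 * Complex.I * zet s)‖ ≤ 8 * η := by
  obtain ⟨ha, hd, hc, hb⟩ := h
  have hη := (norm_nonneg _).trans ha
  set σ := (1 - Complex.exp (-2 * Complex.I * zet s)) / (2 * Complex.I) with hσ
  have hσn : ‖1 - Complex.exp (-2 * Complex.I * zet s)‖ = 2 * ‖σ‖ := by
    rw [hσ, norm_div, norm_mul, Complex.norm_I, Complex.norm_ofNat]; ring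
  rw [hσn]
  suffices ‖σ‖ ≤ 4 * η by linarith
  rcases hz with hz | hz | hz
  · rw [hz] at hc
    simp only [zero_mul, mul_zero, zero_sub, norm_neg] at hc
    linarith
  · rw [hz] at hb
    simp only [zero_mul, mul_zero, zero_add] at hb
    linarith
  · rw [P.Delta_sq_sub_four] at hz
    set E := Complex.exp (-(Complex.I * zet s))
    set A := E * P.monodromy (s ^ 2) 0 0
    set D := E * P.monodromy (s ^ 2) 1 1
    set C := E * (P.monodromy (s ^ 2) 1 0 * Complex.exp (P.u 0 / 2) * s⁻¹) with hC
    set B := E * (P.monodromy (s ^ 2) 0 1 * Complex.exp (-P.u 0 / 2) * s) with hB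
    have hBC : B * C = E ^ 2 * (P.monodromy (s ^ 2) 0 1 * P.monodromy (s ^ 2) 1 0) := by
      have e : Complex.exp (-P.u 0 / 2) = (Complex.exp (P.u 0 / 2))⁻¹ := by
        rw [← Complex.exp_neg]; congr 1; ring
      have e' := Complex.exp_ne_zero (P.u 0 / 2)
      rw [hB, hC, e]; field_simp
    have key : (A - D) ^ 2 + 4 * (B * C) = 0 := by
      rw [hBC]; linear_combination E ^ 2 * hz
    have hAD : ‖A - D‖ ≤ 2 * η := by
      have := norm_sub_le (A - (1 + Complex.exp (-2 * Complex.I * zet s)) / 2)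
        (D - (1 + Complex.exp (-2 * Complex.I * zet s)) / 2)
      rw [sub_sub_sub_cancel_right] at this
      linarith
    have e4 : 4 * σ ^ 2 = (A - D) ^ 2 + 4 * (σ * ((B + σ) - (C - σ))) + 4 * ((B + σ) * (C - σ)) := by
      linear_combination -key
    have hn : 4 * ‖σ‖ ^ 2 ≤ (2 * η) ^ 2 + 4 * (‖σ‖ * (η + η)) + 4 * (η * η) := by
      have := congrArg norm e4
      rw [norm_mul, Complex.norm_ofNat, norm_pow] at this
      rw [this]
      refine (norm_add₃_le).trans ?_
      simp only [norm_mul, norm_pow, Complex.norm_ofNat]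
      have h3 := (norm_sub_le (B + σ) (C - σ)).trans (add_le_add hb hc)
      gcongr
    nlinarith [norm_nonneg σ]

theorem NearVacuum.diag_near {s : ℂ} {η : ℝ} (h : P.NearVacuum s η) {j : ℤ}
    (h1 : ‖1 - Complex.exp (-2 * Complex.I * zet s)‖ ≤ 8 * η)
    (hj : ‖zet s - j * Real.pi‖ ≤ 8 * η) (hη : η ≤ 1 / 16) :
    ‖P.monodromy (s ^ 2) 0 0 - (-1) ^ j‖ ≤ 31 * η ∧
    ‖P.monodromy (s ^ 2) 1 1 - (-1) ^ j‖ ≤ 31 * η := by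
  obtain ⟨ha, hd, -, -⟩ := h
  set ε := zet s - j * Real.pi with hε
  have hexp : Complex.exp (Complex.I * zet s) = (-1) ^ j * Complex.exp (Complex.I * ε) := by
    have : Complex.I * zet s = j * (Real.pi * Complex.I) + Complex.I * ε := by rw [hε]; ring
    rw [this, Complex.exp_add, Complex.exp_int_mul, Complex.exp_pi_mul_I]
  have hm1 : ‖((-1 : ℂ)) ^ j‖ = 1 := by simp
  have hIε : ‖Complex.I * ε‖ ≤ 8 * η := by rwa [norm_mul, Complex.norm_I, one_mul]
  have hε2 : ‖Complex.exp (Complex.I * ε) - 1‖ ≤ 2 * (8 * η) :=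
    (Complex.norm_exp_sub_one_le (by linarith)).trans (by linarith)
  have hε3 : ‖Complex.exp (Complex.I * ε)‖ ≤ 3 := by
    have := norm_add_le (Complex.exp (Complex.I * ε) - 1) 1
    rw [sub_add_cancel, norm_one] at this
    linarith
  have main : ∀ m : ℂ, ‖Complex.exp (-(Complex.I * zet s)) * m -
      (1 + Complex.exp (-2 * Complex.I * zet s)) / 2‖ ≤ η → ‖m - (-1) ^ j‖ ≤ 31 * η := fun m hm => by
    -- The factor e^{iε} is at most 3, the bracket at most η + 4η, and e^{iε} - 1 at most 16η, in
    -- total 31η.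
    have e : m - (-1) ^ j = (-1) ^ j * (Complex.exp (Complex.I * ε) *
        ((Complex.exp (-(Complex.I * zet s)) * m - (1 + Complex.exp (-2 * Complex.I * zet s)) / 2) -
          (1 - Complex.exp (-2 * Complex.I * zet s)) / 2) + (Complex.exp (Complex.I * ε) - 1)) := by
      have h0 : Complex.exp (Complex.I * zet s) * Complex.exp (-(Complex.I * zet s)) = 1 := by
        rw [← Complex.exp_add]; simp
      rw [hexp] at h0
      linear_combination -m * h0
    rw [e, norm_mul, hm1, one_mul]
    refine (norm_add_le _ _).trans ?_
    rw [norm_mul]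
    have h2 := norm_sub_le (Complex.exp (-(Complex.I * zet s)) * m -
      (1 + Complex.exp (-2 * Complex.I * zet s)) / 2) ((1 - Complex.exp (-2 * Complex.I * zet s)) / 2)
    rw [norm_div _ (2 : ℂ), Complex.norm_ofNat] at h2
    have h3 := mul_le_mul hε3 (h2.trans (show _ ≤ 5 * η by linarith)) (norm_nonneg _) (by norm_num)
    linarith
  exact ⟨main _ ha, main _ hd⟩

end Pot

/-! ### Location of the square roots of the spectral parameter -/

theorem norm_zet_near (s : ℂ) (j : ℤ) {δ : ℝ} (h : ‖zet s - j * Real.pi‖ ≤ δ) :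
    |‖s‖ - 4 * Real.pi * abs (j : ℝ)| ≤ 4 * δ + 1 / ‖s‖ := by
  have e : s - 4 * j * Real.pi = 4 * (zet s - j * Real.pi) - s⁻¹ := by unfold zet; ring
  have h1 := abs_norm_sub_norm_le s (4 * j * Real.pi)
  have h2 : ‖(4 * j * Real.pi : ℂ)‖ = 4 * Real.pi * abs (j : ℝ) := by
    simp [abs_of_pos Real.pi_pos]; ring
  rw [h2, e] at h1
  have h3 := norm_sub_le (4 * (zet s - j * Real.pi)) s⁻¹
  rw [norm_mul, Complex.norm_ofNat, norm_inv] at h3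
  rw [one_div]
  linarith

/-- The square root `s` of `λ_{k,0}` with `ζ(s) = k π` and `|s| > 1`. -/
noncomputable def sVac (k : ℕ) : ℝ := 2 * Real.pi * k + Real.sqrt (4 * Real.pi ^ 2 * k ^ 2 - 1)

theorem sVac_spec {k : ℕ} (hk : 1 ≤ k) : 1 ≤ sVac k ∧ sVac k ≤ 4 * Real.pi * k ∧
    sVac k + (sVac k)⁻¹ = 4 * Real.pi * k ∧ sVac k ^ 2 = lamVac k := by
  have hk' : (1 : ℝ) ≤ k := by exact_mod_cast hk
  have hπ := Real.pi_gt_three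
  have h0 : 1 ≤ 2 * Real.pi * k := by nlinarith
  have h1 : 0 ≤ 4 * Real.pi ^ 2 * k ^ 2 - 1 := by nlinarith
  have hs := Real.sq_sqrt h1
  have hs0 := Real.sqrt_nonneg (4 * Real.pi ^ 2 * k ^ 2 - 1)
  have hs1 : Real.sqrt (4 * Real.pi ^ 2 * k ^ 2 - 1) ≤ 2 * Real.pi * k := by
    refine Real.sqrt_le_iff.2 ⟨by linarith, by nlinarith⟩
  have p1 : 1 ≤ sVac k := by unfold sVac; linarith
  refine ⟨p1, by unfold sVac; linarith, ?_, ?_⟩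
  · have : sVac k * (4 * Real.pi * k - sVac k) = 1 := by unfold sVac; nlinarith
    rw [inv_eq_of_mul_eq_one_right this]
    ring
  · unfold sVac lamVac; push_cast; nlinarith

/-- With r = `sVac k`, ζ(s) - kπ = (s - r)(1 - (sr)⁻¹)/4, whose second factor is bounded below.
Passing to s² - r² costs a factor of order k, which is the weight -1 in ℓ²_{-1,3}. -/
theorem norm_sq_sub_lamVac_le {s : ℂ} (hs : 4 ≤ ‖s‖) {j : ℤ} (hj : 1 ≤ j.natAbs) {δ : ℝ} (hδ : δ ≤ 1)
    (h : ‖zet s - j * Real.pi‖ ≤ δ) : ‖s ^ 2 - lamVac j.natAbs‖ ≤ 272 * j.natAbs * δ := by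
  have hδ0 := (norm_nonneg _).trans h
  obtain ⟨p1, p2, p3, p4⟩ := sVac_spec hj
  -- `zet` is odd, while s² and |j| do not see the sign.
  wlog hj0 : 0 ≤ j generalizing s j
  · have := this (s := -s) (by rwa [norm_neg]) (j := -j) (by simpa) (by
      rw [← norm_neg, show -(zet (-s) - ((-j : ℤ) : ℂ) * Real.pi) = zet s - j * Real.pi by
        unfold zet; push_cast; rw [inv_neg]; ring]; exact h) (by simpa using p1) (by simpa using p2) (by simpa using p3)
      (by simpa using p4) (by omega)
    simpa using this
  set k := j.natAbs with hk
  have hjk : (j : ℂ) = (k : ℂ) := by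
    have : j = (k : ℤ) := by omega
    rw [this]; simp
  rw [hjk] at h
  have hk1 : (1 : ℝ) ≤ k := by exact_mod_cast hj
  set r := sVac k with hr
  have hs0 : s ≠ 0 := by rintro rfl; simp at hs; linarith
  have hr0 : (r : ℂ) ≠ 0 := by
    have : r ≠ 0 := by linarith
    exact_mod_cast this
  have hrc : (r : ℂ) + (r : ℂ)⁻¹ = 4 * Real.pi * k := by exact_mod_cast congrArg Complex.ofReal p3
  have e1 : zet s - k * Real.pi = (s - r) * (1 - (s * r)⁻¹) / 4 := by
    have : (k : ℂ) * Real.pi = (r + (r : ℂ)⁻¹) / 4 := by rw [hrc]; ring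
    rw [this]; unfold zet; field_simp; ring
  have hsr : 4 ≤ ‖s * r‖ := by
    rw [norm_mul, Complex.norm_real, Real.norm_of_nonneg (by linarith)]; nlinarith
  have h2 : 1 / 2 ≤ ‖1 - (s * r)⁻¹‖ := by
    have := norm_sub_norm_le 1 (s * r)⁻¹
    rw [norm_one, norm_inv] at this
    have h3 : ‖s * r‖⁻¹ ≤ 4⁻¹ := inv_anti₀ (by norm_num) hsr
    linarith
  have h3 : ‖s - r‖ ≤ 8 * δ := by
    rw [e1, norm_div, norm_mul, Complex.norm_ofNat] at h
    nlinarith [norm_nonneg (s - r)]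
  have e2 : s ^ 2 - (lamVac k : ℝ) = (s - r) * ((s - r) + 2 * r) := by
    rw [← p4]; push_cast; ring
  have h4 : ‖(s - r) + 2 * r‖ ≤ 8 * δ + 2 * (4 * Real.pi * k) := by
    refine (norm_add_le _ _).trans (add_le_add h3 ?_)
    rw [norm_mul, Complex.norm_real, Real.norm_of_nonneg (by linarith), Complex.norm_ofNat]
    linarith
  have hπ := Real.pi_lt_d2
  rw [e2, norm_mul]
  calc ‖s - r‖ * ‖(s - r) + 2 * r‖ ≤ 8 * δ * (8 * δ + 2 * (4 * Real.pi * k)) :=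
        mul_le_mul h3 h4 (norm_nonneg _) (by positivity)
    _ ≤ 8 * δ * (34 * k) := by
        refine mul_le_mul_of_nonneg_left ?_ (by positivity)
        nlinarith
    _ = 272 * k * δ := by ring

end SinhGordon

/-! ### Separating circles and asymptotics of the zeros near infinity -/

namespace SinhGordon

/-- This root makes Re(-2iζ) = 2 Im ζ ≤ 0, as Duhamel's estimate requires. -/
theorem exists_sq_eq_im_nonpos (z : ℂ) : ∃ s, s ^ 2 = z ∧ (zet s).im ≤ 0 := by
  obtain ⟨s, hs⟩ := IsAlgClosed.exists_pow_nat_eq z (n := 2) (by norm_num)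
  rcases le_total (zet s).im 0 with h | h
  · exact ⟨s, hs, h⟩
  · refine ⟨-s, by rw [neg_sq, hs], ?_⟩
    have : zet (-s) = -zet s := by unfold zet; rw [inv_neg]; ring
    rw [this, Complex.neg_im]; linarith

/-- The principal root of s² is s or -s, and `zet` is odd. -/
theorem norm_zeta_sq (s : ℂ) : ‖zeta (s ^ 2)‖ = ‖zet s‖ := by
  set t := (s ^ 2) ^ (1 / 2 : ℂ) with ht
  have ht2 : t ^ 2 = s ^ 2 := by
    rw [ht, ← Complex.cpow_nat_mul]; norm_num
  have e : zeta (s ^ 2) = zet t := by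
    rw [zeta, Complex.cpow_neg, zet]
  rw [e]
  rcases sq_eq_sq_iff_eq_or_eq_neg.1 ht2 with h | h
  · rw [h]
  · rw [h, zet, zet, inv_neg, ← norm_neg]; congr 1; ring

theorem norm_zet_le (s : ℂ) : ‖zet s‖ ≤ (‖s‖ + ‖s‖⁻¹) / 4 := by
  have := norm_add_le s s⁻¹
  rw [norm_inv] at this
  rw [zet, norm_div, Complex.norm_ofNat]; linarith

theorem le_norm_zet (s : ℂ) : (‖s‖ - ‖s‖⁻¹) / 4 ≤ ‖zet s‖ := by
  have := norm_sub_le (s + s⁻¹) s⁻¹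
  rw [norm_inv, add_sub_cancel_right] at this
  rw [zet, norm_div, Complex.norm_ofNat]; linarith

theorem oscBound_natAbs (v : ℝ → ℂ) (j : ℤ) : oscBound v j.natAbs = oscBound v j := by
  rcases Int.natAbs_eq j with h | h
  · rw [← h]
  · conv_rhs => rw [h]
    unfold oscBound
    rw [neg_neg, add_comm]

/-- The radii of the circles that separate the zeros. -/
noncomputable def rad (n : ℝ) : ℝ := (4 * Real.pi * (n + 1 / 2)) ^ 2

theorem rad_lt_rad {m n : ℝ} (hm : 0 ≤ m) (h : m < n) : rad m < rad n := by
  have := Real.pi_pos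
  unfold rad
  gcongr

theorem rad_le_rad {m n : ℝ} (hm : 0 ≤ m) (h : m ≤ n) : rad m ≤ rad n := by
  have := Real.pi_pos
  unfold rad
  gcongr

theorem one_lt_rad {n : ℝ} (hn : 0 ≤ n) : 1 < rad n := by
  have := Real.pi_gt_three
  have h : 6 ≤ 4 * Real.pi * (n + 1 / 2) := by nlinarith
  unfold rad
  nlinarith

/-- The open annuli between consecutive separating circles. -/
def cell (k : ℕ) : Set ℂ := {z | rad ((k : ℝ) - 1) < ‖z‖ ∧ ‖z‖ < rad k}

namespace Pot

variable (P : Pot)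

/-- The points at which one of the functions `c`, `b`, `Δ² - 4` vanishes. -/
def IsZero (z : ℂ) : Prop :=
  P.monodromy z 1 0 = 0 ∨ P.monodromy z 0 1 = 0 ∨ P.Delta z ^ 2 - 4 = 0

/-- The threshold 1/32 gives 8η ≤ 1/4, which isolates ζ near one kπ, and it suffices for the strict
inequalities of `NearVacuum.compare`. -/
theorem exists_nearVacuum_small : ∃ v : ℝ → ℂ, SqInt v ∧ ∃ C : ℝ, 1 ≤ C ∧ ∃ n₀ : ℕ, 1 ≤ n₀ ∧ ∀ s : ℂ,
    (n₀ : ℝ) ≤ ‖s‖ → (zet s).im ≤ 0 →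
    P.NearVacuum s (Real.sqrt (C * (oscSq v (-2 * Complex.I * zet s) + 1 / ‖s‖ ^ 2))) ∧
    Real.sqrt (C * (oscSq v (-2 * Complex.I * zet s) + 1 / ‖s‖ ^ 2)) ≤ 1 / 32 := by
  obtain ⟨v, sv, C, hC1, hC⟩ := P.exists_nearVacuum
  have hε : 0 < (1 / 32) ^ 2 / (2 * C) := by positivity
  obtain ⟨R, hR⟩ := exists_forall_oscSq_le sv hε
  obtain ⟨n, hn⟩ := exists_nat_ge (C + (4 * |R| + 1) + 2048 * C)
  refine ⟨v, sv, C, hC1, n, ?_, fun s hs him => ?_⟩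
  · have : (1 : ℝ) ≤ n := by have := abs_nonneg R; linarith
    exact_mod_cast this
  have hR0 := abs_nonneg R
  have hR1 := le_abs_self R
  have hs1 : 1 ≤ ‖s‖ := by linarith
  have h0 := oscSq_nonneg v (-2 * Complex.I * zet s)
  have h1 : 0 ≤ C * (oscSq v (-2 * Complex.I * zet s) + 1 / ‖s‖ ^ 2) := by positivity
  refine ⟨hC s (by linarith) him _ (Real.sqrt_nonneg _) (Real.sq_sqrt h1).ge, ?_⟩
  refine Real.sqrt_le_iff.2 ⟨by norm_num, ?_⟩
  have h2 : oscSq v (-2 * Complex.I * zet s) ≤ (1 / 32) ^ 2 / (2 * C) := by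
    refine hR _ him ?_
    have := le_norm_zet s
    have h3 : ‖s‖⁻¹ ≤ 1 := inv_le_one_of_one_le₀ hs1
    linarith
  have h3 : 1 / ‖s‖ ^ 2 ≤ (1 / 32) ^ 2 / (2 * C) := by
    rw [div_le_div_iff₀ (by positivity) (by positivity)]
    nlinarith
  calc _ ≤ C * ((1 / 32) ^ 2 / (2 * C) + (1 / 32) ^ 2 / (2 * C)) := by gcongr
    _ = (1 / 32) ^ 2 := by field_simp; norm_num

theorem exists_zero_asymptotics : ∃ n₀ : ℕ, ∃ B : ℕ → ℝ, (Summable fun k => B k ^ 2) ∧ ∀ z : ℂ,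
    rad n₀ ≤ ‖z‖ → P.IsZero z → ∃ k : ℕ, n₀ < k ∧ z ∈ cell k ∧
      ((k : ℝ) - 1 / 2) * Real.pi < ‖zeta z‖ ∧ ‖zeta z‖ < ((k : ℝ) + 1 / 2) * Real.pi ∧
      ‖z - lamVac k‖ ≤ k * B k ∧
      ‖P.monodromy z 0 0 - (-1) ^ k‖ ≤ B k ∧ ‖P.monodromy z 1 1 - (-1) ^ k‖ ≤ B k := by
  obtain ⟨v, sv, C, hC1, n₀, hn1, hn⟩ := P.exists_nearVacuum_small
  set A : ℝ := 4 * ((1 + 2 * (1 / 4 : ℝ)) * Real.exp (2 * (1 / 4)) * Real.exp (2 * (1 / 4))) ^ 2 with hA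
  have hA0 : 0 ≤ A := by positivity
  have hbn : ∀ k : ℕ, 0 ≤ C * (A * oscBound v k + 1 / (k : ℝ) ^ 2) := fun k => by
    have := oscBound_nonneg v k
    positivity
  -- 2176 = 272 · 8, from δ = 8η in `norm_sq_sub_lamVac_le`; it also exceeds the 31 of the diagonal
  -- entries.
  refine ⟨n₀, fun k => 2176 * Real.sqrt (C * (A * oscBound v k + 1 / (k : ℝ) ^ 2)), ?_, fun z hz h0 => ?_⟩
  · have h1 : Summable fun k : ℕ => oscBound v (k : ℤ) :=
      (summable_oscBound sv).comp_injective Nat.cast_injective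
    have h2 := (((h1.mul_left A).add (Real.summable_one_div_nat_pow.2 one_lt_two)).mul_left C).mul_left
      (2176 ^ 2)
    refine h2.congr fun k => ?_
    rw [mul_pow, Real.sq_sqrt (hbn k)]
  obtain ⟨s, rfl, him⟩ := exists_sq_eq_im_nonpos z
  have hπ := Real.pi_gt_three
  have hn1' : (1 : ℝ) ≤ n₀ := by exact_mod_cast hn1
  have hs : 4 * Real.pi * (n₀ + 1 / 2) ≤ ‖s‖ := by
    rw [norm_pow, rad] at hz
    exact le_of_sq_le_sq hz (norm_nonneg _)
  obtain ⟨hnv, hη⟩ := hn s (by nlinarith) him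
  set η := Real.sqrt (C * (oscSq v (-2 * Complex.I * zet s) + 1 / ‖s‖ ^ 2)) with hηd
  have hs4 : 4 ≤ ‖s‖ := by nlinarith
  have hs0 : s ≠ 0 := norm_pos_iff.1 (by linarith)
  have h1 := hnv.exp_near_one hs0 h0
  obtain ⟨j, hj⟩ := exists_int_near_of_exp_near_one (h1.trans (by linarith))
  replace hj := hj.trans h1
  have hj4 : ‖zet s - j * Real.pi‖ ≤ 1 / 4 := hj.trans (by linarith)
  have hloc := norm_zet_near s j hj4
  set k := j.natAbs with hk
  have hkabs : |(j : ℝ)| = k := by rw [hk, Nat.cast_natAbs, Int.cast_abs]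
  have hinv : 1 / ‖s‖ ≤ 1 / 4 := one_div_le_one_div_of_le (by norm_num) hs4
  rw [hkabs, abs_le] at hloc
  have hkn : n₀ < k := by
    have : (n₀ : ℝ) < k := by nlinarith
    exact_mod_cast this
  have hk1 : 1 ≤ k := by omega
  have hk1' : (1 : ℝ) ≤ k := by exact_mod_cast hk1
  have hηB : η ≤ Real.sqrt (C * (A * oscBound v k + 1 / (k : ℝ) ^ 2)) := by
    refine Real.sqrt_le_sqrt ?_
    have h2 := oscSq_le_oscBound sv hj4
    rw [← hA, ← oscBound_natAbs] at h2
    have h3 : 1 / ‖s‖ ^ 2 ≤ 1 / (k : ℝ) ^ 2 := by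
      gcongr
      nlinarith
    gcongr
  have hη0 : 0 ≤ η := Real.sqrt_nonneg _
  refine ⟨k, hkn, ⟨?_, ?_⟩, ?_, ?_, ?_, ?_⟩
  · rw [norm_pow, rad]
    refine pow_lt_pow_left₀ (by nlinarith) (by nlinarith) (by norm_num)
  · rw [norm_pow, rad]
    refine pow_lt_pow_left₀ (by nlinarith) (by nlinarith) (by norm_num)
  · rw [norm_zeta_sq s]
    have := norm_sub_norm_le ((j : ℂ) * Real.pi) (zet s)
    rw [norm_sub_rev, norm_mul, Complex.norm_intCast, hkabs, Complex.norm_real, Real.norm_of_nonneg (by linarith)] at this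
    nlinarith
  · rw [norm_zeta_sq s]
    have := norm_sub_norm_le (zet s) ((j : ℂ) * Real.pi)
    rw [norm_mul, Complex.norm_intCast, hkabs, Complex.norm_real, Real.norm_of_nonneg (by linarith)] at this
    nlinarith
  · have := norm_sq_sub_lamVac_le hs4 (by omega) (by linarith) hj
    refine this.trans ?_
    rw [← hk]
    nlinarith
  · have h3 := hnv.diag_near h1 hj (by linarith)
    have h4 : ((-1 : ℂ)) ^ j = (-1) ^ k := by
      rw [hk]
      rcases Int.natAbs_eq j with h | h
      · conv_lhs => rw [h]
        rw [zpow_natCast]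
      · conv_lhs => rw [h]
        rw [zpow_neg, zpow_natCast, ← inv_pow, inv_neg, inv_one]
    rw [h4] at h3
    exact ⟨h3.1.trans (by linarith), h3.2.trans (by linarith)⟩

end Pot

end SinhGordon

namespace SinhGordon

/-! ### The vacuum -/

/-- The vacuum potential `u = 0`, `u_y = 0`. -/
def vac : Pot where
  u := fun _ => 0
  uy := fun _ => 0
  continuousOn_u := continuousOn_const
  exists_weakDeriv := ⟨fun _ => 0, MemLp.zero, fun φ _ _ _ => by simp⟩
  memLp_uy := MemLp.zero
  periodic := rfl

theorem vac_coef {s : ℂ} (hs : s ≠ 0) (t : ℝ) : vac.coef (s ^ 2) 0 0 t = 0 ∧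
    vac.coef (s ^ 2) 0 1 t = -(zet s * s⁻¹) ∧ vac.coef (s ^ 2) 1 0 t = s * zet s ∧
    vac.coef (s ^ 2) 1 1 t = 0 := by
  refine ⟨by simp [Pot.coef, Pot.alpha, vac], ?_, ?_, by simp [Pot.coef, Pot.alpha, vac]⟩
  · simp [Pot.coef, Pot.alpha, vac, zet]; field_simp; ring
  · simp [Pot.coef, Pot.alpha, vac, zet]; field_simp; ring

theorem vac_monodromy {s : ℂ} (hs : s ≠ 0) : vac.monodromy (s ^ 2) 0 0 = Complex.cos (zet s) ∧
    vac.monodromy (s ^ 2) 0 1 = -Complex.sin (zet s) * s⁻¹ ∧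
    vac.monodromy (s ^ 2) 1 0 = s * Complex.sin (zet s) ∧
    vac.monodromy (s ^ 2) 1 1 = Complex.cos (zet s) := by
  have hd : ∀ x : ℝ, HasDerivAt (fun t : ℝ => (zet s * t : ℂ)) (zet s) x := fun x => by
    simpa using (Complex.ofRealCLM.hasDerivAt (x := x)).const_mul (zet s)
  have hcos : HasPrim (fun t : ℝ => Complex.cos (zet s * t))
      (fun t : ℝ => -Complex.sin (zet s * t) * zet s) :=
    HasPrim.of_hasDerivAt (fun x => (Complex.hasDerivAt_cos _).comp x (hd x)) (by fun_prop)
  have hsin : HasPrim (fun t : ℝ => Complex.sin (zet s * t))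
      (fun t : ℝ => Complex.cos (zet s * t) * zet s) :=
    HasPrim.of_hasDerivAt (fun x => (Complex.hasDerivAt_sin _).comp x (hd x)) (by fun_prop)
  have h1 : IsVecSol (vac.coef (s ^ 2)) ![fun t : ℝ => Complex.cos (zet s * t),
      fun t : ℝ => s * Complex.sin (zet s * t)] := by
    intro i
    fin_cases i
    · refine hcos.congr (fun _ _ => rfl) fun t _ => ?_
      obtain ⟨e1, e2, e3, e4⟩ := vac_coef hs t
      simp [e1, e2]; field_simp
    · refine (hsin.const_mul s).congr (fun _ _ => rfl) fun t _ => ?_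
      obtain ⟨e1, e2, e3, e4⟩ := vac_coef hs t
      simp [e3, e4]; ring
  have h2 : IsVecSol (vac.coef (s ^ 2)) ![fun t : ℝ => -s⁻¹ * Complex.sin (zet s * t),
      fun t : ℝ => Complex.cos (zet s * t)] := by
    intro i
    fin_cases i
    · refine (hsin.const_mul (-s⁻¹)).congr (fun _ _ => rfl) fun t _ => ?_
      obtain ⟨e1, e2, e3, e4⟩ := vac_coef hs t
      simp [e1, e2]; ring
    · refine hcos.congr (fun _ _ => rfl) fun t _ => ?_
      obtain ⟨e1, e2, e3, e4⟩ := vac_coef hs t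
      simp [e3, e4]; field_simp
  have a := h1.monodromy_mul vac 0
  have b := h2.monodromy_mul vac 0
  have c := h1.monodromy_mul vac 1
  have d := h2.monodromy_mul vac 1
  simp at a b c d
  exact ⟨a.symm, by rw [← b]; ring, c.symm, d.symm⟩

namespace Pot

variable {P : Pot}

/-- The hypothesis keeps the normalized sine above 1/4, larger than all errors. The factors
e^{±u(0)/2} are those by which c and b differ from the vacuum to leading order; they do not move
zeros. -/
theorem NearVacuum.compare {s : ℂ} {η : ℝ} (h : P.NearVacuum s η) (hs : s ≠ 0) (hη : η ≤ 1 / 32)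
    (hσ : 1 / 2 < ‖1 - Complex.exp (-2 * Complex.I * zet s)‖) :
    ‖Complex.exp (P.u 0 / 2) * P.monodromy (s ^ 2) 1 0 - vac.monodromy (s ^ 2) 1 0‖ <
      ‖vac.monodromy (s ^ 2) 1 0‖ ∧
    ‖Complex.exp (-P.u 0 / 2) * P.monodromy (s ^ 2) 0 1 - vac.monodromy (s ^ 2) 0 1‖ <
      ‖vac.monodromy (s ^ 2) 0 1‖ ∧
    ‖(P.Delta (s ^ 2) ^ 2 - 4) - (vac.Delta (s ^ 2) ^ 2 - 4)‖ < ‖vac.Delta (s ^ 2) ^ 2 - 4‖ := by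
  obtain ⟨ha, hd, hc, hb⟩ := h
  obtain ⟨v1, v2, v3, v4⟩ := vac_monodromy hs
  have hη0 := (norm_nonneg _).trans ha
  rw [P.Delta_sq_sub_four, vac.Delta_sq_sub_four, v1, v2, v3, v4]
  set σ := (1 - Complex.exp (-2 * Complex.I * zet s)) / (2 * Complex.I) with hσd
  have hσn : 1 / 4 < ‖σ‖ := by
    rw [hσd, norm_div, norm_mul, Complex.norm_I, Complex.norm_ofNat]; linarith
  set E := Complex.exp (-(Complex.I * zet s)) with hE
  have hE0 : E ≠ 0 := Complex.exp_ne_zero _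
  have hEσ : σ = E * Complex.sin (zet s) := by
    have e1 : Complex.exp (-2 * Complex.I * zet s) = E * E := by
      rw [hE, ← Complex.exp_add]; congr 1; ring
    have e2 : Complex.exp (zet s * Complex.I) = E⁻¹ := by
      rw [hE, ← Complex.exp_neg]; congr 1; ring
    have e3 : Complex.exp (-zet s * Complex.I) = E := by
      rw [hE]; congr 1; ring
    have hI := Complex.I_ne_zero
    have hI2 := Complex.I_sq
    rw [hσd, e1, Complex.sin, e2, e3]
    field_simp
    rw [hI2]; ring
  have hs0 : 0 < ‖s‖ := norm_pos_iff.2 hs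
  have hEn : 0 < ‖E‖ := norm_pos_iff.2 hE0
  have hσS : ‖σ‖ = ‖E‖ * ‖Complex.sin (zet s)‖ := by rw [hEσ, norm_mul]
  refine ⟨?_, ?_, ?_⟩
  · have e : E * (P.monodromy (s ^ 2) 1 0 * Complex.exp (P.u 0 / 2) * s⁻¹) - σ =
      E * s⁻¹ * (Complex.exp (P.u 0 / 2) * P.monodromy (s ^ 2) 1 0 - s * Complex.sin (zet s)) := by
      rw [hEσ]; field_simp
    rw [e, norm_mul, norm_mul, norm_inv] at hc
    have : ‖E‖ * ‖s‖⁻¹ * ‖Complex.exp (P.u 0 / 2) * P.monodromy (s ^ 2) 1 0 - s * Complex.sin (zet s)‖ <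
        ‖E‖ * ‖s‖⁻¹ * ‖s * Complex.sin (zet s)‖ := by
      have e2 : ‖E‖ * ‖s‖⁻¹ * ‖s * Complex.sin (zet s)‖ = ‖σ‖ := by
        rw [hσS, norm_mul]; field_simp
      rw [e2]; linarith
    exact lt_of_mul_lt_mul_left this (by positivity)
  · have e : E * (P.monodromy (s ^ 2) 0 1 * Complex.exp (-P.u 0 / 2) * s) + σ =
      E * s * (Complex.exp (-P.u 0 / 2) * P.monodromy (s ^ 2) 0 1 - -Complex.sin (zet s) * s⁻¹) := by
      rw [hEσ]; field_simp; ring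
    rw [e, norm_mul, norm_mul] at hb
    have : ‖E‖ * ‖s‖ * ‖Complex.exp (-P.u 0 / 2) * P.monodromy (s ^ 2) 0 1 - -Complex.sin (zet s) * s⁻¹‖ <
        ‖E‖ * ‖s‖ * ‖-Complex.sin (zet s) * s⁻¹‖ := by
      have e2 : ‖E‖ * ‖s‖ * ‖-Complex.sin (zet s) * s⁻¹‖ = ‖σ‖ := by
        rw [hσS, norm_mul, norm_neg, norm_inv]; field_simp
      rw [e2]; linarith
    exact lt_of_mul_lt_mul_left this (by positivity)
  · set A := E * P.monodromy (s ^ 2) 0 0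
    set D := E * P.monodromy (s ^ 2) 1 1
    set C := E * (P.monodromy (s ^ 2) 1 0 * Complex.exp (P.u 0 / 2) * s⁻¹) with hC
    set B := E * (P.monodromy (s ^ 2) 0 1 * Complex.exp (-P.u 0 / 2) * s) with hB
    have hBC : B * C = E ^ 2 * (P.monodromy (s ^ 2) 0 1 * P.monodromy (s ^ 2) 1 0) := by
      have e : Complex.exp (-P.u 0 / 2) = (Complex.exp (P.u 0 / 2))⁻¹ := by
        rw [← Complex.exp_neg]; congr 1; ring
      have e' := Complex.exp_ne_zero (P.u 0 / 2)
      rw [hB, hC, e]; field_simp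
    have hAD : ‖A - D‖ ≤ 2 * η := by
      have := norm_sub_le (A - (1 + Complex.exp (-2 * Complex.I * zet s)) / 2)
        (D - (1 + Complex.exp (-2 * Complex.I * zet s)) / 2)
      rw [sub_sub_sub_cancel_right] at this
      linarith
    have hv : -Complex.sin (zet s) * s⁻¹ * (s * Complex.sin (zet s)) = -Complex.sin (zet s) ^ 2 := by
      field_simp
    rw [hv, sub_self]
    set X := (P.monodromy (s ^ 2) 0 0 - P.monodromy (s ^ 2) 1 1) ^ 2 +
      4 * (P.monodromy (s ^ 2) 0 1 * P.monodromy (s ^ 2) 1 0) with hX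
    have e4 : E ^ 2 * (X - (0 ^ 2 + 4 * -Complex.sin (zet s) ^ 2)) =
        (A - D) ^ 2 + 4 * (σ * ((B + σ) * -1 + (C - σ)) * -1) + 4 * ((B + σ) * (C - σ)) := by
      have : (A - D) ^ 2 + 4 * (B * C) = E ^ 2 * X := by
        rw [hBC, hX]; ring
      rw [mul_sub, ← this, show E ^ 2 * (0 ^ 2 + 4 * -Complex.sin (zet s) ^ 2) = -4 * σ ^ 2 by
        rw [hEσ]; ring]
      ring
    have hn : ‖E ^ 2 * (X - (0 ^ 2 + 4 * -Complex.sin (zet s) ^ 2))‖ ≤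
        (2 * η) ^ 2 + 4 * (‖σ‖ * (η + η)) + 4 * (η * η) := by
      rw [e4]
      refine (norm_add₃_le).trans ?_
      simp only [norm_mul, norm_pow, Complex.norm_ofNat, norm_neg, norm_one, mul_one]
      have h3 : ‖(B + σ) * -1 + (C - σ)‖ ≤ η + η := by
        refine (norm_add_le _ _).trans (add_le_add ?_ hc)
        rw [norm_mul, norm_neg, norm_one, mul_one]; exact hb
      gcongr
    rw [norm_mul, norm_pow] at hn
    have e5 : ‖E‖ ^ 2 * ‖(0 ^ 2 + 4 * -Complex.sin (zet s) ^ 2 : ℂ)‖ = 4 * ‖σ‖ ^ 2 := by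
      rw [hσS]; simp; ring
    refine lt_of_mul_lt_mul_left (a := ‖E‖ ^ 2) ?_ (by positivity)
    rw [e5]
    nlinarith

/-- |s| = 4π(n + 1/2) has distance at least 2π from every 4π|j|, while a point near a zero of the
sine would be within 2 + 1/6. -/
theorem half_lt_of_norm_eq_rad {s : ℂ} {n : ℕ} (h : ‖s ^ 2‖ = rad n) :
    1 / 2 < ‖1 - Complex.exp (-2 * Complex.I * zet s)‖ := by
  by_contra! hc
  obtain ⟨j, hj⟩ := exists_int_near_of_exp_near_one hc
  have hπ := Real.pi_gt_three
  have hs : ‖s‖ = 4 * Real.pi * (n + 1 / 2) := by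
    rw [norm_pow, rad] at h
    exact (sq_eq_sq₀ (norm_nonneg _) (by positivity)).1 h
  have hloc := norm_zet_near s j (hj.trans hc)
  have hs6 : 6 ≤ ‖s‖ := by rw [hs]; nlinarith [(Nat.cast_nonneg n : (0 : ℝ) ≤ n)]
  have hinv : 1 / ‖s‖ ≤ 1 / 6 := one_div_le_one_div_of_le (by norm_num) hs6
  have hkabs : |(j : ℝ)| = j.natAbs := by rw [Nat.cast_natAbs, Int.cast_abs]
  rw [hs] at hinv
  rw [hkabs, abs_le, hs] at hloc
  rcases le_or_gt j.natAbs n with h1 | h1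
  · have : (j.natAbs : ℝ) ≤ n := by exact_mod_cast h1
    nlinarith
  · have : (n : ℝ) + 1 ≤ j.natAbs := by exact_mod_cast h1
    nlinarith

theorem exists_compare (P : Pot) : ∃ n₀ : ℕ, ∀ n : ℕ, n₀ ≤ n → ∀ z : ℂ, ‖z‖ = rad n →
    ‖Complex.exp (P.u 0 / 2) * P.monodromy z 1 0 - vac.monodromy z 1 0‖ < ‖vac.monodromy z 1 0‖ ∧
    ‖Complex.exp (-P.u 0 / 2) * P.monodromy z 0 1 - vac.monodromy z 0 1‖ < ‖vac.monodromy z 0 1‖ ∧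
    ‖(P.Delta z ^ 2 - 4) - (vac.Delta z ^ 2 - 4)‖ < ‖vac.Delta z ^ 2 - 4‖ := by
  obtain ⟨v, sv, C, hC1, n₀, hn1, hn⟩ := P.exists_nearVacuum_small
  refine ⟨n₀, fun n hnn z hz => ?_⟩
  obtain ⟨s, rfl, him⟩ := exists_sq_eq_im_nonpos z
  have hs : ‖s‖ = 4 * Real.pi * (n + 1 / 2) := by
    have hz' := hz
    rw [norm_pow, rad] at hz'
    exact (sq_eq_sq₀ (norm_nonneg _) (by positivity)).1 hz'
  have hπ := Real.pi_gt_three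
  have hnn' : (n₀ : ℝ) ≤ n := by exact_mod_cast hnn
  have hn1' : (1 : ℝ) ≤ n₀ := by exact_mod_cast hn1
  obtain ⟨h1, h2⟩ := hn s (by rw [hs]; nlinarith) him
  exact h1.compare (norm_pos_iff.1 (by rw [hs]; nlinarith)) h2 (half_lt_of_norm_eq_rad hz)

end Pot

end SinhGordon

namespace SinhGordon

/-! ### Zeros of holomorphic functions on the punctured plane -/

theorem isPreconnected_compl_zero : IsPreconnected ({0}ᶜ : Set ℂ) :=
  (isConnected_compl_singleton_of_one_lt_rank (by simp) 0).isPreconnected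

section Zeros

variable {f g : ℂ → ℂ}

theorem analyticOrderAt_ne_top_of_ne_zero (hf : AnalyticOnNhd ℂ f {0}ᶜ) {z₀ : ℂ} (h0 : z₀ ≠ 0)
    (hz₀ : f z₀ ≠ 0) {z : ℂ} (hz : z ≠ 0) : analyticOrderAt f z ≠ ⊤ := fun h =>
  hz₀ (hf.eqOn_zero_of_preconnected_of_eventuallyEq_zero isPreconnected_compl_zero hz
    (analyticOrderAt_eq_top.1 h) h0)

theorem finite_zeros (hf : AnalyticOnNhd ℂ f {0}ᶜ) {z₀ : ℂ} (h0 : z₀ ≠ 0) (hz₀ : f z₀ ≠ 0)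
    {r : ℝ} (hr : 0 < r) (R : ℝ) : {z | r ≤ ‖z‖ ∧ ‖z‖ ≤ R ∧ f z = 0}.Finite := by
  by_contra hinf
  have hK : IsCompact {z : ℂ | r ≤ ‖z‖ ∧ ‖z‖ ≤ R} := by
    refine (isCompact_closedBall (0 : ℂ) R).of_isClosed_subset
      ((isClosed_le continuous_const continuous_norm).inter
        (isClosed_le continuous_norm continuous_const)) fun z hz => by simpa using hz.2
  obtain ⟨z, hz, hacc⟩ := Set.Infinite.exists_accPt_of_subset_isCompact hinf hK
    fun z hz => ⟨hz.1, hz.2.1⟩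
  have hzne : z ≠ 0 := norm_pos_iff.1 (hr.trans_le hz.1)
  refine hz₀ (hf.eqOn_zero_of_preconnected_of_frequently_eq_zero isPreconnected_compl_zero hzne ?_ h0)
  exact (accPt_iff_frequently_nhdsNE.1 hacc).mono fun w hw => hw.2.2

theorem exists_eq_pow_mul {U : Set ℂ} (hf : AnalyticOnNhd ℂ f U) {w : ℂ} (hw : w ∈ U)
    (hn : analyticOrderAt f w ≠ ⊤) : ∃ g, AnalyticOnNhd ℂ g U ∧
      (∀ z, f z = (z - w) ^ analyticOrderNatAt f w * g z) ∧ g w ≠ 0 := by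
  obtain ⟨h, ha, h0, hh⟩ := ((hf w hw).analyticOrderAt_ne_top).1 hn
  set n := analyticOrderNatAt f w
  refine ⟨Function.update (fun z => f z / (z - w) ^ n) w (h w), fun z hz => ?_, fun z => ?_, by simpa⟩
  · rcases eq_or_ne z w with rfl | hzw
    · refine ha.congr ?_
      filter_upwards [hh] with x hx
      rcases eq_or_ne x z with rfl | hxz
      · simp
      · rw [Function.update_of_ne hxz, hx, smul_eq_mul,
          mul_div_cancel_left₀ _ (pow_ne_zero _ (sub_ne_zero.2 hxz))]
    · refine ((hf z hz).div ((analyticAt_id.sub analyticAt_const).pow n)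
        (pow_ne_zero _ (sub_ne_zero.2 hzw))).congr ?_
      filter_upwards [isOpen_ne.mem_nhds hzw] with x hx
      rw [Function.update_of_ne hx]; rfl
  · rcases eq_or_ne z w with rfl | hzw
    · simpa using hh.self_of_nhds
    · rw [Function.update_of_ne hzw, mul_div_cancel₀ _ (pow_ne_zero _ (sub_ne_zero.2 hzw))]

/-- The zeros are divided out one after the other; the factors already removed do not vanish at the
next zero, so its order is unaffected. -/
theorem exists_eq_prod_mul {U : Set ℂ} (hf : AnalyticOnNhd ℂ f U)
    (hn : ∀ w ∈ U, analyticOrderAt f w ≠ ⊤) (Z : Finset ℂ) (hZ : ∀ w ∈ Z, w ∈ U) :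
    ∃ g, AnalyticOnNhd ℂ g U ∧
      (∀ z, f z = (∏ w ∈ Z, (z - w) ^ analyticOrderNatAt f w) * g z) ∧ ∀ w ∈ Z, g w ≠ 0 := by
  induction Z using Finset.induction_on with
  | empty => exact ⟨f, hf, by simp, by simp⟩
  | insert w Z hwZ ih =>
    obtain ⟨g, hg, hfg, hg0⟩ := ih fun x hx => hZ x (Finset.mem_insert_of_mem hx)
    have hwU := hZ w (Finset.mem_insert_self w Z)
    have hp : AnalyticAt ℂ (fun z => ∏ x ∈ Z, (z - x) ^ analyticOrderNatAt f x) w :=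
      Finset.analyticAt_fun_prod _ fun x _ => (analyticAt_id.sub analyticAt_const).pow _
    have hp0 : analyticOrderAt (fun z => ∏ x ∈ Z, (z - x) ^ analyticOrderNatAt f x) w = 0 := by
      rw [hp.analyticOrderAt_eq_zero, Finset.prod_ne_zero_iff]
      exact fun x hx => pow_ne_zero _ (sub_ne_zero.2 fun h => hwZ (h ▸ hx))
    have horder : analyticOrderAt f w = analyticOrderAt g w := by
      have e : analyticOrderAt f w = analyticOrderAt
          ((fun z => ∏ x ∈ Z, (z - x) ^ analyticOrderNatAt f x) * g) w :=
        congrArg (analyticOrderAt · w) (funext hfg)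
      rw [e, analyticOrderAt_mul hp (hg w hwU), hp0, zero_add]
    obtain ⟨h, hh, hgh, hhw⟩ := exists_eq_pow_mul hg hwU (horder ▸ hn w hwU)
    have hnat : analyticOrderNatAt g w = analyticOrderNatAt f w := by
      simp only [analyticOrderNatAt, horder]
    refine ⟨h, hh, fun z => ?_, fun x hx => ?_⟩
    · rw [Finset.prod_insert hwZ, hfg z, hgh z, hnat]; ring
    · rcases Finset.mem_insert.1 hx with rfl | hx
      · exact hhw
      · intro h0
        apply hg0 x hx
        rw [hgh, h0, mul_zero]

theorem circleIntegral_logDeriv_eq (hf : AnalyticOnNhd ℂ f {0}ᶜ) {r R : ℝ} (hr : 0 < r) (hrR : r < R)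
    (h0 : ∀ z, r ≤ ‖z‖ → ‖z‖ ≤ R → f z ≠ 0) :
    ∮ z in C(0, R), logDeriv f z = ∮ z in C(0, r), logDeriv f z := by
  have hd : ∀ z, r ≤ ‖z‖ → ‖z‖ ≤ R → DifferentiableAt ℂ (fun z => z * logDeriv f z) z :=
    fun z h1 h2 => by
      have hz : z ≠ 0 := norm_pos_iff.1 (hr.trans_le h1)
      exact differentiableAt_id.mul
        ((hf.deriv z hz).differentiableAt.div (hf z hz).differentiableAt (h0 z h1 h2))
  -- The factor `z` cancels the kernel `(z - 0)⁻¹`.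
  have h := Complex.circleIntegral_sub_center_inv_smul_eq_of_differentiable_on_annulus_off_countable
    (c := 0) hr hrR.le (f := fun z => z * logDeriv f z) countable_empty
    (fun z hz => (hd z (by simpa using hz.2) (by simpa using hz.1)).continuousAt.continuousWithinAt)
    (fun z hz => hd z (by simpa using (not_le.1 fun h => hz.1.2 (by simpa using h)).le)
      (by simpa using (mem_ball_zero_iff.1 hz.1.1).le))
  have e : ∀ ρ : ℝ, 0 < ρ → ∮ z in C(0, ρ), (z - 0)⁻¹ • (z * logDeriv f z) =
      ∮ z in C(0, ρ), logDeriv f z := fun ρ hρ =>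
    circleIntegral.integral_congr hρ.le fun z hz => by
      have hz : z ≠ 0 := norm_pos_iff.1 (by rw [mem_sphere_zero_iff_norm.1 hz]; exact hρ)
      simp only [sub_zero, smul_eq_mul]
      rw [inv_mul_cancel_left₀ hz]
  rwa [e R (hr.trans hrR), e r hr] at h

theorem circleIntegrable_logDeriv (hf : AnalyticOnNhd ℂ f {0}ᶜ) {r : ℝ} (hr : 0 < r)
    (h0 : ∀ z, ‖z‖ = r → f z ≠ 0) : CircleIntegrable (logDeriv f) 0 r :=
  ContinuousOn.circleIntegrable hr.le fun z hz => by
    have hzr := mem_sphere_zero_iff_norm.1 hz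
    have hz : z ≠ 0 := norm_pos_iff.1 (by rwa [hzr])
    exact ((hf.deriv z hz).differentiableAt.div (hf z hz).differentiableAt
      (h0 z hzr)).continuousAt.continuousWithinAt

theorem circleIntegral_sub_inv_of_lt {w : ℂ} {r : ℝ} (hr : 0 < r) (hw : r < ‖w‖) :
    ∮ z in C(0, r), (z - w)⁻¹ = 0 := by
  refine Complex.circleIntegral_eq_zero_of_differentiable_on_off_countable hr.le countable_empty
    (fun z hz => ?_) fun z hz => ?_
  · have : z - w ≠ 0 := sub_ne_zero.2 fun h => by
      have := mem_closedBall_zero_iff.1 hz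
      rw [h] at this; linarith
    exact ((continuousAt_id.sub continuousAt_const).inv₀ this).continuousWithinAt
  · have : z - w ≠ 0 := sub_ne_zero.2 fun h => by
      have := mem_ball_zero_iff.1 hz.1
      rw [h] at this; linarith
    exact (differentiableAt_id.sub_const w).inv this

/-- The argument principle on an annulus. -/
theorem argument_principle (hf : AnalyticOnNhd ℂ f {0}ᶜ) {r R : ℝ} (hr : 0 < r) (hrR : r < R)
    (hfr : ∀ z, ‖z‖ = r → f z ≠ 0) (hfR : ∀ z, ‖z‖ = R → f z ≠ 0) :
    (∮ z in C(0, R), logDeriv f z) - ∮ z in C(0, r), logDeriv f z =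
      2 * Real.pi * Complex.I * ((∑ᶠ z ∈ {z : ℂ | r < ‖z‖ ∧ ‖z‖ < R}, analyticOrderNatAt f z : ℕ) : ℂ) := by
  have hz₀ : f (r : ℂ) ≠ 0 := hfr r (by simp [abs_of_pos hr])
  have hr0 : (r : ℂ) ≠ 0 := by exact_mod_cast hr.ne'
  have hfin := finite_zeros hf hr0 hz₀ hr R
  set Z := hfin.toFinset with hZ
  have hZ1 : ∀ w ∈ Z, r < ‖w‖ ∧ ‖w‖ < R := fun w hw => by
    have hw' := hfin.mem_toFinset.1 hw
    exact ⟨lt_of_le_of_ne hw'.1 fun h => hfr w h.symm hw'.2.2,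
      lt_of_le_of_ne hw'.2.1 fun h => hfR w h hw'.2.2⟩
  have hZ0 : ∀ w ∈ Z, w ∈ ({0}ᶜ : Set ℂ) := fun w hw => norm_pos_iff.1 (hr.trans (hZ1 w hw).1)
  -- `g` has no zeros on the closed annulus, so it contributes equally on both circles; each factor
  -- z - w contributes 2πi on the outer circle and 0 on the inner one.
  obtain ⟨g, hg, hfg, hgZ⟩ := exists_eq_prod_mul hf
    (fun w hw => analyticOrderAt_ne_top_of_ne_zero hf hr0 hz₀ hw) Z hZ0
  have hsum : ∑ᶠ z ∈ {z : ℂ | r < ‖z‖ ∧ ‖z‖ < R}, analyticOrderNatAt f z =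
      ∑ w ∈ Z, analyticOrderNatAt f w := by
    refine finsum_mem_eq_sum_of_inter_support_eq _ ?_
    ext z
    simp only [mem_inter_iff, mem_ofPred_eq, Function.mem_support, Finset.mem_coe]
    constructor
    · rintro ⟨⟨h1, h2⟩, h3⟩
      refine ⟨hfin.mem_toFinset.2 ⟨h1.le, h2.le, ?_⟩, h3⟩
      by_contra h4
      exact h3 (by rw [analyticOrderNatAt, (hf z (norm_pos_iff.1 (hr.trans h1))).analyticOrderAt_eq_zero.2 h4]; rfl)
    · rintro ⟨h1, h3⟩
      exact ⟨hZ1 z h1, h3⟩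
  have hg0 : ∀ z, r ≤ ‖z‖ → ‖z‖ ≤ R → g z ≠ 0 := fun z h1 h2 h3 => by
    have h4 : f z = 0 := by rw [hfg, h3, mul_zero]
    exact hgZ z (hfin.mem_toFinset.2 ⟨h1, h2, h4⟩) h3
  have key : ∀ ρ : ℝ, r ≤ ρ → ρ ≤ R → (∀ z, ‖z‖ = ρ → f z ≠ 0) →
      ∮ z in C(0, ρ), logDeriv f z = (∑ w ∈ Z, (analyticOrderNatAt f w : ℂ) * ∮ z in C(0, ρ), (z - w)⁻¹) +
        ∮ z in C(0, ρ), logDeriv g z := by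
    intro ρ h1 h2 h3
    have hρ : 0 < ρ := hr.trans_le h1
    have hwi : ∀ w ∈ Z, CircleIntegrable (fun z => (analyticOrderNatAt f w : ℂ) * (z - w)⁻¹) 0 ρ := fun w hw => by
      refine ContinuousOn.circleIntegrable hρ.le fun z hz => ?_
      have : z - w ≠ 0 := sub_ne_zero.2 fun h => h3 z (mem_sphere_zero_iff_norm.1 hz)
        (by rw [h]; exact (hfin.mem_toFinset.1 hw).2.2)
      exact (continuousAt_const.mul
        ((continuousAt_id.sub continuousAt_const).inv₀ this)).continuousWithinAt
    have hgi : CircleIntegrable (logDeriv g) 0 ρ := circleIntegrable_logDeriv hg hρ fun z hz =>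
      hg0 z (hz ▸ h1) (hz ▸ h2)
    calc ∮ z in C(0, ρ), logDeriv f z =
        ∮ z in C(0, ρ), ((∑ w ∈ Z, (analyticOrderNatAt f w : ℂ) * (z - w)⁻¹) + logDeriv g z) := by
          refine circleIntegral.integral_congr hρ.le fun z hz => ?_
          have hzr := mem_sphere_zero_iff_norm.1 hz
          have hzw : ∀ w ∈ Z, z - w ≠ 0 := fun w hw => sub_ne_zero.2 fun h => h3 z hzr
            (by rw [h]; exact (hfin.mem_toFinset.1 hw).2.2)
          have hz0 : z ≠ 0 := norm_pos_iff.1 (by rwa [hzr])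
          have hd : ∀ w, DifferentiableAt ℂ (fun z => (z - w) ^ analyticOrderNatAt f w) z :=
            fun w => (differentiableAt_id.sub_const w).pow _
          have e1 : logDeriv f z = logDeriv (fun z =>
              (∏ w ∈ Z, (z - w) ^ analyticOrderNatAt f w) * g z) z := by
            congr 1; exact funext hfg
          rw [e1, logDeriv_mul (f := fun z => ∏ w ∈ Z, (z - w) ^ analyticOrderNatAt f w) z
            (Finset.prod_ne_zero_iff.2 fun w hw => pow_ne_zero _ (hzw w hw))
            (hg0 z (hzr ▸ h1) (hzr ▸ h2)) (DifferentiableAt.fun_finsetProd fun w _ => hd w)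
            (hg z hz0).differentiableAt,
            logDeriv_prod (f := fun w z => (z - w) ^ analyticOrderNatAt f w)
              (fun w hw => pow_ne_zero _ (hzw w hw)) fun w _ => hd w]
          congr 1
          refine Finset.sum_congr rfl fun w hw => ?_
          rw [logDeriv_fun_pow (f := fun z => z - w) (differentiableAt_id.sub_const w)]
          congr 1
          simp [logDeriv_apply]
      _ = _ := by
          rw [circleIntegral.integral_add (CircleIntegrable.fun_sum Z hwi) hgi,
            circleIntegral.integral_fun_sum hwi]
          congr 1
          exact Finset.sum_congr rfl fun w _ => circleIntegral.integral_const_mul _ _ _ _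
  rw [key R hrR.le le_rfl hfR, key r le_rfl hrR.le hfr, circleIntegral_logDeriv_eq hg hr hrR hg0,
    add_sub_add_right_eq_sub, hsum, ← Finset.sum_sub_distrib, Nat.cast_sum, Finset.mul_sum]
  refine Finset.sum_congr rfl fun w hw => ?_
  rw [circleIntegral.integral_sub_inv_of_mem_ball (mem_ball_zero_iff.2 (hZ1 w hw).2),
    circleIntegral_sub_inv_of_lt hr (hZ1 w hw).1]
  ring

/-- On the circle a f/g stays in the disc of radius 1 about 1, so its logarithm is a primitive of
the difference of the logarithmic derivatives. -/
theorem circleIntegral_logDeriv_eq_of_norm_sub_lt (hf : AnalyticOnNhd ℂ f {0}ᶜ)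
    (hg : AnalyticOnNhd ℂ g {0}ᶜ) {r : ℝ} (hr : 0 < r) {a : ℂ}
    (h : ∀ z, ‖z‖ = r → ‖a * f z - g z‖ < ‖g z‖) :
    ∮ z in C(0, r), logDeriv f z = ∮ z in C(0, r), logDeriv g z := by
  have hg0 : ∀ z, ‖z‖ = r → g z ≠ 0 := fun z hz h0 => by
    have := h z hz
    rw [h0, norm_zero] at this
    exact absurd this (norm_nonneg _).not_gt
  have hf0 : ∀ z, ‖z‖ = r → a * f z ≠ 0 := fun z hz h0 => by
    have := h z hz
    rw [h0, zero_sub, norm_neg] at this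
    exact lt_irrefl _ this
  have hf0' : ∀ z, ‖z‖ = r → f z ≠ 0 := fun z hz => right_ne_zero_of_mul (hf0 z hz)
  rw [← sub_eq_zero, ← circleIntegral.integral_sub (circleIntegrable_logDeriv hf hr hf0')
    (circleIntegrable_logDeriv hg hr hg0)]
  refine circleIntegral.integral_eq_zero_of_hasDerivWithinAt'
    (f := fun z => Complex.log (a * f z / g z)) fun z hz => ?_
  rw [abs_of_pos hr] at hz
  have hzr := mem_sphere_zero_iff_norm.1 hz
  have hz0 : z ≠ 0 := norm_pos_iff.1 (by rwa [hzr])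
  have hslit : a * f z / g z ∈ Complex.slitPlane := by
    refine Complex.ball_one_subset_slitPlane ?_
    rw [mem_ball_iff_norm, div_sub_one (hg0 z hzr), norm_div, div_lt_one (norm_pos_iff.2 (hg0 z hzr))]
    exact h z hzr
  have hd := ((((hf z hz0).differentiableAt.hasDerivAt.const_mul a).fun_div
    (hg z hz0).differentiableAt.hasDerivAt (hg0 z hzr)).clog hslit)
  refine (hd.congr_deriv ?_).hasDerivWithinAt
  have h1 := hg0 z hzr
  have h2 := hf0' z hzr
  have h3 := left_ne_zero_of_mul (hf0 z hzr)
  simp only [logDeriv_apply]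
  field_simp

/-- Rouché's theorem on an annulus, with different factors on the two boundary circles. -/
theorem rouche (hf : AnalyticOnNhd ℂ f {0}ᶜ) (hg : AnalyticOnNhd ℂ g {0}ᶜ) {r R : ℝ} (hr : 0 < r)
    (hrR : r < R) {a b : ℂ} (ha : ∀ z, ‖z‖ = r → ‖a * f z - g z‖ < ‖g z‖)
    (hb : ∀ z, ‖z‖ = R → ‖b * f z - g z‖ < ‖g z‖) :
    ∑ᶠ z ∈ {z : ℂ | r < ‖z‖ ∧ ‖z‖ < R}, analyticOrderNatAt f z =
      ∑ᶠ z ∈ {z : ℂ | r < ‖z‖ ∧ ‖z‖ < R}, analyticOrderNatAt g z := by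
  have key : ∀ {a : ℂ} {ρ : ℝ}, (∀ z, ‖z‖ = ρ → ‖a * f z - g z‖ < ‖g z‖) →
      (∀ z, ‖z‖ = ρ → f z ≠ 0) ∧ ∀ z, ‖z‖ = ρ → g z ≠ 0 := fun h => by
    refine ⟨fun z hz h0 => ?_, fun z hz h0 => ?_⟩
    · have := h z hz
      rw [h0, mul_zero, zero_sub, norm_neg] at this
      exact lt_irrefl _ this
    · have := h z hz
      rw [h0, norm_zero] at this
      exact absurd this (norm_nonneg _).not_gt
  have h1 := argument_principle hf hr hrR (key ha).1 (key hb).1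
  have h2 := argument_principle hg hr hrR (key ha).2 (key hb).2
  rw [circleIntegral_logDeriv_eq_of_norm_sub_lt hf hg hr ha,
    circleIntegral_logDeriv_eq_of_norm_sub_lt hf hg (hr.trans hrR) hb, h2] at h1
  exact_mod_cast (mul_left_cancel₀ Complex.two_pi_I_ne_zero h1).symm

end Zeros

end SinhGordon

namespace SinhGordon

/-! ### The zeros of the vacuum -/

/-- The radii of the separating circles, indexed by all integers: `λ_{k,0}` lies between the
circles of radius `bd (k - 1)` and `bd k`. -/
noncomputable def bd (k : ℤ) : ℝ := if 0 ≤ k then rad k else (rad (-k - 1))⁻¹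

theorem bd_of_nonneg {k : ℤ} (h : 0 ≤ k) : bd k = rad k := if_pos h

theorem bd_natCast (n : ℕ) : bd n = rad n := by rw [bd_of_nonneg (by omega)]; simp

theorem bd_neg_sub_one (n : ℕ) : bd (-n - 1) = (rad n)⁻¹ := by
  rw [bd, if_neg (by omega)]; push_cast; congr 2; ring

theorem bd_pos (k : ℤ) : 0 < bd k := by
  rcases lt_or_ge k 0 with h | h
  · obtain ⟨n, rfl⟩ : ∃ n : ℕ, k = -n - 1 := ⟨(-k - 1).toNat, by omega⟩
    rw [bd_neg_sub_one]
    exact inv_pos.2 (zero_lt_one.trans (one_lt_rad (by positivity)))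
  · obtain ⟨n, rfl⟩ : ∃ n : ℕ, k = n := ⟨k.toNat, by omega⟩
    rw [bd_natCast]
    exact zero_lt_one.trans (one_lt_rad (by positivity))

/-- Inversion maps the cell of `k` to that of `-k`, hence its outer circle `k` to the inner circle
`-k - 1`. -/
theorem bd_neg_sub (k : ℤ) : bd (-k - 1) = (bd k)⁻¹ := by
  rcases lt_or_ge k 0 with h | h
  · obtain ⟨n, rfl⟩ : ∃ n : ℕ, k = -n - 1 := ⟨(-k - 1).toNat, by omega⟩
    rw [bd_neg_sub_one, inv_inv, ← bd_natCast]; congr 1; ring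
  · obtain ⟨n, rfl⟩ : ∃ n : ℕ, k = n := ⟨k.toNat, by omega⟩
    rw [bd_natCast, bd_neg_sub_one]

theorem strictMono_bd : StrictMono bd := by
  have pos : ∀ n : ℕ, bd n < bd (n + 1) := fun n => by
    rw [bd_natCast, show (n : ℤ) + 1 = ((n + 1 : ℕ) : ℤ) by simp, bd_natCast]
    exact rad_lt_rad (by positivity) (by push_cast; linarith)
  refine strictMono_int_of_lt_succ fun k => ?_
  rcases lt_trichotomy k (-1) with h | rfl | h
  · obtain ⟨n, rfl⟩ : ∃ n : ℕ, k = -(n + 1 : ℤ) - 1 := ⟨(-k - 2).toNat, by omega⟩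
    rw [bd_neg_sub, show -(n + 1 : ℤ) - 1 + 1 = -n - 1 by ring, bd_neg_sub]
    exact inv_strictAnti₀ (bd_pos _) (pos n)
  · have h1 := one_lt_rad le_rfl
    have e : bd (-1) = (rad 0)⁻¹ := by simpa using bd_neg_sub_one 0
    have e0 : bd (-1 + 1) = rad 0 := by simpa using bd_natCast 0
    rw [e, e0]
    exact (inv_lt_one_of_one_lt₀ h1).trans h1
  · obtain ⟨n, rfl⟩ : ∃ n : ℕ, k = n := ⟨k.toNat, by omega⟩
    exact pos n

theorem lamVac_neg {k : ℤ} (hk : k ≠ 0) : lamVac (-k) = (lamVac k)⁻¹ := by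
  refine eq_inv_of_mul_eq_one_left ?_
  have hk2 : (1 : ℝ) ≤ (k : ℝ) ^ 2 := by
    have : (1 : ℤ) ≤ k ^ 2 := by
      have := sq_nonneg k
      have := pow_ne_zero 2 hk
      omega
    exact_mod_cast this
  have hπ := Real.pi_gt_three
  have h1 : 0 ≤ 4 * Real.pi ^ 2 * (k : ℝ) ^ 2 - 1 := by nlinarith
  have hs := Real.sq_sqrt h1
  unfold lamVac
  push_cast
  rw [neg_sq]
  set r := Real.sqrt (4 * Real.pi ^ 2 * (k : ℝ) ^ 2 - 1)
  linear_combination -16 * Real.pi ^ 2 * (k : ℝ) ^ 2 * hs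

theorem lamVac_zero : lamVac 0 = -1 := by simp [lamVac]

theorem lamVac_natCast_mem {k : ℕ} (hk : 1 ≤ k) : bd ((k : ℤ) - 1) < lamVac k ∧ lamVac k < bd k := by
  obtain ⟨p1, p2, p3, p4⟩ := sVac_spec hk
  have hk' : (1 : ℝ) ≤ k := by exact_mod_cast hk
  have hπ := Real.pi_gt_three
  have h3 : (sVac k)⁻¹ ≤ 1 := inv_le_one_of_one_le₀ p1
  rw [bd_natCast, bd_of_nonneg (by omega), ← p4]
  unfold rad
  push_cast
  constructor
  · refine pow_lt_pow_left₀ ?_ (by nlinarith) (by norm_num)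
    nlinarith
  · refine pow_lt_pow_left₀ ?_ (by linarith) (by norm_num)
    nlinarith

theorem norm_lamVac_mem (k : ℤ) : bd (k - 1) < ‖(lamVac k : ℂ)‖ ∧ ‖(lamVac k : ℂ)‖ < bd k := by
  rw [Complex.norm_real]
  have pos : ∀ n : ℕ, 1 ≤ n → bd ((n : ℤ) - 1) < ‖lamVac n‖ ∧ ‖lamVac n‖ < bd n := fun n hn => by
    obtain ⟨h1, h2⟩ := lamVac_natCast_mem hn
    rw [Real.norm_of_nonneg ((bd_pos _).trans h1).le]
    exact ⟨h1, h2⟩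
  rcases lt_trichotomy k 0 with h | rfl | h
  · obtain ⟨n, rfl⟩ : ∃ n : ℕ, k = -(n : ℤ) := ⟨(-k).toNat, by omega⟩
    obtain ⟨h1, h2⟩ := pos n (by omega)
    rw [lamVac_neg (by omega), norm_inv, bd_neg_sub,
      show -(n : ℤ) = -((n : ℤ) - 1) - 1 by ring, bd_neg_sub]
    exact ⟨inv_strictAnti₀ ((bd_pos _).trans h1) h2, inv_strictAnti₀ (bd_pos _) h1⟩
  · have h1 := one_lt_rad le_rfl
    have e : bd (0 - 1) = (rad 0)⁻¹ := by simpa using bd_neg_sub_one 0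
    have e0 : bd 0 = rad 0 := by simpa using bd_natCast 0
    rw [lamVac_zero, norm_neg, norm_one, e, e0]
    exact ⟨inv_lt_one_of_one_lt₀ h1, h1⟩
  · obtain ⟨n, rfl⟩ : ∃ n : ℕ, k = n := ⟨k.toNat, by omega⟩
    exact pos n (by omega)

theorem lamVac_mem_iff (k m n : ℤ) : (bd m < ‖(lamVac k : ℂ)‖ ∧ ‖(lamVac k : ℂ)‖ < bd n) ↔
    m < k ∧ k ≤ n := by
  obtain ⟨h1, h2⟩ := norm_lamVac_mem k
  refine ⟨fun ⟨h3, h4⟩ => ⟨strictMono_bd.lt_iff_lt.1 (h3.trans h2), ?_⟩, fun ⟨h3, h4⟩ =>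
    ⟨(strictMono_bd.monotone (by omega)).trans_lt h1, h2.trans_le (strictMono_bd.monotone h4)⟩⟩
  have := strictMono_bd.lt_iff_lt.1 (h1.trans h4)
  omega

theorem lamVac_injective : Function.Injective fun k : ℤ => (lamVac k : ℂ) := fun k l h => by
  have h1 := (lamVac_mem_iff k (k - 1) k).2 ⟨by omega, le_rfl⟩
  simp only at h
  rw [h, lamVac_mem_iff] at h1
  omega

theorem lamVac_ne_zero (k : ℤ) : (lamVac k : ℂ) ≠ 0 :=
  norm_pos_iff.1 ((bd_pos _).trans (norm_lamVac_mem k).1)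

theorem exists_sq_eq_lamVac (k : ℤ) : ∃ s : ℂ, s ≠ 0 ∧ s ^ 2 = lamVac k ∧ s + s⁻¹ = 4 * Real.pi * k := by
  have pos : ∀ n : ℕ, 1 ≤ n → ∃ s : ℂ, s ≠ 0 ∧ s ^ 2 = lamVac n ∧ s + s⁻¹ = 4 * Real.pi * n := by
    intro n hn
    obtain ⟨p1, p2, p3, p4⟩ := sVac_spec hn
    have h0 : sVac n ≠ 0 := by linarith
    exact ⟨sVac n, by exact_mod_cast h0, by exact_mod_cast congrArg Complex.ofReal p4,
      by exact_mod_cast congrArg Complex.ofReal p3⟩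
  rcases lt_trichotomy k 0 with h | rfl | h
  · obtain ⟨n, rfl⟩ : ∃ n : ℕ, k = -(n : ℤ) := ⟨(-k).toNat, by omega⟩
    obtain ⟨s, h0, h1, h2⟩ := pos n (by omega)
    refine ⟨-s⁻¹, by simpa, ?_, ?_⟩
    · rw [lamVac_neg (by omega), neg_sq, inv_pow, h1]; simp
    · rw [inv_neg, inv_inv]; push_cast; linear_combination -h2
  · exact ⟨Complex.I, Complex.I_ne_zero, by simp [lamVac_zero], by simp⟩
  · obtain ⟨n, rfl⟩ : ∃ n : ℕ, k = n := ⟨k.toNat, by omega⟩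
    simpa using pos n (by omega)

/-- sin ζ = 0 means s + s⁻¹ = 4πk for some k, and the two solutions t, t⁻¹ have the squares λ_{k,0}
and λ_{-k,0}. -/
theorem vac_zero_iff {z : ℂ} (hz : z ≠ 0) : vac.monodromy z 1 0 = 0 ↔ ∃ k : ℤ, z = lamVac k := by
  constructor
  · intro h
    obtain ⟨s, rfl, -⟩ := exists_sq_eq_im_nonpos z
    have hs : s ≠ 0 := by rintro rfl; simp at hz
    rw [(vac_monodromy hs).2.2.1, mul_eq_zero, or_iff_right hs, Complex.sin_eq_zero_iff] at h
    obtain ⟨k, hk⟩ := h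
    obtain ⟨t, ht, ht2, hts⟩ := exists_sq_eq_lamVac k
    have e : s + s⁻¹ = t + t⁻¹ := by
      rw [hts]; unfold zet at hk; linear_combination 4 * hk
    have e2 : (s - t) * (s * t - 1) = 0 := by
      field_simp at e
      linear_combination e
    rcases mul_eq_zero.1 e2 with h | h
    · exact ⟨k, by rw [sub_eq_zero.1 h, ht2]⟩
    · have hst : s = t⁻¹ := eq_inv_of_mul_eq_one_left (sub_eq_zero.1 h)
      rcases eq_or_ne k 0 with rfl | hk0
      · refine ⟨0, ?_⟩
        rw [hst, inv_pow, ht2, lamVac_zero]; norm_num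
      · exact ⟨-k, by rw [hst, inv_pow, ht2, lamVac_neg hk0]; simp⟩
  · rintro ⟨k, rfl⟩
    obtain ⟨t, ht, ht2, hts⟩ := exists_sq_eq_lamVac k
    rw [← ht2, (vac_monodromy ht).2.2.1, zet, hts, show (4 * Real.pi * k : ℂ) / 4 = k * Real.pi by ring,
      Complex.sin_int_mul_pi, mul_zero]

theorem analyticOnNhd_monodromy (P : Pot) (i j : Fin 2) :
    AnalyticOnNhd ℂ (fun z => P.monodromy z i j) {0}ᶜ := fun _ hz => P.analyticAt_monodromy hz i j

theorem analyticOnNhd_disc (P : Pot) : AnalyticOnNhd ℂ (fun z => P.Delta z ^ 2 - 4) {0}ᶜ := fun z hz => by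
  have e : (fun z => P.Delta z ^ 2 - 4) =
      fun z => (P.monodromy z 0 0 + P.monodromy z 1 1) ^ 2 - 4 := by
    funext z; rw [Pot.Delta, Matrix.trace_fin_two]
  rw [e]
  exact (((analyticOnNhd_monodromy P 0 0 z hz).add (analyticOnNhd_monodromy P 1 1 z hz)).pow 2).sub
    analyticAt_const

/-- In the variable s the zero of s sin ζ(s) is simple unless ζ' = 0, that is s² = 1. But |λ_{k,0}|
= 1 only for k = 0, where the value is -1. -/
theorem vac_order (k : ℤ) : analyticOrderAt (fun z => vac.monodromy z 1 0) (lamVac k) = 1 := by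
  have ha := analyticOnNhd_monodromy vac 1 0 _ (lamVac_ne_zero k)
  have h0 : vac.monodromy (lamVac k) 1 0 = 0 := (vac_zero_iff (lamVac_ne_zero k)).2 ⟨k, rfl⟩
  have hd : deriv (fun z => vac.monodromy z 1 0) (lamVac k) ≠ 0 := by
    obtain ⟨t, ht, ht2, hts⟩ := exists_sq_eq_lamVac k
    have h1 : HasDerivAt (fun s => vac.monodromy (s ^ 2) 1 0)
        (deriv (fun z => vac.monodromy z 1 0) (lamVac k) * (2 * t)) t := by
      have h2 := ha.differentiableAt.hasDerivAt
      rw [← ht2] at h2 ⊢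
      have h3 : HasDerivAt (fun s : ℂ => s ^ 2) (2 * t) t := by simpa using hasDerivAt_pow 2 t
      exact h2.comp t h3
    have hz : HasDerivAt zet ((1 + -(t ^ 2)⁻¹) / 4) t :=
      ((hasDerivAt_id t).add (hasDerivAt_inv ht)).div_const 4
    have h4 : HasDerivAt (fun s => s * Complex.sin (zet s))
        (1 * Complex.sin (zet t) + t * (Complex.cos (zet t) * ((1 + -(t ^ 2)⁻¹) / 4))) t :=
      (hasDerivAt_id t).mul ((Complex.hasDerivAt_sin _).comp t hz)
    have h5 := h1.unique (h4.congr_of_eventuallyEq (by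
      filter_upwards [isOpen_ne.mem_nhds ht] with s hs
      exact (vac_monodromy hs).2.2.1))
    have hzt : zet t = k * Real.pi := by rw [zet, hts]; ring
    intro hc
    rw [hc, hzt, Complex.sin_int_mul_pi, zero_mul, mul_zero, zero_add, eq_comm, mul_eq_zero,
      or_iff_right ht, mul_eq_zero] at h5
    rcases h5 with h5 | h5
    · have := Complex.sin_sq_add_cos_sq (k * Real.pi : ℂ)
      rw [h5, Complex.sin_int_mul_pi] at this
      norm_num at this
    · have : (lamVac k : ℂ) = 1 := by
        rw [ht2] at h5
        have h6 : (lamVac k : ℂ)⁻¹ = 1 := by linear_combination -4 * h5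
        rw [← inv_inv (lamVac k : ℂ), h6, inv_one]
      have h7 := norm_lamVac_mem k
      have hb1 := one_lt_rad le_rfl
      have e : bd (-1) = (rad 0)⁻¹ := by simpa using bd_neg_sub_one 0
      have e0 : bd 0 = rad 0 := by simpa using bd_natCast 0
      have hk : k = 0 := by
        rw [this, norm_one] at h7
        have i1 : bd (-1) < 1 := by rw [e]; exact inv_lt_one_of_one_lt₀ hb1
        have i2 : 1 < bd 0 := by rw [e0]; exact hb1
        have j1 := strictMono_bd.lt_iff_lt.1 (i1.trans h7.2)
        have j2 := strictMono_bd.lt_iff_lt.1 (h7.1.trans i2)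
        omega
      rw [hk, lamVac_zero] at this
      norm_num at this
  have := ha.analyticOrderAt_sub_eq_one_of_deriv_ne_zero hd
  simpa [h0] using this

theorem vac_disc {z : ℂ} (hz : z ≠ 0) :
    vac.Delta z ^ 2 - 4 = -4 * z⁻¹ * vac.monodromy z 1 0 ^ 2 := by
  obtain ⟨s, rfl, -⟩ := exists_sq_eq_im_nonpos z
  have hs : s ≠ 0 := by rintro rfl; simp at hz
  obtain ⟨a, b, c, d⟩ := vac_monodromy hs
  rw [vac.Delta_sq_sub_four, a, b, c, d]
  field_simp
  ring

theorem vac_order_disc {z : ℂ} (hz : z ≠ 0) : analyticOrderNatAt (fun z => vac.Delta z ^ 2 - 4) z =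
    2 * analyticOrderNatAt (fun z => vac.monodromy z 1 0) z := by
  have ha := analyticOnNhd_monodromy vac 1 0 z hz
  have hi : AnalyticAt ℂ (fun z : ℂ => -4 * z⁻¹) z := analyticAt_const.mul (analyticAt_inv hz)
  have h1 : analyticOrderAt (fun z => vac.Delta z ^ 2 - 4) z =
      2 • analyticOrderAt (fun z => vac.monodromy z 1 0) z := by
    rw [analyticOrderAt_congr (g := (fun z : ℂ => -4 * z⁻¹) * (fun z => vac.monodromy z 1 0) ^ 2) (by
      filter_upwards [isOpen_ne.mem_nhds hz] with w hw using vac_disc hw),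
      analyticOrderAt_mul hi (ha.pow 2), analyticOrderAt_pow ha,
      hi.analyticOrderAt_eq_zero.2 (by simpa using hz), zero_add]
  rw [analyticOrderNatAt, h1, analyticOrderNatAt]
  simp

/-- The circles enclose exactly the λ_{k,0} with m < k ≤ n. Used with r = 1 for c and r = 2 for the
discriminant. -/
theorem vac_count (m n : ℤ) {f : ℂ → ℂ} {r : ℕ} (hf : ∀ z, z ≠ 0 → analyticOrderNatAt f z =
    r * analyticOrderNatAt (fun z => vac.monodromy z 1 0) z) :
    ∑ᶠ z ∈ {z : ℂ | bd m < ‖z‖ ∧ ‖z‖ < bd n}, analyticOrderNatAt f z = r * (n - m).toNat := by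
  have h1 : ∀ k : ℤ, analyticOrderNatAt f (lamVac k) = r := fun k => by
    rw [hf _ (lamVac_ne_zero k), analyticOrderNatAt, vac_order]; simp
  rw [finsum_mem_eq_sum_of_inter_support_eq (t := (Finset.Ioc m n).image fun k : ℤ => (lamVac k : ℂ)),
    Finset.sum_image lamVac_injective.injOn, Finset.sum_congr rfl fun k _ => h1 k]
  · simp [mul_comm]
  · ext z
    simp only [mem_inter_iff, mem_ofPred_eq, Function.mem_support, Finset.coe_image, Finset.coe_Ioc,
      mem_image, mem_Ioc]
    constructor
    · rintro ⟨hz, h0⟩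
      refine ⟨?_, h0⟩
      have hz0 : z ≠ 0 := norm_pos_iff.1 ((bd_pos m).trans hz.1)
      rw [hf z hz0] at h0
      have h2 : vac.monodromy z 1 0 = 0 := by
        by_contra h3
        rw [analyticOrderNatAt, (analyticOnNhd_monodromy vac 1 0 z hz0).analyticOrderAt_eq_zero.2 h3] at h0
        simp at h0
      obtain ⟨k, rfl⟩ := (vac_zero_iff hz0).1 h2
      exact ⟨k, (lamVac_mem_iff k m n).1 hz, rfl⟩
    · rintro ⟨⟨k, hk, rfl⟩, h0⟩
      exact ⟨(lamVac_mem_iff k m n).2 hk, h0⟩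

/-! ### Counting zeros -/

theorem vac_flip : vac.flip = vac := by simp [Pot.flip, vac]

namespace Pot

variable (P : Pot)

theorem Delta_flip (z : ℂ) : P.Delta z = P.flip.Delta z⁻¹ := by
  obtain ⟨a, b, c, d⟩ := P.monodromy_flip z
  rw [Delta, Delta, Matrix.trace_fin_two, Matrix.trace_fin_two, a, d, add_comm]

/-- Near 0, the inequality for c is that for b of the flipped potential at z⁻¹. -/
theorem exists_compare_bd : ∃ n₀ : ℕ, ∀ k : ℤ, (n₀ : ℤ) ≤ k ∨ k < -n₀ →
    (∃ α : ℂ, ∀ z, ‖z‖ = bd k →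
      ‖α * P.monodromy z 1 0 - vac.monodromy z 1 0‖ < ‖vac.monodromy z 1 0‖) ∧
    ∀ z, ‖z‖ = bd k →
      ‖1 * (P.Delta z ^ 2 - 4) - (vac.Delta z ^ 2 - 4)‖ < ‖vac.Delta z ^ 2 - 4‖ := by
  obtain ⟨n₁, h1⟩ := P.exists_compare
  obtain ⟨n₂, h2⟩ := P.flip.exists_compare
  refine ⟨max n₁ n₂, fun k hk => ?_⟩
  simp only [one_mul]
  rcases hk with hk | hk
  · obtain ⟨n, rfl⟩ : ∃ n : ℕ, k = n := ⟨k.toNat, by omega⟩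
    rw [bd_natCast]
    have := h1 n (by omega)
    exact ⟨⟨_, fun z hz => (this z hz).1⟩, fun z hz => (this z hz).2.2⟩
  · obtain ⟨n, rfl⟩ : ∃ n : ℕ, k = -n - 1 := ⟨(-k - 1).toNat, by omega⟩
    rw [bd_neg_sub_one]
    have h3 : ∀ z : ℂ, ‖z‖ = (rad n)⁻¹ → ‖z⁻¹‖ = rad n := fun z hz => by rw [norm_inv, hz, inv_inv]
    have := fun z hz => h2 n (by omega) z⁻¹ (h3 z hz)
    refine ⟨⟨Complex.exp (-P.flip.u 0 / 2), fun z hz => ?_⟩, fun z hz => ?_⟩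
    · have h4 := (this z hz).2.1
      rw [(P.monodromy_flip z).2.2.1, (vac.monodromy_flip z).2.2.1, vac_flip, norm_neg,
        mul_neg, neg_sub_neg, norm_sub_rev]
      exact h4
    · rw [P.Delta_flip z, vac.Delta_flip z, vac_flip]
      exact (this z hz).2.2

theorem exists_count : ∃ n₀ : ℕ, ∀ m n : ℤ, ((n₀ : ℤ) ≤ m ∨ m < -n₀) → ((n₀ : ℤ) ≤ n ∨ n < -n₀) → m < n →
    ∑ᶠ z ∈ {z : ℂ | bd m < ‖z‖ ∧ ‖z‖ < bd n}, analyticOrderNatAt (fun z => P.monodromy z 1 0) z =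
      (n - m).toNat ∧
    ∑ᶠ z ∈ {z : ℂ | bd m < ‖z‖ ∧ ‖z‖ < bd n}, analyticOrderNatAt (fun z => P.Delta z ^ 2 - 4) z =
      2 * (n - m).toNat := by
  obtain ⟨n₀, h⟩ := P.exists_compare_bd
  refine ⟨n₀, fun m n hm hn hmn => ?_⟩
  obtain ⟨⟨a, ha⟩, ha'⟩ := h m hm
  obtain ⟨⟨b, hb⟩, hb'⟩ := h n hn
  constructor
  · rw [rouche (analyticOnNhd_monodromy P 1 0) (analyticOnNhd_monodromy vac 1 0) (bd_pos m)
      (strictMono_bd hmn) ha hb, vac_count m n (r := 1) fun z _ => (one_mul _).symm, one_mul]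
  · rw [rouche (analyticOnNhd_disc P) (analyticOnNhd_disc vac) (bd_pos m)
      (strictMono_bd hmn) ha' hb', vac_count m n (r := 2) fun z hz => vac_order_disc hz]

theorem exists_c_ne_zero : ∃ z : ℂ, z ≠ 0 ∧ P.monodromy z 1 0 ≠ 0 := by
  obtain ⟨n₀, h⟩ := P.exists_compare_bd
  obtain ⟨⟨a, ha⟩, -⟩ := h n₀ (Or.inl le_rfl)
  have hn : ‖((bd n₀ : ℝ) : ℂ)‖ = bd n₀ := by
    rw [Complex.norm_real, Real.norm_of_nonneg (bd_pos _).le]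
  refine ⟨bd n₀, norm_pos_iff.1 (by rw [hn]; exact bd_pos _), fun h0 => ?_⟩
  have := ha _ hn
  rw [h0, mul_zero, zero_sub, norm_neg] at this
  exact lt_irrefl _ this

theorem exists_disc_ne_zero : ∃ z : ℂ, z ≠ 0 ∧ P.Delta z ^ 2 - 4 ≠ 0 := by
  obtain ⟨n₀, h⟩ := P.exists_compare_bd
  obtain ⟨-, ha⟩ := h n₀ (Or.inl le_rfl)
  have hn : ‖((bd n₀ : ℝ) : ℂ)‖ = bd n₀ := by
    rw [Complex.norm_real, Real.norm_of_nonneg (bd_pos _).le]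
  refine ⟨bd n₀, norm_pos_iff.1 (by rw [hn]; exact bd_pos _), fun h0 => ?_⟩
  have := ha _ hn
  rw [h0, mul_zero, zero_sub, norm_neg] at this
  exact lt_irrefl _ this

end Pot

end SinhGordon

namespace SinhGordon

/-! ### Location of all zeros of large index -/

theorem one_lt_bd {k : ℤ} (hk : 0 ≤ k) : 1 < bd k := by
  rw [bd_of_nonneg hk]; exact one_lt_rad (by exact_mod_cast hk)

theorem bd_lt_one {k : ℤ} (hk : k < 0) : bd k < 1 := by
  rw [show k = -(-k - 1) - 1 by ring, bd_neg_sub]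
  exact inv_lt_one_of_one_lt₀ (one_lt_bd (by omega))

theorem norm_zeta_inv {z : ℂ} : ‖zeta z⁻¹‖ = ‖zeta z‖ := by
  obtain ⟨s, rfl, -⟩ := exists_sq_eq_im_nonpos z
  rw [← inv_pow, norm_zeta_sq, norm_zeta_sq, zet, zet, inv_inv, add_comm]

theorem norm_zeta_le_of_norm_le {z : ℂ} {n : ℕ} (h1 : (rad n)⁻¹ ≤ ‖z‖) (h2 : ‖z‖ ≤ rad n) :
    ‖zeta z‖ ≤ ((n : ℝ) + 1 / 2) * Real.pi + 1 / 4 := by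
  have hr := one_lt_rad (n := n) (by positivity)
  wlog hz : 1 ≤ ‖z‖ generalizing z
  · rw [← norm_zeta_inv]
    have hz0 : 0 < ‖z‖ := (by positivity : 0 < (rad n)⁻¹).trans_le h1
    refine this ?_ ?_ ?_
    · rw [norm_inv]; exact inv_anti₀ hz0 h2
    · rw [norm_inv, inv_le_comm₀ hz0 (by linarith)]; exact h1
    · rw [norm_inv]; exact (one_le_inv₀ hz0).2 (not_le.1 hz).le
  obtain ⟨s, rfl, -⟩ := exists_sq_eq_im_nonpos z
  rw [norm_zeta_sq]
  rw [norm_pow] at hz h2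
  have hs1 : 1 ≤ ‖s‖ := by nlinarith [norm_nonneg s]
  have hs2 : ‖s‖ ≤ 4 * Real.pi * (n + 1 / 2) := by
    have hπ := Real.pi_pos
    unfold rad at h2
    exact (pow_le_pow_iff_left₀ (norm_nonneg s) (by positivity) two_ne_zero).1 h2
  have hs3 : ‖s‖⁻¹ ≤ 1 := inv_le_one_of_one_le₀ hs1
  linarith [norm_zet_le s]

theorem mem_annulus_iff {k : ℤ} (hk : k ≠ 0) {z : ℂ} : z ∈ annulus k ↔ z ≠ 0 ∧
    (|(k : ℝ)| - 1 / 2) * Real.pi ≤ ‖zeta z‖ ∧ ‖zeta z‖ ≤ (|(k : ℝ)| + 1 / 2) * Real.pi ∧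
    (0 < k → 1 < ‖z‖) ∧ (k < 0 → ‖z‖ < 1) := by
  unfold annulus
  rcases lt_or_gt_of_ne hk with h | h
  · have h' : (k : ℝ) < 0 := by exact_mod_cast h
    rw [if_neg (by omega), if_neg hk, abs_of_neg h']
    simp [h, h.le]
  · have h' : (0 : ℝ) < k := by exact_mod_cast h
    rw [if_pos h, abs_of_pos h']
    simp [h, h.le]

/-- A point outside S_0 is not on the unit circle, where |ζ| ≤ 1/2; so |z| decides between the two
signs of the index. -/
theorem mem_iUnion_annulus_iff {N : ℕ} {z : ℂ} :
    (z ∈ ⋃ k : {k : ℤ // |k| ≤ (N : ℤ)}, annulus k) ↔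
      z ≠ 0 ∧ ‖zeta z‖ ≤ ((N : ℝ) + 1 / 2) * Real.pi := by
  have hπ := Real.pi_gt_three
  rw [mem_iUnion]
  constructor
  · rintro ⟨⟨k, hk⟩, hz⟩
    simp only at hz
    have hkN : |(k : ℝ)| ≤ N := by exact_mod_cast hk
    rcases eq_or_ne k 0 with rfl | h0
    · simp only [annulus, lt_irrefl, if_false, if_true] at hz
      refine ⟨hz.1, hz.2.trans ?_⟩
      nlinarith [(Nat.cast_nonneg N : (0 : ℝ) ≤ N)]
    · rw [mem_annulus_iff h0] at hz
      refine ⟨hz.1, hz.2.2.1.trans ?_⟩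
      gcongr
  · rintro ⟨hz, h⟩
    rcases le_or_gt ‖zeta z‖ (Real.pi / 2) with h1 | h1
    · exact ⟨⟨0, by simp⟩, by simp only [annulus, lt_irrefl, if_false, if_true]; exact ⟨hz, h1⟩⟩
    -- The index whose layer (n ± 1/2)π contains |ζ|.
    · set n := ⌈‖zeta z‖ / Real.pi - 1 / 2⌉₊ with hn
      have e : ‖zeta z‖ = ‖zeta z‖ / Real.pi * Real.pi := by field_simp
      have hn1 := Nat.le_ceil (‖zeta z‖ / Real.pi - 1 / 2)
      have hpos : 0 < ‖zeta z‖ / Real.pi - 1 / 2 := by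
        rw [sub_pos, lt_div_iff₀ (by linarith)]; linarith
      have hn2 := Nat.ceil_lt_add_one hpos.le
      have hn3 : n ≤ N := by
        rw [hn, Nat.ceil_le, sub_le_iff_le_add, div_le_iff₀ (by linarith)]; exact h
      have hn0 : 0 < n := Nat.ceil_pos.2 hpos
      have hne : ‖z‖ ≠ 1 := by
        intro h2
        obtain ⟨s, rfl, -⟩ := exists_sq_eq_im_nonpos z
        rw [norm_zeta_sq] at h1
        have hs : ‖s‖ = 1 := by
          rw [norm_pow] at h2
          exact (pow_eq_one_iff_of_nonneg (norm_nonneg s) two_ne_zero).1 h2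
        have := norm_zet_le s
        rw [hs] at this
        norm_num at this
        linarith
      have low : ((n : ℝ) - 1 / 2) * Real.pi ≤ ‖zeta z‖ := by
        rw [e]; gcongr; linarith
      have up : ‖zeta z‖ ≤ ((n : ℝ) + 1 / 2) * Real.pi := by
        rw [e]; gcongr; linarith
      rcases lt_or_gt_of_ne hne with h2 | h2
      · refine ⟨⟨-n, by simpa using hn3⟩, (mem_annulus_iff (by simpa using hn0.ne')).2 ?_⟩
        push_cast
        rw [abs_neg, Nat.abs_cast]
        exact ⟨hz, low, up, fun h => by omega, fun _ => h2⟩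
      · refine ⟨⟨n, by simpa using hn3⟩, (mem_annulus_iff (by simpa using hn0.ne')).2 ?_⟩
        push_cast
        rw [Nat.abs_cast]
        exact ⟨hz, low, up, fun _ => h2, fun h => by omega⟩

theorem sq_le_of_bd_lt {k : ℕ} (hk : 1 ≤ k) {x : ℝ} (h : bd ((k : ℤ) - 1) < x) : (k : ℝ) ^ 2 ≤ x := by
  have hk' : (1 : ℝ) ≤ k := by exact_mod_cast hk
  have hπ := Real.pi_gt_three
  refine le_trans ?_ h.le
  rw [bd_of_nonneg (by omega), rad]
  push_cast
  gcongr
  nlinarith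

theorem summable_int_natAbs {g : ℕ → ℝ} (hg : Summable g) : Summable fun k : ℤ => g k.natAbs :=
  Summable.of_nat_of_neg (by simpa using hg) (by simpa using hg)

namespace Pot

variable (P : Pot)

/-- The points at which `c` or `Δ² - 4` vanishes. -/
def IsSpecial (z : ℂ) : Prop := z ≠ 0 ∧ (P.monodromy z 1 0 = 0 ∨ P.Delta z ^ 2 - 4 = 0)

/-- Near 0 the flipped potential is used at w = z⁻¹. In z - λ⁻¹ = -(w - λ)/(wλ) with λ = λ_{k,0},
the numerator is at most k times the bound and the denominator at least k⁴; this yields the weight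
k³. -/
theorem exists_special_asymptotics : ∃ n₀ : ℕ, ∃ B : ℤ → ℝ, (Summable fun k => B k ^ 2) ∧ ∀ z : ℂ,
    P.IsSpecial z → (bd n₀ ≤ ‖z‖ ∨ ‖z‖ ≤ bd (-n₀ - 1)) → ∃ k : ℤ, (n₀ : ℤ) < |k| ∧
      (bd (k - 1) < ‖z‖ ∧ ‖z‖ < bd k) ∧
      (|(k : ℝ)| - 1 / 2) * Real.pi < ‖zeta z‖ ∧ ‖zeta z‖ < (|(k : ℝ)| + 1 / 2) * Real.pi ∧
      ellWeight (-1) 3 k * ‖z - lamVac k‖ ≤ B k ∧ ‖P.monodromy z 0 0 - muVac k‖ ≤ B k := by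
  obtain ⟨n₁, B₁, hB₁, h₁⟩ := P.exists_zero_asymptotics
  obtain ⟨n₂, B₂, hB₂, h₂⟩ := P.flip.exists_zero_asymptotics
  refine ⟨max n₁ n₂, fun k => |B₁ k.natAbs| + |B₂ k.natAbs|, ?_, fun z hz hzn => ?_⟩
  · refine Summable.of_nonneg_of_le (fun k => sq_nonneg _) (fun k => ?_)
      (summable_int_natAbs ((hB₁.add hB₂).mul_left 2))
    have e1 := sq_abs (B₁ k.natAbs)
    have e2 := sq_abs (B₂ k.natAbs)
    nlinarith [sq_nonneg (|B₁ k.natAbs| - |B₂ k.natAbs|)]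
  have cellk : ∀ k : ℕ, 1 ≤ k → ∀ w : ℂ, w ∈ cell k → bd ((k : ℤ) - 1) < ‖w‖ ∧ ‖w‖ < bd k := by
    intro k hk w hw
    rw [bd_natCast, bd_of_nonneg (by omega)]
    push_cast
    exact hw
  rcases hzn with hzn | hzn
  · have hle : rad n₁ ≤ ‖z‖ := by
      rw [bd_natCast] at hzn
      exact (rad_le_rad (by positivity) (by push_cast; exact le_max_left _ _)).trans hzn
    obtain ⟨k, hk, hc, z1, z2, e1, e2, e3⟩ := h₁ z hle (hz.2.imp id Or.inr)
    have hc' := cellk k (by omega) z hc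
    have hk' : (1 : ℝ) ≤ k := by exact_mod_cast (by omega : 1 ≤ k)
    have hkn : ((max n₁ n₂ : ℕ) : ℤ) < k := strictMono_bd.lt_iff_lt.1 (hzn.trans_lt hc'.2)
    refine ⟨k, by simpa using hkn, hc', ?_, ?_, ?_, ?_⟩
    · simpa using z1
    · simpa using z2
    · rw [ellWeight, if_neg (by omega), if_neg (by omega)]
      simp only [zpow_neg, zpow_one, Int.natAbs_natCast, Int.cast_natCast]
      have h5 := le_abs_self (B₁ k)
      have h6 := abs_nonneg (B₂ k)
      rw [inv_mul_le_iff₀ (by linarith)]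
      refine e1.trans ?_
      gcongr
      linarith
    · simp only [muVac, zpow_natCast, Int.natAbs_natCast]
      linarith [le_abs_self (B₁ k), abs_nonneg (B₂ k)]
  · have hz0 : 0 < ‖z‖ := norm_pos_iff.2 hz.1
    have hzn' : bd (max n₁ n₂ : ℕ) ≤ ‖z⁻¹‖ := by
      rw [bd_neg_sub] at hzn
      rw [norm_inv, le_inv_comm₀ (bd_pos _) hz0]; exact hzn
    have hle : rad n₂ ≤ ‖z⁻¹‖ := by
      refine le_trans ?_ hzn'
      rw [bd_natCast]
      exact rad_le_rad (by positivity) (by push_cast; exact le_max_right _ _)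
    obtain ⟨ma, mb, mc, md⟩ := P.monodromy_flip z
    obtain ⟨k, hk, hc, z1, z2, e1, e2, e3⟩ := h₂ z⁻¹ hle (by
      rcases hz.2 with h | h
      · exact Or.inr (Or.inl (by rwa [mc, neg_eq_zero] at h))
      · exact Or.inr (Or.inr (by rwa [P.Delta_flip] at h)))
    have hc' := cellk k (by omega) z⁻¹ hc
    have hk1 : 1 ≤ k := by omega
    have hk' : (1 : ℝ) ≤ k := by exact_mod_cast hk1
    have hkn : ((max n₁ n₂ : ℕ) : ℤ) < k := strictMono_bd.lt_iff_lt.1 (hzn'.trans_lt hc'.2)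
    refine ⟨-k, by simpa using hkn, ⟨?_, ?_⟩, ?_, ?_, ?_, ?_⟩
    · rw [bd_neg_sub, inv_lt_comm₀ (bd_pos _) hz0, ← norm_inv]; exact hc'.2
    · rw [show -(k : ℤ) = -((k : ℤ) - 1) - 1 by ring, bd_neg_sub, lt_inv_comm₀ hz0 (bd_pos _), ← norm_inv]
      exact hc'.1
    · rw [norm_zeta_inv] at z1; simpa using z1
    · rw [norm_zeta_inv] at z2; simpa using z2
    · rw [ellWeight, if_pos (by omega), lamVac_neg (by omega)]
      have hL := (lamVac_natCast_mem hk1).1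
      have hw2 := sq_le_of_bd_lt hk1 hc'.1
      have hL2 := sq_le_of_bd_lt hk1 hL
      have hL0 : (lamVac k : ℂ) ≠ 0 := lamVac_ne_zero k
      have e : z - ((lamVac k)⁻¹ : ℝ) = -(z⁻¹ - lamVac k) / (z⁻¹ * lamVac k) := by
        have := hz.1
        push_cast
        field_simp
        ring
      rw [e, norm_div, norm_neg, norm_mul, Complex.norm_real, Real.norm_of_nonneg (by nlinarith)]
      have h7 : (k : ℝ) ^ 4 ≤ ‖z⁻¹‖ * lamVac k := by
        calc (k : ℝ) ^ 4 = k ^ 2 * k ^ 2 := by ring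
          _ ≤ _ := by gcongr
      have h5 := le_abs_self (B₂ k)
      have h6 := abs_nonneg (B₁ k)
      have hd : ‖z⁻¹ - lamVac k‖ / (‖z⁻¹‖ * lamVac k) ≤ (k * (|B₁ k| + |B₂ k|)) / k ^ 4 := by
        gcongr
        refine e1.trans ?_
        gcongr
        linarith
      have h8 : |((-(k : ℤ) : ℤ) : ℝ)| = k := by simp
      simp only [h8, Int.natAbs_neg, Int.natAbs_natCast]
      calc (k : ℝ) ^ (3 : ℤ) * (‖z⁻¹ - lamVac k‖ / (‖z⁻¹‖ * lamVac k)) ≤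
            (k : ℝ) ^ (3 : ℤ) * ((k * (|B₁ k| + |B₂ k|)) / k ^ 4) := by gcongr
        _ = |B₁ k| + |B₂ k| := by
            rw [show (k : ℝ) ^ (3 : ℤ) = (k : ℝ) ^ 3 by norm_cast]
            field_simp
    · rw [ma]
      have : muVac (-k) = (-1) ^ k := by
        rw [muVac, zpow_neg, zpow_natCast, ← inv_pow, inv_neg, inv_one]
      rw [this]
      simp only [Int.natAbs_neg, Int.natAbs_natCast]
      linarith [le_abs_self (B₂ k), abs_nonneg (B₁ k)]

/-- The S_k are bounded by level sets of |ζ|, the counting regions by circles in |z|. For large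
index no zero lies in the gap between them, so they contain the same zeros. -/
theorem exists_special_location : ∃ n₁ : ℕ, ∃ B : ℤ → ℝ, (Summable fun k => B k ^ 2) ∧
    (∀ k : ℤ, (n₁ : ℤ) < |k| → ∀ z, P.IsSpecial z →
      (z ∈ annulus k ↔ bd (k - 1) < ‖z‖ ∧ ‖z‖ < bd k) ∧ (z ∈ annulus k →
        ellWeight (-1) 3 k * ‖z - lamVac k‖ ≤ B k ∧ ‖P.monodromy z 0 0 - muVac k‖ ≤ B k)) ∧
    (∀ N : ℕ, n₁ ≤ N → ∀ z, P.IsSpecial z →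
      ((z ∈ ⋃ k : {k : ℤ // |k| ≤ (N : ℤ)}, annulus k) ↔ bd (-N - 1) < ‖z‖ ∧ ‖z‖ < bd N)) ∧
    ∀ N : ℕ, n₁ ≤ N → ∀ z, P.IsSpecial z → (bd (-N - 1) < ‖z‖ ∧ ‖z‖ < bd N) ∨
      ∃ k : ℤ, (N : ℤ) < |k| ∧ bd (k - 1) < ‖z‖ ∧ ‖z‖ < bd k := by
  obtain ⟨n₀, B, hB, h⟩ := P.exists_special_asymptotics
  have hπ := Real.pi_gt_three
  have mid : ∀ z, ¬ (bd n₀ ≤ ‖z‖ ∨ ‖z‖ ≤ bd (-n₀ - 1)) →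
      ‖zeta z‖ < ((n₀ : ℝ) + 1 + 1 / 2) * Real.pi := fun z hz => by
    push Not at hz
    have := norm_zeta_le_of_norm_le (n := n₀) (z := z) (by rw [← bd_neg_sub_one]; exact hz.2.le)
      (by rw [← bd_natCast]; exact hz.1.le)
    linarith
  have hmono := strictMono_bd.monotone
  -- In the middle region |ζ| < (n₀ + 3/2)π, which lies below every S_k with |k| ≥ n₀ + 2.
  refine ⟨n₀ + 1, B, hB, fun k hk z hz => ?_, fun N hN z hz => ?_, fun N hN z hz => ?_⟩
  · have hk0 : k ≠ 0 := by rintro rfl; simp at hk; omega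
    have hkn : ((n₀ : ℝ) + 1 + 1) ≤ |(k : ℝ)| := by
      have : (n₀ : ℤ) + 1 + 1 ≤ |k| := by push_cast at hk; omega
      exact_mod_cast this
    rw [mem_annulus_iff hk0]
    by_cases hzn : bd n₀ ≤ ‖z‖ ∨ ‖z‖ ≤ bd (-n₀ - 1)
    · obtain ⟨l, hl, hc, z1, z2, e1, e2⟩ := h z hz hzn
      have hl0 : l ≠ 0 := by rintro rfl; simp at hl; omega
      have sgn1 : 0 < l → 1 < ‖z‖ := fun h => (one_lt_bd (by omega)).trans hc.1
      have sgn2 : l < 0 → ‖z‖ < 1 := fun h => hc.2.trans (bd_lt_one h)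
      have hA : (z ≠ 0 ∧ (|(k : ℝ)| - 1 / 2) * Real.pi ≤ ‖zeta z‖ ∧
          ‖zeta z‖ ≤ (|(k : ℝ)| + 1 / 2) * Real.pi ∧ (0 < k → 1 < ‖z‖) ∧ (k < 0 → ‖z‖ < 1)) → l = k := by
        rintro ⟨-, a1, a2, a3, a4⟩
        have b1 : |k| < |l| + 1 := by
          have := lt_of_mul_lt_mul_right (a1.trans_lt z2) (by linarith)
          have : |(k : ℝ)| < |(l : ℝ)| + 1 := by linarith
          exact_mod_cast this
        have b2 : |l| < |k| + 1 := by
          have := lt_of_mul_lt_mul_right (z1.trans_le a2) (by linarith)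
          have : |(l : ℝ)| < |(k : ℝ)| + 1 := by linarith
          exact_mod_cast this
        have b3 : |l| = |k| := by omega
        rcases abs_eq_abs.1 b3 with h' | h'
        · exact h'
        · exfalso
          rcases lt_or_gt_of_ne hl0 with hl | hl
          · linarith [sgn2 hl, a3 (by omega)]
          · linarith [sgn1 hl, a4 (by omega)]
      refine ⟨⟨fun ha => hA ha ▸ hc, fun ⟨c1, c2⟩ => ?_⟩, fun ha => ?_⟩
      · have i1 := strictMono_bd.lt_iff_lt.1 (c1.trans hc.2)
        have i2 := strictMono_bd.lt_iff_lt.1 (hc.1.trans c2)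
        have : l = k := by omega
        subst this
        exact ⟨hz.1, z1.le, z2.le, sgn1, sgn2⟩
      · rw [← hA ha]; exact ⟨e1, e2⟩
    · have hm := mid z hzn
      have no : ¬ (|(k : ℝ)| - 1 / 2) * Real.pi ≤ ‖zeta z‖ := fun h => by nlinarith
      refine ⟨⟨fun ha => absurd ha.2.1 no, fun ⟨c1, c2⟩ => (hzn ?_).elim⟩, fun ha => absurd ha.2.1 no⟩
      rcases lt_or_gt_of_ne hk0 with h0 | h0
      · rw [abs_of_neg h0] at hk
        exact Or.inr (c2.le.trans (hmono (by push_cast at hk; omega)))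
      · rw [abs_of_pos h0] at hk
        exact Or.inl ((hmono (by push_cast at hk; omega)).trans c1.le)
  · have hNn : (n₀ : ℝ) + 1 ≤ N := by exact_mod_cast hN
    rw [mem_iUnion_annulus_iff]
    by_cases hzn : bd n₀ ≤ ‖z‖ ∨ ‖z‖ ≤ bd (-n₀ - 1)
    · obtain ⟨l, hl, hc, z1, z2, -⟩ := h z hz hzn
      constructor
      · rintro ⟨-, a⟩
        have b2 : |l| ≤ N := by
          have := lt_of_mul_lt_mul_right (z1.trans_le a) (by linarith)
          have : |(l : ℝ)| < N + 1 := by linarith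
          have : |l| < N + 1 := by exact_mod_cast this
          omega
        rw [abs_le] at b2
        exact ⟨(hmono (by omega)).trans_lt hc.1, hc.2.trans_le (hmono b2.2)⟩
      · rintro ⟨c1, c2⟩
        have i1 := strictMono_bd.lt_iff_lt.1 (c1.trans hc.2)
        have i2 := strictMono_bd.lt_iff_lt.1 (hc.1.trans c2)
        have : |l| ≤ N := abs_le.2 ⟨by omega, by omega⟩
        have : |(l : ℝ)| ≤ N := by exact_mod_cast this
        refine ⟨hz.1, z2.le.trans ?_⟩
        gcongr
    · have hm := mid z hzn
      push Not at hzn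
      refine ⟨fun _ => ⟨(hmono (by omega)).trans_lt hzn.2, hzn.1.trans_le (hmono (by omega))⟩,
        fun _ => ⟨hz.1, hm.le.trans ?_⟩⟩
      gcongr
  · by_cases hzn : bd n₀ ≤ ‖z‖ ∨ ‖z‖ ≤ bd (-n₀ - 1)
    · obtain ⟨l, hl, hc, -⟩ := h z hz hzn
      rcases le_or_gt |l| (N : ℤ) with hlN | hlN
      · rw [abs_le] at hlN
        exact Or.inl ⟨(hmono (by omega)).trans_lt hc.1, hc.2.trans_le (hmono hlN.2)⟩
      · exact Or.inr ⟨l, hlN, hc⟩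
    · push Not at hzn
      exact Or.inl ⟨(hmono (by omega)).trans_lt hzn.2, hzn.1.trans_le (hmono (by omega))⟩

end Pot

end SinhGordon

namespace SinhGordon

/-! ### Local lemmas on holomorphic functions -/

theorem exists_analytic_sqrt {f : ℂ → ℂ} {z ρ : ℂ} (hf : AnalyticAt ℂ f z) (hρ : ρ ^ 2 = f z)
    (h0 : f z ≠ 0) : ∃ r : ℂ → ℂ, AnalyticAt ℂ r z ∧ r z = ρ ∧ ∀ᶠ w in 𝓝 z, r w ^ 2 = f w := by
  have hd : AnalyticAt ℂ (fun w => f w / f z) z := hf.div_const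
  have h1 : f z / f z = 1 := div_self h0
  have hl : AnalyticAt ℂ (fun w => Complex.log (f w / f z)) z :=
    hd.clog (by rw [h1]; exact Complex.one_mem_slitPlane)
  refine ⟨fun w => ρ * Complex.exp (Complex.log (f w / f z) / 2),
    analyticAt_const.mul (hl.div_const).cexp, by simp [h1], ?_⟩
  filter_upwards [hf.continuousAt.eventually_ne h0] with w hw
  rw [mul_pow, hρ, ← Complex.exp_nat_mul]
  push_cast
  rw [mul_div_cancel₀ _ (two_ne_zero), Complex.exp_log (div_ne_zero hw h0), mul_div_cancel₀ _ h0]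

theorem exists_analytic_extension {φ : ℂ → ℂ} {z₀ : ℂ} (h : ∀ᶠ z in 𝓝[≠] z₀, AnalyticAt ℂ φ z)
    {K : ℝ} (hb : ∀ᶠ z in 𝓝[≠] z₀, ‖φ z‖ ≤ K) :
    ∃ ψ : ℂ → ℂ, AnalyticAt ℂ ψ z₀ ∧ ∀ᶠ z in 𝓝[≠] z₀, φ z = ψ z := by
  have hlim := Complex.tendsto_limUnder_of_differentiable_on_punctured_nhds_of_bounded_under
    (h.mono fun z hz => hz.differentiableAt) (isBoundedUnder_of_eventually_le
      (a := K + ‖φ z₀‖) (hb.mono fun z hz => (norm_sub_le _ _).trans (by gcongr)))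
  set y := limUnder (𝓝[≠] z₀) φ
  have he : ∀ᶠ z in 𝓝[≠] z₀, φ z = Function.update φ z₀ y z :=
    eventually_mem_nhdsWithin.mono fun z hz => by rw [Function.update_of_ne hz]
  refine ⟨Function.update φ z₀ y, ?_, he⟩
  refine Complex.analyticAt_of_differentiable_on_punctured_nhds_of_continuousAt ?_
    (continuousAt_update_same.2 hlim)
  filter_upwards [h, eventually_mem_nhdsWithin] with z hz hz0
  exact hz.differentiableAt.congr_of_eventuallyEq (by
    filter_upwards [isOpen_ne.mem_nhds hz0] with w hw
    rw [Function.update_of_ne hw])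

theorem exists_taylor {f : ℂ → ℂ} {z₀ : ℂ} (hf : AnalyticAt ℂ f z₀) (n : ℕ) :
    ∃ v : Fin n → ℂ, ∃ g : ℂ → ℂ, AnalyticAt ℂ g z₀ ∧
      ∀ z, f z = ∑ j, v j * (z - z₀) ^ (j : ℕ) + (z - z₀) ^ n * g z := by
  induction n with
  | zero => exact ⟨fun _ => 0, f, hf, fun z => by simp⟩
  | succ n ih =>
    obtain ⟨v, g, hg, h⟩ := ih
    obtain ⟨p, hp⟩ := hg
    refine ⟨Fin.snoc v (g z₀), dslope g z₀, ⟨_, hp.has_fpower_series_dslope_fslope⟩, fun z => ?_⟩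
    rw [h z, Fin.sum_univ_castSucc]
    have : g z = g z₀ + (z - z₀) * dslope g z₀ z := by
      have := sub_smul_dslope g z₀ z
      rw [smul_eq_mul] at this
      rw [this]; ring
    simp only [Fin.snoc_castSucc, Fin.snoc_last, Fin.val_castSucc, Fin.val_last]
    rw [this]; ring

/-- Independence of the powers below `n` modulo order `n`; the lowest coefficient is the limit at
`z₀`, and one power is split off at a time. -/
theorem eq_zero_of_sum_le {n : ℕ} {v : Fin n → ℂ} {z₀ : ℂ} {C : ℝ}
    (h : ∀ᶠ z in 𝓝[≠] z₀, ‖∑ j, v j * (z - z₀) ^ (j : ℕ)‖ ≤ C * ‖z - z₀‖ ^ n) : v = 0 := by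
  induction n with
  | zero => exact Subsingleton.elim _ _
  | succ n ih =>
    have h0 : v 0 = 0 := by
      have t1 : Tendsto (fun z => ‖∑ j, v j * (z - z₀) ^ (j : ℕ)‖) (𝓝[≠] z₀) (𝓝 ‖v 0‖) := by
        have : Continuous fun z => ‖∑ j, v j * (z - z₀) ^ (j : ℕ)‖ := by fun_prop
        have := (this.tendsto z₀).mono_left (nhdsWithin_le_nhds (s := {z₀}ᶜ))
        simpa [Fin.sum_univ_succ] using this
      have t2 : Tendsto (fun z => C * ‖z - z₀‖ ^ (n + 1)) (𝓝[≠] z₀) (𝓝 0) := by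
        have : Continuous fun z => C * ‖z - z₀‖ ^ (n + 1) := by fun_prop
        have := (this.tendsto z₀).mono_left (nhdsWithin_le_nhds (s := {z₀}ᶜ))
        simpa using this
      exact norm_le_zero_iff.1 (le_of_tendsto_of_tendsto t1 t2 h)
    have h1 : (fun j : Fin n => v j.succ) = 0 := by
      refine ih ?_
      filter_upwards [h, eventually_mem_nhdsWithin] with z hz hz0
      have hpos : 0 < ‖z - z₀‖ := norm_pos_iff.2 (sub_ne_zero.2 hz0)
      rw [Fin.sum_univ_succ, h0, zero_mul, zero_add] at hz
      have e : ∑ j : Fin n, v j.succ * (z - z₀) ^ (j.succ : ℕ) =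
          (z - z₀) * ∑ j : Fin n, v j.succ * (z - z₀) ^ (j : ℕ) := by
        rw [Finset.mul_sum]
        refine Finset.sum_congr rfl fun j _ => ?_
        rw [Fin.val_succ]; ring
      rw [e, norm_mul, pow_succ, mul_comm ‖z - z₀‖, ← mul_assoc] at hz
      exact le_of_mul_le_mul_right hz hpos
    funext j
    refine Fin.cases h0 (fun j => congrFun h1 j) j

namespace Pot

variable (P : Pot)

theorem charFun_eq (p : ℂ × ℂ) : P.charFun p = p.2 ^ 2 - P.Delta p.1 * p.2 + 1 := by
  have h := P.det_monodromy p.1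
  rw [Matrix.det_fin_two] at h
  rw [charFun, Matrix.det_fin_two, Delta, Matrix.trace_fin_two]
  simp
  linear_combination h

theorem mem_curve_iff (p : ℂ × ℂ) : p ∈ P.curve ↔ p.1 ≠ 0 ∧ p.2 ^ 2 - P.Delta p.1 * p.2 + 1 = 0 := by
  rw [← P.charFun_eq]; rfl

theorem mem_curve_iff_mul (p : ℂ × ℂ) : p ∈ P.curve ↔ p.1 ≠ 0 ∧
    (p.2 - P.monodromy p.1 0 0) * (p.2 - P.monodromy p.1 1 1) =
      P.monodromy p.1 0 1 * P.monodromy p.1 1 0 := by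
  have h := P.det_monodromy p.1
  rw [Matrix.det_fin_two] at h
  rw [mem_curve_iff, Delta, Matrix.trace_fin_two]
  refine and_congr_right fun _ => ⟨fun h1 => ?_, fun h1 => ?_⟩
  · linear_combination h1 + h
  · linear_combination h1 - h

theorem mem_curve_iff_sq (p : ℂ × ℂ) : p ∈ P.curve ↔ p.1 ≠ 0 ∧
    (2 * p.2 - P.Delta p.1) ^ 2 = P.Delta p.1 ^ 2 - 4 := by
  rw [mem_curve_iff]
  refine and_congr_right fun _ => ⟨fun h1 => ?_, fun h1 => ?_⟩
  · linear_combination 4 * h1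
  · linear_combination h1 / 4

theorem analyticAt_Delta {z : ℂ} (hz : z ≠ 0) : AnalyticAt ℂ P.Delta z := by
  have e : P.Delta = fun z => P.monodromy z 0 0 + P.monodromy z 1 1 := by
    funext z; rw [Pot.Delta, Matrix.trace_fin_two]
  rw [e]
  exact (P.analyticAt_monodromy hz 0 0).add (P.analyticAt_monodromy hz 1 1)

theorem eventually_disc_ne_zero {z : ℂ} (hz : z ≠ 0) : ∀ᶠ w in 𝓝[≠] z, P.Delta w ^ 2 - 4 ≠ 0 := by
  obtain ⟨z₀, h0, h1⟩ := P.exists_disc_ne_zero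
  refine ((analyticOnNhd_disc P z hz).eventually_eq_zero_or_eventually_ne_zero).resolve_left fun h => ?_
  exact analyticOrderAt_ne_top_of_ne_zero (analyticOnNhd_disc P) h0 h1 hz (analyticOrderAt_eq_top.2 h)

theorem c_order_ne_top {z : ℂ} (hz : z ≠ 0) :
    analyticOrderAt (fun w => P.monodromy w 1 0) z ≠ ⊤ := by
  obtain ⟨z₀, h0, h1⟩ := P.exists_c_ne_zero
  exact analyticOrderAt_ne_top_of_ne_zero (analyticOnNhd_monodromy P 1 0) h0 h1 hz

theorem disc_order_ne_top {z : ℂ} (hz : z ≠ 0) :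
    analyticOrderAt (fun w => P.Delta w ^ 2 - 4) z ≠ ⊤ := by
  obtain ⟨z₀, h0, h1⟩ := P.exists_disc_ne_zero
  exact analyticOrderAt_ne_top_of_ne_zero (analyticOnNhd_disc P) h0 h1 hz

theorem eventually_c_ne_zero {z : ℂ} (hz : z ≠ 0) : ∀ᶠ w in 𝓝[≠] z, P.monodromy w 1 0 ≠ 0 :=
  ((analyticOnNhd_monodromy P 1 0 z hz).eventually_eq_zero_or_eventually_ne_zero).resolve_left fun h =>
    P.c_order_ne_top hz (analyticOrderAt_eq_top.2 h)

/-! ### Points of the curve near a given point -/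

variable {P}

/-- The fibre through `p` contains at most one other point, with second coordinate Δ - μ, and that
point is not close to `p`. -/
theorem eventually_fst_ne {p : ℂ × ℂ} (hp : p ∈ P.curve) :
    ∀ᶠ q in 𝓝[P.curve \ {p}] p, q.1 ≠ p.1 := by
  have h1 : ∀ᶠ q : ℂ × ℂ in 𝓝 p, P.Delta p.1 - p.2 ≠ p.2 → q.2 ≠ P.Delta p.1 - p.2 := by
    by_cases h : P.Delta p.1 - p.2 = p.2
    · exact Eventually.of_forall fun q hq => absurd h hq
    · exact (continuous_snd.continuousAt.eventually_ne (Ne.symm h)).mono fun q hq _ => hq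
  filter_upwards [nhdsWithin_le_nhds h1, eventually_mem_nhdsWithin] with q hq hqc h
  rw [mem_curve_iff] at hp
  have h2 := (P.mem_curve_iff q).1 hqc.1
  rw [h] at h2
  have h3 : (q.2 - p.2) * (q.2 - (P.Delta p.1 - p.2)) = 0 := by linear_combination h2.2 - hp.2
  have hne : q.2 ≠ p.2 := fun h4 => hqc.2 (Prod.ext h h4)
  rcases mul_eq_zero.1 h3 with h4 | h4
  · exact hne (sub_eq_zero.1 h4)
  · rw [sub_eq_zero] at h4
    exact hq (fun h5 => hne (h4.trans h5)) h4

theorem tendsto_fst {p : ℂ × ℂ} (hp : p ∈ P.curve) :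
    Tendsto Prod.fst (𝓝[P.curve \ {p}] p) (𝓝[≠] p.1) :=
  tendsto_nhdsWithin_iff.2 ⟨(continuous_fst.tendsto p).mono_left nhdsWithin_le_nhds,
    eventually_fst_ne hp⟩

/-- Multiplication by c and by μ - a makes the section holomorphic; these relations determine the
module. -/
theorem eventually_mul_eigenSection {p : ℂ × ℂ} (hp : p ∈ P.curve) :
    ∀ᶠ q in 𝓝[P.curve \ {p}] p, P.monodromy q.1 1 0 ≠ 0 ∧
      (q.2 - P.monodromy q.1 0 0) * P.eigenSection q = P.monodromy q.1 0 1 ∧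
      P.monodromy q.1 1 0 * P.eigenSection q = q.2 - P.monodromy q.1 1 1 := by
  filter_upwards [(tendsto_fst hp).eventually (P.eventually_c_ne_zero hp.1),
    eventually_mem_nhdsWithin] with q hc hq
  refine ⟨hc, ?_, ?_⟩
  · rw [eigenSection, ← mul_div_assoc, ((P.mem_curve_iff_mul q).1 hq.1).2, mul_div_cancel_right₀ _ hc]
  · rw [eigenSection, mul_div_cancel₀ _ hc]

/-- A sheet of the curve near `p`, not necessarily continuous. -/
theorem tendsto_sheet {p : ℂ × ℂ} (hp : p ∈ P.curve) {m : ℂ → ℂ}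
    (hm : Tendsto m (𝓝[≠] p.1) (𝓝 p.2))
    (hc : ∀ᶠ z in 𝓝[≠] p.1, (2 * m z - P.Delta z) ^ 2 = P.Delta z ^ 2 - 4) :
    Tendsto (fun z => (z, m z)) (𝓝[≠] p.1) (𝓝[P.curve \ {p}] p) := by
  refine tendsto_nhdsWithin_iff.2 ⟨(tendsto_id.mono_left nhdsWithin_le_nhds).prodMk_nhds hm, ?_⟩
  filter_upwards [hc, eventually_mem_nhdsWithin,
    nhdsWithin_le_nhds (isOpen_ne.mem_nhds hp.1)] with z h1 h2 h3
  exact ⟨(P.mem_curve_iff_sq _).2 ⟨h3, h1⟩, fun h => h2 (congrArg Prod.fst h)⟩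

/-! ### The stalks -/

variable (P)

theorem mem_structureStalk {p : ℂ × ℂ} {g : P.PuncturedGerm p} : g ∈ P.structureStalk p ↔
    ∃ h : ℂ × ℂ → ℂ, AnalyticAt ℂ h p ∧ g = (h : P.PuncturedGerm p) := by
  refine ⟨fun hg => ?_, fun hg => Submodule.subset_span hg⟩
  induction hg using Submodule.span_induction with
  | mem x hx => exact hx
  | zero => exact ⟨fun _ => 0, analyticAt_const, rfl⟩
  | add x y _ _ hx hy =>
    obtain ⟨h, hh, rfl⟩ := hx
    obtain ⟨k, hk, rfl⟩ := hy
    exact ⟨h + k, hh.add hk, rfl⟩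
  | smul a x _ hx =>
    obtain ⟨h, hh, rfl⟩ := hx
    exact ⟨a • h, hh.const_smul, rfl⟩

theorem mem_divisorStalk {p : ℂ × ℂ} {g : P.PuncturedGerm p} : g ∈ P.divisorStalk p ↔
    ∃ h₁ h₂ : ℂ × ℂ → ℂ, AnalyticAt ℂ h₁ p ∧ AnalyticAt ℂ h₂ p ∧
      g = ((fun q => h₁ q + h₂ q * P.eigenSection q : ℂ × ℂ → ℂ) : P.PuncturedGerm p) := by
  refine ⟨fun hg => ?_, fun hg => Submodule.subset_span hg⟩
  induction hg using Submodule.span_induction with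
  | mem x hx => exact hx
  | zero => exact ⟨fun _ => 0, fun _ => 0, analyticAt_const, analyticAt_const, by simp; rfl⟩
  | add x y _ _ hx hy =>
    obtain ⟨h, k, hh, hk, rfl⟩ := hx
    obtain ⟨h', k', hh', hk', rfl⟩ := hy
    refine ⟨h + h', k + k', hh.add hh', hk.add hk', ?_⟩
    rw [← Germ.coe_add]
    congr 1
    funext q
    simp only [Pi.add_apply]; ring
  | smul a x _ hx =>
    obtain ⟨h, k, hh, hk, rfl⟩ := hx
    refine ⟨a • h, a • k, hh.const_smul, hk.const_smul, ?_⟩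
    rw [← Germ.coe_smul]
    congr 1
    funext q
    simp only [Pi.smul_apply, smul_eq_mul]; ring

theorem spectralDivisor_eq_zero {p : ℂ × ℂ} {e : ℂ × ℂ → ℂ} (he : AnalyticAt ℂ e p)
    (h : ∀ᶠ q in 𝓝[P.curve \ {p}] p, P.eigenSection q = e q) : P.spectralDivisor p = 0 := by
  have hle : P.divisorStalk p ≤ P.structureStalk p := fun g hg => by
    obtain ⟨h₁, h₂, a₁, a₂, rfl⟩ := P.mem_divisorStalk.1 hg
    refine P.mem_structureStalk.2 ⟨fun q => h₁ q + h₂ q * e q, a₁.add (a₂.mul he), ?_⟩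
    exact Germ.coe_eq.2 (h.mono fun q hq => by simp only [hq])
  have htop : (P.structureStalk p).submoduleOf (P.divisorStalk p) = ⊤ :=
    Submodule.submoduleOf_eq_top.2 hle
  rw [spectralDivisor, htop, rank_subsingleton', map_zero]

/-- Write e for the eigenvector section. By `hdec`, and since (μ - a)e = b and ce = μ - d are
holomorphic, the quotient is spanned by H(λ)e with H taken modulo c, that is by polynomials of
degree below the order `n` of c. By `hinj`, He is holomorphic only if H = O(c), so these polynomials
are independent. -/
theorem spectralDivisor_eq_of {p : ℂ × ℂ} (hp : p ∈ P.curve)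
    (hdec : ∀ h : ℂ × ℂ → ℂ, AnalyticAt ℂ h p → ∃ H g : ℂ → ℂ, AnalyticAt ℂ H p.1 ∧
      AnalyticAt ℂ g p.1 ∧ ∀ᶠ q in 𝓝[P.curve \ {p}] p,
        h q = H q.1 + (q.2 - P.monodromy q.1 0 0) * g q.1)
    (hinj : ∀ q₀ : ℂ → ℂ, ∀ k : ℂ × ℂ → ℂ, AnalyticAt ℂ q₀ p.1 → AnalyticAt ℂ k p →
      (∀ᶠ q in 𝓝[P.curve \ {p}] p, q₀ q.1 * P.eigenSection q = k q) →
      ∃ C : ℝ, ∀ᶠ z in 𝓝[≠] p.1, ‖q₀ z‖ ≤ C * ‖P.monodromy z 1 0‖) :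
    P.spectralDivisor p = analyticOrderAt (fun w => P.monodromy w 1 0) p.1 := by
  have hz := hp.1
  have hc := P.analyticAt_monodromy hz 1 0
  have hb := P.analyticAt_monodromy hz 0 1
  have hd := P.analyticAt_monodromy hz 1 1
  obtain ⟨u, hu, hu0, hcu⟩ := (hc.analyticOrderAt_ne_top).1 (P.c_order_ne_top hz)
  rw [← Nat.cast_analyticOrderNatAt (P.c_order_ne_top hz)]
  set n := analyticOrderNatAt (fun w => P.monodromy w 1 0) p.1
  have hmul := eventually_mul_eigenSection hp
  set S' := (P.structureStalk p).submoduleOf (P.divisorStalk p) with hS'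
  have hpoly : ∀ v : Fin n → ℂ, AnalyticAt ℂ (fun z => ∑ j, v j * (z - p.1) ^ (j : ℕ)) p.1 := fun v =>
    Finset.analyticAt_fun_sum _ fun j _ => analyticAt_const.mul ((analyticAt_id.sub analyticAt_const).pow _)
  have lift1 : ∀ {f : ℂ → ℂ}, AnalyticAt ℂ f p.1 → AnalyticAt ℂ (fun q : ℂ × ℂ => f q.1) p :=
    fun hf => hf.comp analyticAt_fst
  set Ψ : (Fin n → ℂ) →ₗ[ℂ] P.divisorStalk p :=
    { toFun := fun v => ⟨((fun q => (∑ j, v j * (q.1 - p.1) ^ (j : ℕ)) * P.eigenSection q : ℂ × ℂ → ℂ) :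
        P.PuncturedGerm p), P.mem_divisorStalk.2 ⟨fun _ => 0, fun q => ∑ j, v j * (q.1 - p.1) ^ (j : ℕ),
          analyticAt_const, lift1 (hpoly v), by simp⟩⟩
      map_add' := fun v w => by
        ext1
        rw [Submodule.coe_add, ← Germ.coe_add]
        refine congrArg (fun φ : ℂ × ℂ → ℂ => (φ : P.PuncturedGerm p)) ?_
        funext q
        simp only [Pi.add_apply, add_mul, Finset.sum_add_distrib]
      map_smul' := fun a v => by
        ext1
        rw [RingHom.id_apply, Submodule.coe_smul, ← Germ.coe_smul]
        refine congrArg (fun φ : ℂ × ℂ → ℂ => (φ : P.PuncturedGerm p)) ?_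
        funext q
        simp only [Pi.smul_apply, smul_eq_mul, mul_assoc, Finset.mul_sum, Finset.sum_mul] } with hΨ
  set Φ := S'.mkQ.comp Ψ with hΦ
  have hinjΦ : Function.Injective Φ := by
    rw [← LinearMap.ker_eq_bot, LinearMap.ker_eq_bot']
    intro v hv
    rw [hΦ, LinearMap.comp_apply, Submodule.mkQ_apply, Submodule.Quotient.mk_eq_zero, hS',
      Submodule.submoduleOf, Submodule.mem_comap, Submodule.subtype_apply] at hv
    obtain ⟨k, hk, hk2⟩ := P.mem_structureStalk.1 hv
    obtain ⟨C, hC⟩ := hinj _ k (hpoly v) hk (Germ.coe_eq.1 hk2)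
    have hub : ∀ᶠ z in 𝓝[≠] p.1, ‖u z‖ ≤ ‖u p.1‖ + 1 :=
      nhdsWithin_le_nhds (hu.continuousAt.norm.eventually_le_const (by linarith))
    refine eq_zero_of_sum_le (C := |C| * (‖u p.1‖ + 1)) (z₀ := p.1) ?_
    filter_upwards [hC, hub, nhdsWithin_le_nhds hcu] with z h1 h2 h3
    refine h1.trans ?_
    rw [h3, norm_smul, norm_pow]
    calc C * (‖z - p.1‖ ^ n * ‖u z‖) ≤ |C| * (‖z - p.1‖ ^ n * (‖u p.1‖ + 1)) := by
          gcongr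
          exact le_abs_self C
      _ = _ := by ring
  have hsurj : Function.Surjective Φ := by
    intro x
    obtain ⟨⟨t, ht⟩, rfl⟩ := Submodule.mkQ_surjective S' x
    obtain ⟨h₁, h₂, a₁, a₂, rfl⟩ := P.mem_divisorStalk.1 ht
    obtain ⟨H, g, hH, hg, he⟩ := hdec h₂ a₂
    obtain ⟨v, H₂, hH₂, hv⟩ := exists_taylor hH n
    refine ⟨v, ?_⟩
    rw [hΦ, LinearMap.comp_apply, Submodule.mkQ_apply, Submodule.mkQ_apply, eq_comm,
      Submodule.Quotient.eq, hS', Submodule.submoduleOf, Submodule.mem_comap, Submodule.subtype_apply, Submodule.coe_sub]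
    -- With c = (λ - λ_p)ⁿu, the Taylor remainder satisfies (λ - λ_p)ⁿH₂e = (H₂/u)ce = (H₂/u)(μ -
    -- d).
    refine P.mem_structureStalk.2 ⟨fun q => h₁ q + (H₂ q.1 / u q.1) * (q.2 - P.monodromy q.1 1 1) +
      g q.1 * P.monodromy q.1 0 1, ?_, ?_⟩
    · exact (a₁.add ((lift1 (hH₂.div hu hu0)).mul (analyticAt_snd.sub (lift1 hd)))).add
        ((lift1 hg).mul (lift1 hb))
    · rw [hΨ]
      simp only [LinearMap.coe_mk, AddHom.coe_mk]
      rw [← Germ.coe_sub]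
      refine Germ.coe_eq.2 ?_
      filter_upwards [hmul, he, (tendsto_fst hp).eventually (nhdsWithin_le_nhds hcu),
        (tendsto_fst hp).eventually (nhdsWithin_le_nhds (hu.continuousAt.eventually_ne hu0))]
        with q h1 h2 h3 h4
      obtain ⟨m1, m2, m3⟩ := h1
      simp only [Pi.sub_apply]
      rw [h2, hv q.1, ← m2, ← m3, h3, smul_eq_mul]
      field_simp
      ring
  have hrank := (LinearEquiv.ofBijective Φ ⟨hinjΦ, hsurj⟩).rank_eq
  rw [spectralDivisor, ← hS', ← hrank]
  simp

end Pot

end SinhGordon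

namespace SinhGordon

namespace Pot

variable (P : Pot)

/-! ### The multiplicities of the spectral divisor -/

/-- Near `p` the curve is a graph μ = m(λ), so its functions depend on λ alone. There ce = m - d is
nonzero at `p`, hence a holomorphic qe forces q = O(c). -/
theorem spectralDivisor_of_separated {p : ℂ × ℂ} (hp : p ∈ P.curve) (hc : P.monodromy p.1 1 0 = 0)
    (ha : p.2 = P.monodromy p.1 0 0) (had : P.monodromy p.1 0 0 ≠ P.monodromy p.1 1 1) :
    P.spectralDivisor p = analyticOrderAt (fun w => P.monodromy w 1 0) p.1 := by
  have hz := hp.1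
  have hΔ := P.analyticAt_Delta hz
  have hd := P.analyticAt_monodromy hz 1 1
  have hsub := sub_ne_zero.2 had
  have hD0 : (P.monodromy p.1 0 0 - P.monodromy p.1 1 1) ^ 2 = P.Delta p.1 ^ 2 - 4 := by
    rw [P.Delta_sq_sub_four, hc]; ring
  -- The value a - d of the root at λ_p selects the sheet through `p`, where μ = a.
  obtain ⟨r, hr, hr0, hr2⟩ := exists_analytic_sqrt (analyticOnNhd_disc P p.1 hz) hD0
    (by rw [← hD0]; exact pow_ne_zero 2 hsub)
  set m : ℂ → ℂ := fun z => (P.Delta z + r z) / 2 with hm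
  have hma : AnalyticAt ℂ m p.1 := (hΔ.add hr).div_const
  have hm0 : m p.1 = p.2 := by
    rw [hm, ha]; simp only [hr0, Delta, Matrix.trace_fin_two]; ring
  have hsheet : ∀ᶠ q in 𝓝[P.curve \ {p}] p, q.2 = m q.1 := by
    have h1 : ∀ᶠ q : ℂ × ℂ in 𝓝 p, 2 * q.2 - P.Delta q.1 + r q.1 ≠ 0 := by
      have hcont : ContinuousAt (fun q : ℂ × ℂ => 2 * q.2 - P.Delta q.1 + r q.1) p :=
        ((continuousAt_const.mul continuousAt_snd).sub
          (hΔ.continuousAt.comp continuousAt_fst)).add (hr.continuousAt.comp continuousAt_fst)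
      refine hcont.eventually_ne ?_
      rw [hr0, ha, Delta, Matrix.trace_fin_two]
      intro h
      exact hsub (by linear_combination h / 2)
    filter_upwards [nhdsWithin_le_nhds h1, (tendsto_fst hp).eventually (nhdsWithin_le_nhds hr2),
      eventually_mem_nhdsWithin] with q h1 h2 h3
    have h4 := ((P.mem_curve_iff_sq q).1 h3.1).2
    rw [← h2] at h4
    rcases sq_eq_sq_iff_eq_or_eq_neg.1 h4 with h5 | h5
    · simp only [hm]; linear_combination h5 / 2
    · exact absurd (by rw [h5]; ring) h1
  refine P.spectralDivisor_eq_of hp (fun h hh => ?_) fun q₀ k hq hk he => ?_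
  · refine ⟨fun z => h (z, m z), fun _ => 0, ?_, analyticAt_const, ?_⟩
    · exact AnalyticAt.comp_of_eq (g := h) (f := fun z => (z, m z)) hh (analyticAt_id.prod hma)
        (Prod.ext rfl hm0)
    · filter_upwards [hsheet] with q hq
      rw [mul_zero, add_zero, ← hq]
  · have htend := tendsto_sheet hp (m := m) (by
      rw [← hm0]; exact hma.continuousAt.tendsto.mono_left nhdsWithin_le_nhds)
      (nhdsWithin_le_nhds (hr2.mono fun z hz => by simp only [hm]; rw [← hz]; ring))
    have hkb : ∀ᶠ z in 𝓝[≠] p.1, ‖k (z, m z)‖ ≤ ‖k p‖ + 1 :=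
      htend.eventually (nhdsWithin_le_nhds (hk.continuousAt.norm.eventually_le_const (by linarith)))
    have hmd : ∀ᶠ z in 𝓝[≠] p.1, ‖P.monodromy p.1 0 0 - P.monodromy p.1 1 1‖ / 2 ≤
        ‖m z - P.monodromy z 1 1‖ := by
      refine nhdsWithin_le_nhds ((hma.continuousAt.sub hd.continuousAt).norm.eventually_const_le ?_)
      simp only [Pi.sub_apply]
      rw [hm0, ha]
      exact half_lt_self (norm_pos_iff.2 hsub)
    have hpos : 0 < ‖P.monodromy p.1 0 0 - P.monodromy p.1 1 1‖ / 2 := half_pos (norm_pos_iff.2 hsub)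
    refine ⟨(‖k p‖ + 1) / (‖P.monodromy p.1 0 0 - P.monodromy p.1 1 1‖ / 2), ?_⟩
    filter_upwards [htend.eventually he, htend.eventually (eventually_mul_eigenSection hp),
      hkb, hmd] with z h1 h2 h3 h4
    have e : q₀ z * (m z - P.monodromy z 1 1) = P.monodromy z 1 0 * k (z, m z) := by
      rw [← h1, ← h2.2.2]; ring
    have e' := congrArg norm e
    rw [norm_mul, norm_mul] at e'
    rw [div_mul_eq_mul_div, le_div_iff₀ hpos]
    calc _ ≤ ‖q₀ z‖ * ‖m z - P.monodromy z 1 1‖ := by gcongr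
      _ = ‖P.monodromy z 1 0‖ * ‖k (z, m z)‖ := e'
      _ ≤ ‖P.monodromy z 1 0‖ * (‖k p‖ + 1) := by gcongr
      _ = _ := by ring

/-- Division with remainder by `μ - a` on the curve near a point at which both sheets meet. -/
theorem exists_decomposition {p : ℂ × ℂ} (hp : p ∈ P.curve) {r : ℂ → ℂ} (hr : ∀ z, r z ^ 2 = P.Delta z ^ 2 - 4)
    (hplus : Tendsto (fun z => (z, (P.Delta z + r z) / 2)) (𝓝[≠] p.1) (𝓝[P.curve \ {p}] p))
    (hminus : Tendsto (fun z => (z, (P.Delta z - r z) / 2)) (𝓝[≠] p.1) (𝓝[P.curve \ {p}] p))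
    {h : ℂ × ℂ → ℂ} (hh : AnalyticAt ℂ h p) :
    ∃ H g : ℂ → ℂ, AnalyticAt ℂ H p.1 ∧ AnalyticAt ℂ g p.1 ∧ ∀ᶠ q in 𝓝[P.curve \ {p}] p,
      h q = H q.1 + (q.2 - P.monodromy q.1 0 0) * g q.1 := by
  have hz := hp.1
  have hΔ := P.analyticAt_Delta hz
  have ha := P.analyticAt_monodromy hz 0 0
  -- `sym` and `alt` do not change when r is replaced by -r at a point. Hence they are holomorphic
  -- where Δ² ≠ 4 for a pointwise choice of r; both are bounded (`alt` by a Lipschitz estimate), and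
  -- their singularity at λ_p is removable.
  set sym : (ℂ → ℂ) → ℂ → ℂ := fun r z =>
    (h (z, (P.Delta z + r z) / 2) + h (z, (P.Delta z - r z) / 2)) / 2 with hsym
  set alt : (ℂ → ℂ) → ℂ → ℂ := fun r z =>
    (h (z, (P.Delta z + r z) / 2) - h (z, (P.Delta z - r z) / 2)) / r z with halt
  obtain ⟨L, U, hU, hL⟩ := (hh.contDiffAt (n := 1)).exists_lipschitzOnWith
  have hUp := hplus.eventually (nhdsWithin_le_nhds hU)
  have hUm := hminus.eventually (nhdsWithin_le_nhds hU)
  have hkb := hh.continuousAt.norm.eventually_le_const (show ‖h p‖ < ‖h p‖ + 1 by linarith)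
  have hne := P.eventually_disc_ne_zero hz
  have hrne : ∀ᶠ z in 𝓝[≠] p.1, r z ≠ 0 := hne.mono fun z h1 h2 => h1 (by rw [← hr, h2]; ring)
  have hAn : ∀ᶠ z in 𝓝[≠] p.1, AnalyticAt ℂ (sym r) z ∧ AnalyticAt ℂ (alt r) z := by
    filter_upwards [hne, hplus.eventually (nhdsWithin_le_nhds hh.eventually_analyticAt),
      hminus.eventually (nhdsWithin_le_nhds hh.eventually_analyticAt),
      nhdsWithin_le_nhds (isOpen_ne.mem_nhds hz)] with w h1 h2 h3 h4
    obtain ⟨ρ, hρ, hρw, hρ2⟩ := exists_analytic_sqrt (analyticOnNhd_disc P w h4) (hr w) h1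
    have hΔw := P.analyticAt_Delta h4
    have hρ0 : ρ w ≠ 0 := fun h5 => h1 (by rw [← hρ2.self_of_nhds, h5]; ring)
    have A1 : AnalyticAt ℂ (fun z => h (z, (P.Delta z + ρ z) / 2)) w :=
      AnalyticAt.comp_of_eq (g := h) (f := fun z => (z, (P.Delta z + ρ z) / 2)) h2
        (analyticAt_id.prod ((hΔw.add hρ).div_const)) (by simp only [hρw])
    have A2 : AnalyticAt ℂ (fun z => h (z, (P.Delta z - ρ z) / 2)) w :=
      AnalyticAt.comp_of_eq (g := h) (f := fun z => (z, (P.Delta z - ρ z) / 2)) h3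
        (analyticAt_id.prod ((hΔw.sub hρ).div_const)) (by simp only [hρw])
    have hpm : ∀ᶠ z in 𝓝 w, r z = ρ z ∨ r z = -ρ z := hρ2.mono fun z h5 =>
      sq_eq_sq_iff_eq_or_eq_neg.1 (by rw [hr, h5])
    constructor
    · refine ((A1.add A2).div_const (c := 2)).congr ?_
      filter_upwards [hpm] with z h5
      rcases h5 with h5 | h5
      · simp only [hsym, h5, Pi.add_apply]
      · simp only [hsym, h5, Pi.add_apply, sub_neg_eq_add, ← sub_eq_add_neg]; ring
    · refine ((A1.sub A2).div hρ hρ0).congr ?_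
      filter_upwards [hpm] with z h5
      rcases h5 with h5 | h5
      · simp only [halt, h5, Pi.sub_apply, Pi.div_apply]
      · simp only [halt, h5, Pi.sub_apply, Pi.div_apply, sub_neg_eq_add, ← sub_eq_add_neg, div_neg]; ring
  obtain ⟨S, hS, hSe⟩ := exists_analytic_extension (φ := sym r) (K := ‖h p‖ + 1)
    (hAn.mono fun z h => h.1) (by
      filter_upwards [hplus.eventually (nhdsWithin_le_nhds hkb),
        hminus.eventually (nhdsWithin_le_nhds hkb)] with z h1 h2
      simp only [hsym]
      rw [norm_div, Complex.norm_ofNat, div_le_iff₀ two_pos]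
      exact (norm_add_le _ _).trans (by linarith))
  obtain ⟨G, hG, hGe⟩ := exists_analytic_extension (φ := alt r) (K := L)
    (hAn.mono fun z h => h.2) (by
      filter_upwards [hUp, hUm, hrne] with z h1 h2 h3
      simp only [halt]
      rw [norm_div, div_le_iff₀ (norm_pos_iff.2 h3), ← dist_eq_norm]
      refine (hL.dist_le_mul _ h1 _ h2).trans (le_of_eq ?_)
      rw [Prod.dist_eq]
      simp only [dist_self]
      rw [max_eq_right dist_nonneg, dist_eq_norm]
      congr 2; ring)
  refine ⟨fun z => S z + (P.monodromy z 0 0 - P.Delta z / 2) * G z, G,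
    hS.add ((ha.sub hΔ.div_const).mul hG), hG, ?_⟩
  filter_upwards [(tendsto_fst hp).eventually hSe, (tendsto_fst hp).eventually hGe,
    (tendsto_fst hp).eventually hrne, eventually_mem_nhdsWithin] with q h1 h2 h3 h4
  have h5 := ((P.mem_curve_iff_sq q).1 h4.1).2
  rw [← hr] at h5
  rw [← h1, ← h2]
  simp only [hsym, halt]
  rcases sq_eq_sq_iff_eq_or_eq_neg.1 h5 with h6 | h6
  · have e : q.2 = (P.Delta q.1 + r q.1) / 2 := by linear_combination h6 / 2
    have e2 : h q = h (q.1, (P.Delta q.1 + r q.1) / 2) := by rw [← e]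
    rw [e2, e]; field_simp; ring
  · have e : q.2 = (P.Delta q.1 - r q.1) / 2 := by linear_combination h6 / 2
    have e2 : h q = h (q.1, (P.Delta q.1 - r q.1) / 2) := by rw [← e]
    rw [e2, e]; field_simp; ring

/-- Subtracting the relation qe = k on the two sheets gives qr = c(k₊ - k₋), where the difference is
O(r); so q = O(c). Branch points and singular points are treated alike. -/
theorem spectralDivisor_of_meeting {p : ℂ × ℂ} (hp : p ∈ P.curve) (hΔp : P.Delta p.1 = 2 * p.2) :
    P.spectralDivisor p = analyticOrderAt (fun w => P.monodromy w 1 0) p.1 := by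
  have hz := hp.1
  have hΔ := P.analyticAt_Delta hz
  have hex : ∀ z, ∃ ρ : ℂ, ρ ^ 2 = P.Delta z ^ 2 - 4 := fun z =>
    IsAlgClosed.exists_pow_nat_eq _ (n := 2) (by norm_num)
  -- A root chosen point by point, in general discontinuous; only r → 0 at λ_p matters.
  choose r hr using hex
  have hrt : Tendsto r (𝓝[≠] p.1) (𝓝 0) := by
    have h1 : Tendsto (fun z => P.Delta z ^ 2 - 4) (𝓝[≠] p.1) (𝓝 0) := by
      have h2 := (analyticOnNhd_disc P p.1 hz).continuousAt.tendsto.mono_left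
        (nhdsWithin_le_nhds (s := {p.1}ᶜ))
      have h3 := ((P.mem_curve_iff_sq p).1 hp).2
      rw [← h3, hΔp, sub_self] at h2
      simpa using h2
    have h4 := (Real.continuous_sqrt.tendsto 0).comp (by simpa using h1.norm)
    rw [Real.sqrt_zero] at h4
    refine tendsto_zero_iff_norm_tendsto_zero.2 (h4.congr fun z => ?_)
    simp only [Function.comp_apply]
    rw [← hr, norm_pow, Real.sqrt_sq (norm_nonneg _)]
  have hΔt : Tendsto P.Delta (𝓝[≠] p.1) (𝓝 (2 * p.2)) := by
    rw [← hΔp]; exact hΔ.continuousAt.tendsto.mono_left nhdsWithin_le_nhds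
  have hplus : Tendsto (fun z => (z, (P.Delta z + r z) / 2)) (𝓝[≠] p.1) (𝓝[P.curve \ {p}] p) := by
    refine tendsto_sheet hp ?_ (Eventually.of_forall fun z => by rw [← hr]; ring)
    simpa using (hΔt.add hrt).div_const 2
  have hminus : Tendsto (fun z => (z, (P.Delta z - r z) / 2)) (𝓝[≠] p.1) (𝓝[P.curve \ {p}] p) := by
    refine tendsto_sheet hp ?_ (Eventually.of_forall fun z => by rw [← hr]; ring)
    simpa using (hΔt.sub hrt).div_const 2
  have hne := P.eventually_disc_ne_zero hz
  have hrne : ∀ᶠ z in 𝓝[≠] p.1, r z ≠ 0 := hne.mono fun z h1 h2 => h1 (by rw [← hr, h2]; ring)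
  refine P.spectralDivisor_eq_of hp
    (fun h hh => P.exists_decomposition hp hr hplus hminus hh) fun q₀ k hq hk he => ?_
  obtain ⟨L, U, hU, hL⟩ := (hk.contDiffAt (n := 1)).exists_lipschitzOnWith
  refine ⟨L, ?_⟩
  filter_upwards [hplus.eventually he, hminus.eventually he,
    hplus.eventually (eventually_mul_eigenSection hp),
    hminus.eventually (eventually_mul_eigenSection hp), hrne,
    hplus.eventually (nhdsWithin_le_nhds hU), hminus.eventually (nhdsWithin_le_nhds hU)]
    with z h1 h2 h3 h4 h5 h6 h7
  have e1 : P.monodromy z 1 0 * P.eigenSection (z, (P.Delta z + r z) / 2) =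
    (P.Delta z + r z) / 2 - P.monodromy z 1 1 := h3.2.2
  have e2 : P.monodromy z 1 0 * P.eigenSection (z, (P.Delta z - r z) / 2) =
    (P.Delta z - r z) / 2 - P.monodromy z 1 1 := h4.2.2
  have e : q₀ z * r z = P.monodromy z 1 0 * (k (z, (P.Delta z + r z) / 2) - k (z, (P.Delta z - r z) / 2)) := by
    rw [← h1, ← h2]; linear_combination -q₀ z * e1 + q₀ z * e2
  have hd := hL.dist_le_mul _ h6 _ h7
  rw [Prod.dist_eq] at hd
  simp only [dist_self] at hd
  rw [max_eq_right dist_nonneg, dist_eq_norm, dist_eq_norm,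
    show (P.Delta z + r z) / 2 - (P.Delta z - r z) / 2 = r z by ring] at hd
  have e' := congrArg norm e
  rw [norm_mul, norm_mul] at e'
  refine le_of_mul_le_mul_right ?_ (norm_pos_iff.2 h5)
  rw [e']
  calc _ ≤ ‖P.monodromy z 1 0‖ * (L * ‖r z‖) := by gcongr
    _ = _ := by ring

/-- Where μ ≠ a the section equals b/(μ - a) and is holomorphic. Where c ≠ 0 it is holomorphic too,
and the order of c is 0. -/
theorem spectralDivisor_eq {p : ℂ × ℂ} (hp : p ∈ P.curve) : P.spectralDivisor p =
    if p.2 = P.monodromy p.1 0 0 then analyticOrderAt (fun w => P.monodromy w 1 0) p.1 else 0 := by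
  have hz := hp.1
  have hc := P.analyticAt_monodromy hz 1 0
  have hb := P.analyticAt_monodromy hz 0 1
  have ha := P.analyticAt_monodromy hz 0 0
  have hd := P.analyticAt_monodromy hz 1 1
  have lift1 : ∀ {f : ℂ → ℂ}, AnalyticAt ℂ f p.1 → AnalyticAt ℂ (fun q : ℂ × ℂ => f q.1) p :=
    fun hf => hf.comp analyticAt_fst
  by_cases h0 : P.monodromy p.1 1 0 = 0
  · by_cases h1 : p.2 = P.monodromy p.1 0 0
    · rw [if_pos h1]
      by_cases h2 : P.monodromy p.1 0 0 = P.monodromy p.1 1 1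
      · refine P.spectralDivisor_of_meeting hp ?_
        rw [Delta, Matrix.trace_fin_two, ← h2, h1]; ring
      · exact P.spectralDivisor_of_separated hp h0 h1 h2
    · rw [if_neg h1]
      have hsub : p.2 - P.monodromy p.1 0 0 ≠ 0 := sub_ne_zero.2 h1
      have han : AnalyticAt ℂ (fun q : ℂ × ℂ => q.2 - P.monodromy q.1 0 0) p :=
        analyticAt_snd.sub (lift1 ha)
      refine P.spectralDivisor_eq_zero ((lift1 hb).div han hsub) ?_
      filter_upwards [eventually_mul_eigenSection hp,
        nhdsWithin_le_nhds (han.continuousAt.eventually_ne hsub)] with q h2 h3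
      simp only [Pi.div_apply]
      rw [eq_div_iff h3, mul_comm]
      exact h2.2.1
  · have : analyticOrderAt (fun w => P.monodromy w 1 0) p.1 = 0 := hc.analyticOrderAt_eq_zero.2 h0
    rw [this, ite_self]
    exact P.spectralDivisor_eq_zero ((analyticAt_snd.sub (lift1 hd)).div (lift1 hc) h0)
      (Eventually.of_forall fun q => rfl)

/-! ### Branch points and singularities -/

/-- The differential is (2μ - Δ)dμ - Δ'μ dλ, and μ ≠ 0 on the curve, so it vanishes iff 2μ = Δ and
Δ' = 0. The discriminant has derivative 2ΔΔ', with Δ ≠ 0 at its zeros. -/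
theorem exists_isSingularPoint_iff {z : ℂ} (hz : z ≠ 0) : (∃ μ : ℂ, P.IsSingularPoint (z, μ)) ↔
    2 ≤ analyticOrderAt (fun w => P.Delta w ^ 2 - 4) z := by
  have hD := analyticOnNhd_disc P z hz
  have hΔ := (P.analyticAt_Delta hz).differentiableAt.hasDerivAt
  set Δ' := deriv P.Delta z with hΔ'
  have hder : HasDerivAt (fun w => P.Delta w ^ 2 - 4) (2 * P.Delta z * Δ') z := by
    simpa using (hΔ.pow 2).sub_const 4
  have hF : ∀ μ : ℂ, HasFDerivAt P.charFun ((2 * μ - P.Delta z) • ContinuousLinearMap.snd ℂ ℂ ℂ -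
      (Δ' * μ) • ContinuousLinearMap.fst ℂ ℂ ℂ) (z, μ) := fun μ => by
    have e : P.charFun = fun q : ℂ × ℂ => q.2 ^ 2 - P.Delta q.1 * q.2 + 1 := funext P.charFun_eq
    rw [e]
    have h1 : HasFDerivAt (fun q : ℂ × ℂ => P.Delta q.1) (Δ' • ContinuousLinearMap.fst ℂ ℂ ℂ) (z, μ) :=
      hΔ.comp_hasFDerivAt (f := Prod.fst) (z, μ) hasFDerivAt_fst
    have h2 : HasFDerivAt (fun q : ℂ × ℂ => q.2) (ContinuousLinearMap.snd ℂ ℂ ℂ) (z, μ) := hasFDerivAt_snd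
    refine (((h2.pow 2).sub (h1.mul h2)).add_const 1).congr_fderiv ?_
    ext <;> simp; ring
  have hord : 2 ≤ analyticOrderAt (fun w => P.Delta w ^ 2 - 4) z ↔
      P.Delta z ^ 2 - 4 = 0 ∧ Δ' = 0 := by
    have hΔ0 : P.Delta z ^ 2 - 4 = 0 → P.Delta z ≠ 0 := fun h h0 => by rw [h0] at h; norm_num at h
    constructor
    · intro h
      have h0 : P.Delta z ^ 2 - 4 = 0 := by
        by_contra h0
        rw [hD.analyticOrderAt_eq_zero.2 h0] at h
        norm_num at h
      refine ⟨h0, ?_⟩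
      by_contra h1
      have h2 := hD.analyticOrderAt_sub_eq_one_of_deriv_ne_zero (by
        rw [hder.deriv]
        exact mul_ne_zero (mul_ne_zero two_ne_zero (hΔ0 h0)) h1)
      rw [h0] at h2
      simp only [sub_zero] at h2
      rw [h2] at h
      norm_num at h
    · rintro ⟨h0, h1⟩
      obtain ⟨u, hu, hu0, he⟩ := hD.analyticOrderAt_ne_top.1 (P.disc_order_ne_top hz)
      rw [← Nat.cast_analyticOrderNatAt (P.disc_order_ne_top hz)]
      set n := analyticOrderNatAt (fun w => P.Delta w ^ 2 - 4) z
      by_contra hn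
      have hn2 : n < 2 := by
        by_contra h2
        exact hn (by exact_mod_cast not_lt.1 h2)
      interval_cases n
      · have := he.self_of_nhds
        simp only [pow_zero, one_smul] at this
        exact hu0 (by rw [← this, h0])
      · have h3 : HasDerivAt (fun w => (w - z) ^ 1 • u w) (u z) z := by
          have := ((hasDerivAt_id z).sub_const z).fun_mul hu.differentiableAt.hasDerivAt
          simpa using this
        have h4 := (h3.congr_of_eventuallyEq he).unique hder
        rw [h1, mul_zero] at h4
        exact hu0 h4
  rw [hord]
  constructor
  · rintro ⟨μ, hμ, hs⟩
    have h1 := hs.unique (hF μ)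
    have e1 := congrArg (fun L : ℂ × ℂ →L[ℂ] ℂ => L (0, 1)) h1
    have e2 := congrArg (fun L : ℂ × ℂ →L[ℂ] ℂ => L (1, 0)) h1
    simp at e1 e2
    have h2 := (P.mem_curve_iff _).1 hμ
    have h3 := (P.mem_curve_iff_sq _).1 hμ
    simp only at h2 h3
    refine ⟨by rw [← h3.2, ← e1]; ring, e2.resolve_right fun h0 => ?_⟩
    rw [h0] at h2
    norm_num at h2
  · rintro ⟨h0, h1⟩
    refine ⟨P.Delta z / 2, (P.mem_curve_iff_sq _).2 ⟨hz, by simp only; rw [h0]; ring⟩, ?_⟩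
    have := hF (P.Delta z / 2)
    rw [h1] at this
    refine this.congr_fderiv ?_
    ext <;> simp; ring

/-- Holomorphic sections m correspond to holomorphic square roots 2m - Δ of the discriminant, which
exist iff its order is even. -/
theorem isBranchValue_iff {z : ℂ} (hz : z ≠ 0) : P.IsBranchValue z ↔
    Odd (analyticOrderNatAt (fun w => P.Delta w ^ 2 - 4) z) := by
  have hD := analyticOnNhd_disc P z hz
  have hΔ := P.analyticAt_Delta hz
  have htop := P.disc_order_ne_top hz
  rw [IsBranchValue, and_iff_right hz, ← Nat.not_even_iff_odd, not_iff_not]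
  constructor
  · rintro ⟨m, hm, he⟩
    have ha : AnalyticAt ℂ (fun w => 2 * m w - P.Delta w) z := (analyticAt_const.mul hm).sub hΔ
    have h1 : analyticOrderAt (fun w => P.Delta w ^ 2 - 4) z =
        2 • analyticOrderAt (fun w => 2 * m w - P.Delta w) z := by
      rw [← analyticOrderAt_pow ha]
      refine analyticOrderAt_congr (he.mono fun w hw => ?_)
      exact ((P.mem_curve_iff_sq _).1 hw).2.symm
    rw [analyticOrderNatAt, h1]
    exact ⟨analyticOrderNatAt (fun w => 2 * m w - P.Delta w) z, by
      rw [analyticOrderNatAt, nsmul_eq_mul, ENat.toNat_mul]; simp; ring⟩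
  · rintro ⟨k, hk⟩
    obtain ⟨u, hu, hu0, he⟩ := hD.analyticOrderAt_ne_top.1 htop
    obtain ⟨ρ₀, hρ₀⟩ := IsAlgClosed.exists_pow_nat_eq (u z) (n := 2) (by norm_num)
    obtain ⟨ρ, hρ, -, hρ2⟩ := exists_analytic_sqrt hu hρ₀ hu0
    refine ⟨fun w => (P.Delta w + (w - z) ^ k * ρ w) / 2,
      (hΔ.add (((analyticAt_id.sub analyticAt_const).pow k).mul hρ)).div_const, ?_⟩
    filter_upwards [he, hρ2, isOpen_ne.mem_nhds hz] with w h1 h2 h3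
    refine (P.mem_curve_iff_sq _).2 ⟨h3, ?_⟩
    simp only
    rw [h1, hk, ← h2, smul_eq_mul]
    ring

end Pot

end SinhGordon

namespace SinhGordon

/-! ### Enumerations -/

/-- The disjoint union of the `Fin (m x)` encodes multiplicities; its fibres over the labels and
those of the index set are finite of equal size, hence can be matched. -/
theorem exists_enumeration_of_fibers {X I J : Type} {m : X → ℕ} {b : X → J} {γ : I → J}
    (hI : ∀ c, Finite {i // γ i = c}) (hfin : ∀ c, ({x | b x = c} ∩ Function.support m).Finite)
    (hcard : ∀ c, ∑ᶠ x ∈ {x | b x = c}, m x = Nat.card {i // γ i = c}) :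
    ∃ e : I → X, (∀ x, {i | e i = x}.encard = m x) ∧ ∀ i, b (e i) = γ i := by
  have key : ∀ c, Nonempty ({t : Σ x, Fin (m x) // b t.1 = c} ≃ {i // γ i = c}) := fun c => by
    let E : {t : Σ x, Fin (m x) // b t.1 = c} ≃ Σ x : (hfin c).toFinset, Fin (m x.1) :=
      { toFun := fun t => ⟨⟨t.1.1, (hfin c).mem_toFinset.2 ⟨t.2, fun h => (h ▸ t.1.2 : Fin 0).elim0⟩⟩, t.1.2⟩
        invFun := fun s => ⟨⟨s.1.1, s.2⟩, ((hfin c).mem_toFinset.1 s.1.2).1⟩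
        left_inv := fun _ => rfl
        right_inv := fun _ => rfl }
    have : Finite {t : Σ x, Fin (m x) // b t.1 = c} := Finite.of_equiv _ E.symm
    have hI' := hI c
    refine Finite.card_eq.1 ?_
    rw [← hcard c, Nat.card_congr E, Nat.card_sigma,
      finsum_mem_eq_sum_of_inter_support_eq m (t := (hfin c).toFinset) (by
        ext x
        simp only [Set.Finite.coe_toFinset]
        exact ⟨fun h => ⟨h, h.2⟩, fun h => h.1⟩)]
    simp only [Nat.card_eq_fintype_card, Fintype.card_fin]
    exact Finset.sum_coe_sort _ m
  let E : (Σ x, Fin (m x)) ≃ I := Equiv.ofFiberEquiv (f := fun t => b t.1) (g := γ) fun c => (key c).some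
  refine ⟨fun i => (E.symm i).1, fun x => ?_, fun i => ?_⟩
  · have e2 : {i | (E.symm i).1 = x} ≃ Fin (m x) :=
      (E.symm.subtypeEquiv (q := fun t : Σ x, Fin (m x) => t.1 = x) fun _ => Iff.rfl).trans
        (Equiv.sigmaSubtype x)
    rw [Set.encard, ENat.card_congr e2, ENat.card_eq_coe_fintype_card, Fintype.card_fin]
  · have := Equiv.ofFiberEquiv_map (f := fun t : Σ x, Fin (m x) => b t.1) (g := γ)
      (fun c => (key c).some) (E.symm i)
    rw [show Equiv.ofFiberEquiv (f := fun t : Σ x, Fin (m x) => b t.1) (g := γ)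
      (fun c => (key c).some) = E from rfl, E.apply_symm_apply] at this
    exact this.symm

/-- Each cell beyond `N` is its own block and the middle region is a single block, in which indices
are assigned arbitrarily. -/
theorem exists_enumeration {X : Type} (m : X → ℕ) (pos : X → ℝ) (N r : ℕ) (hr : r ≠ 0)
    (hcov : ∀ x, m x ≠ 0 → (bd (-N - 1) < pos x ∧ pos x < bd N) ∨
      ∃ k : ℤ, (N : ℤ) < |k| ∧ bd (k - 1) < pos x ∧ pos x < bd k)
    (hcell : ∀ k : ℤ, (N : ℤ) < |k| → ∑ᶠ x ∈ {x | bd (k - 1) < pos x ∧ pos x < bd k}, m x = r)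
    (hmid : ∑ᶠ x ∈ {x | bd (-N - 1) < pos x ∧ pos x < bd N}, m x = r * (2 * N + 1)) :
    ∃ e : ℤ × Fin r → X, (∀ x, {i | e i = x}.encard = m x) ∧
      ∀ i, (N : ℤ) < |i.1| → bd (i.1 - 1) < pos (e i) ∧ pos (e i) < bd i.1 := by
  classical
  have hmono := strictMono_bd
  set b : X → Option ℤ := fun x =>
    if h : ∃ k : ℤ, (N : ℤ) < |k| ∧ bd (k - 1) < pos x ∧ pos x < bd k then some h.choose else none with hb
  have b_some : ∀ x k, b x = some k → (N : ℤ) < |k| ∧ bd (k - 1) < pos x ∧ pos x < bd k := by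
    intro x k h
    simp only [hb] at h
    split_ifs at h with h'
    rw [← Option.some.inj h]
    exact h'.choose_spec
  have b_cell : ∀ x k, (N : ℤ) < |k| → bd (k - 1) < pos x → pos x < bd k → b x = some k := by
    intro x k hk h1 h2
    have h' : ∃ k : ℤ, (N : ℤ) < |k| ∧ bd (k - 1) < pos x ∧ pos x < bd k := ⟨k, hk, h1, h2⟩
    simp only [hb, dif_pos h']
    obtain ⟨-, h3, h4⟩ := h'.choose_spec
    have i1 := hmono.lt_iff_lt.1 (h1.trans h4)
    have i2 := hmono.lt_iff_lt.1 (h3.trans h2)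
    congr 1
    omega
  have b_mid : ∀ x, m x ≠ 0 → (b x = none ↔ bd (-N - 1) < pos x ∧ pos x < bd N) := by
    intro x hx
    constructor
    · intro h
      refine (hcov x hx).resolve_right fun ⟨k, hk, h1, h2⟩ => ?_
      rw [b_cell x k hk h1 h2] at h
      exact absurd h (by simp)
    · rintro ⟨h1, h2⟩
      by_contra h
      obtain ⟨k, hk⟩ := Option.ne_none_iff_exists'.1 h
      obtain ⟨h3, h4, h5⟩ := b_some x k hk
      have i1 := hmono.lt_iff_lt.1 (h1.trans h5)
      have i2 := hmono.lt_iff_lt.1 (h4.trans h2)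
      exact absurd (abs_le.2 ⟨by omega, by omega⟩ : |k| ≤ (N : ℤ)) (not_le.2 h3)
  set γ : ℤ × Fin r → Option ℤ := fun i => if (N : ℤ) < |i.1| then some i.1 else none with hγ
  have γ_some : ∀ k : ℤ, (N : ℤ) < |k| → Nat.card {i // γ i = some k} = r ∧ Finite {i // γ i = some k} := by
    intro k hk
    let E : {i // γ i = some k} ≃ Fin r :=
      { toFun := fun i => i.1.2
        invFun := fun ν => ⟨(k, ν), by simp [hγ, hk]⟩
        left_inv := fun ⟨⟨l, ν⟩, h⟩ => by
          simp only [hγ] at h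
          split_ifs at h
          simpa using (Option.some.inj h).symm
        right_inv := fun _ => rfl }
    exact ⟨by rw [Nat.card_congr E]; simp, Finite.of_equiv _ E.symm⟩
  have γ_none : Nat.card {i // γ i = none} = r * (2 * N + 1) ∧ Finite {i // γ i = none} := by
    let E : {i // γ i = none} ≃ Finset.Icc (-(N : ℤ)) N × Fin r :=
      { toFun := fun i => (⟨i.1.1, by
          have := i.2
          simp only [hγ] at this
          split_ifs at this with h
          rw [Finset.mem_Icc]
          exact abs_le.1 (not_lt.1 h)⟩, i.1.2)
        invFun := fun j => ⟨(j.1.1, j.2), by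
          have := Finset.mem_Icc.1 j.1.2
          simp only [hγ]
          rw [if_neg (not_lt.2 (abs_le.2 this))]⟩
        left_inv := fun _ => rfl
        right_inv := fun _ => rfl }
    refine ⟨?_, Finite.of_equiv _ E.symm⟩
    rw [Nat.card_congr E, Nat.card_prod, Nat.card_eq_fintype_card, Nat.card_eq_fintype_card,
      Fintype.card_coe, Int.card_Icc, Fintype.card_fin, mul_comm]
    congr 1
    omega
  have γ_empty : ∀ k : ℤ, ¬ (N : ℤ) < |k| → IsEmpty {i // γ i = some k} := fun k hk => ⟨fun ⟨i, hi⟩ => by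
    simp only [hγ] at hi
    split_ifs at hi with h
    rw [Option.some.inj hi] at h
    exact hk h⟩
  have sum_some : ∀ k : ℤ, (N : ℤ) < |k| → ∑ᶠ x ∈ {x | b x = some k}, m x = r := fun k hk => by
    rw [← hcell k hk]
    refine finsum_mem_inter_support_eq' _ _ _ fun x _ => ⟨fun h => (b_some x k h).2, fun h => b_cell x k hk h.1 h.2⟩
  have sum_none : ∑ᶠ x ∈ {x | b x = none}, m x = r * (2 * N + 1) := by
    rw [← hmid]
    exact finsum_mem_inter_support_eq' _ _ _ fun x hx => b_mid x hx
  -- `finsum` is 0 on infinite support, so a nonzero value certifies finiteness; this is the use of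
  -- r ≠ 0.
  have fin_of : ∀ {s : Set X} {n : ℕ}, n ≠ 0 → ∑ᶠ x ∈ s, m x = n → (s ∩ Function.support m).Finite :=
    fun hn h => by
      by_contra hc
      exact hn (h.symm.trans (finsum_mem_eq_zero_of_infinite hc))
  have empty_some : ∀ k : ℤ, ¬ (N : ℤ) < |k| → {x | b x = some k} = ∅ := fun k hk =>
    eq_empty_of_forall_notMem fun x hx => hk (b_some x k hx).1
  obtain ⟨e, he, hbe⟩ := exists_enumeration_of_fibers (m := m) (b := b) (γ := γ)
    (fun c => by
      rcases c with _ | k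
      · exact γ_none.2
      · by_cases hk : (N : ℤ) < |k|
        · exact (γ_some k hk).2
        · have := γ_empty k hk; infer_instance)
    (fun c => by
      rcases c with _ | k
      · exact fin_of (by positivity) sum_none
      · by_cases hk : (N : ℤ) < |k|
        · exact fin_of hr (sum_some k hk)
        · rw [empty_some k hk, empty_inter]; exact finite_empty)
    (fun c => by
      rcases c with _ | k
      · rw [γ_none.1, sum_none]
      · by_cases hk : (N : ℤ) < |k|
        · rw [(γ_some k hk).1, sum_some k hk]
        · have := γ_empty k hk
          rw [empty_some k hk, finsum_mem_empty, Nat.card_of_isEmpty])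
  refine ⟨e, he, fun i hi => ?_⟩
  have := hbe i
  simp only [hγ] at this
  rw [if_pos hi] at this
  exact (b_some _ _ this).2

theorem memEll_of_bound {n m : ℤ} {a : ℤ → ℂ} {B : ℤ → ℝ} (hB : Summable fun k => B k ^ 2) {N : ℕ}
    (h : ∀ k : ℤ, (N : ℤ) < |k| → ellWeight n m k * ‖a k‖ ≤ B k) : MemEll n m a := by
  refine Summable.of_norm_bounded_eventually hB ?_
  rw [eventually_cofinite]
  refine (Set.finite_Icc (-(N : ℤ)) N).subset fun k hk => ?_
  by_contra hc
  have hk' : (N : ℤ) < |k| := by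
    by_contra h'
    exact hc (abs_le.1 (not_lt.1 h'))
  refine hk ?_
  have h0 : 0 ≤ ellWeight n m k := by
    unfold ellWeight
    split_ifs with h1 h2
    · positivity
    · exact zero_le_one
    · exact zpow_nonneg (by exact_mod_cast (not_lt.1 h1)) _
  rw [norm_pow, Real.norm_of_nonneg (by positivity)]
  exact pow_le_pow_left₀ (by positivity) (h k hk') 2

/-! ### Counting in the annuli S_k -/

theorem finsum_analyticOrderAt_eq {f : ℂ → ℂ} (hf : AnalyticOnNhd ℂ f {0}ᶜ)
    (htop : ∀ z, z ≠ 0 → analyticOrderAt f z ≠ ⊤) {A : Set ℂ} (hA : (0 : ℂ) ∉ A) {m n : ℤ}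
    (h : ∀ z, z ≠ 0 → f z = 0 → (z ∈ A ↔ bd m < ‖z‖ ∧ ‖z‖ < bd n)) {r : ℕ} (hr : r ≠ 0)
    (hsum : ∑ᶠ z ∈ {z : ℂ | bd m < ‖z‖ ∧ ‖z‖ < bd n}, analyticOrderNatAt f z = r) :
    ∑ᶠ z ∈ A, analyticOrderAt f z = r := by
  have hfin : ({z : ℂ | bd m < ‖z‖ ∧ ‖z‖ < bd n} ∩
      Function.support fun z => analyticOrderNatAt f z).Finite := by
    by_contra hc
    exact hr (hsum.symm.trans (finsum_mem_eq_zero_of_infinite hc))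
  have hcast := (Nat.castAddMonoidHom ℕ∞).map_finsum_mem' hfin
  rw [hsum] at hcast
  rw [show ((r : ℕ) : ℕ∞) = Nat.castAddMonoidHom ℕ∞ r from rfl, hcast]
  have hne : ∀ z : ℂ, bd m < ‖z‖ → z ≠ 0 := fun z hz => norm_pos_iff.1 ((bd_pos m).trans hz)
  rw [finsum_mem_inter_support_eq' _ A {z : ℂ | bd m < ‖z‖ ∧ ‖z‖ < bd n} fun z hz => ?_]
  · refine finsum_mem_congr rfl fun z hz => ?_
    exact (Nat.cast_analyticOrderNatAt (htop z (hne z hz.1))).symm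
  · rcases eq_or_ne z 0 with rfl | h0
    · exact ⟨fun h => absurd h hA, fun h => absurd rfl (hne 0 h.1)⟩
    · refine h z h0 ?_
      by_contra h1
      exact hz ((hf z h0).analyticOrderAt_eq_zero.2 h1)

theorem zero_notMem_annulus (k : ℤ) : (0 : ℂ) ∉ annulus k := by
  unfold annulus
  split_ifs <;> simp

namespace Pot

variable (P : Pot)

/-- Over each zero z of c lies exactly one point of the divisor, (z, a(z)), so counting the divisor
means counting zeros of c. -/
theorem divisorCount_eq {A : Set ℂ} (hA : (0 : ℂ) ∉ A) :
    P.divisorCount A = ∑ᶠ z ∈ A, analyticOrderAt (fun w => P.monodromy w 1 0) z := by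
  have hne : ∀ z ∈ A, z ≠ 0 := fun z hz h => hA (h ▸ hz)
  have hmem : ∀ z ∈ A, P.monodromy z 1 0 = 0 → (z, P.monodromy z 0 0) ∈ P.curve := fun z hz h =>
    (P.mem_curve_iff_mul _).2 ⟨hne z hz, by simp only; rw [h]; ring⟩
  have hord : ∀ z, z ≠ 0 → analyticOrderAt (fun w => P.monodromy w 1 0) z ≠ 0 →
      P.monodromy z 1 0 = 0 := fun z hz h => by
    by_contra h1
    exact h ((P.analyticAt_monodromy hz 1 0).analyticOrderAt_eq_zero.2 h1)
  have h1 : P.divisorCount A = ∑ᶠ p ∈ (fun z => (z, P.monodromy z 0 0)) ''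
      {z | z ∈ A ∧ P.monodromy z 1 0 = 0}, P.spectralDivisor p := by
    refine finsum_mem_inter_support_eq' _ _ _ fun p hp => ⟨fun ⟨h1, h2⟩ => ?_, ?_⟩
    · rw [Function.mem_support, P.spectralDivisor_eq h1] at hp
      split_ifs at hp with h3
      · exact ⟨p.1, ⟨h2, hord _ h1.1 hp⟩, Prod.ext rfl h3.symm⟩
      · exact absurd rfl hp
    · rintro ⟨z, ⟨hz, hc⟩, rfl⟩
      exact ⟨hmem z hz hc, hz⟩
  rw [h1, finsum_mem_image fun z _ w _ h => congrArg Prod.fst h]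
  rw [finsum_mem_congr rfl fun z hz => (P.spectralDivisor_eq (hmem z hz.1 hz.2)).trans (if_pos rfl)]
  exact finsum_mem_inter_support_eq' _ _ _ fun z hz =>
    ⟨fun h => h.1, fun h => ⟨h, hord z (hne z h) hz⟩⟩

theorem asymptoticallyAndTotally {count : Set ℂ → ℕ∞} {f : ℂ → ℂ} {r : ℕ} (hr : r ≠ 0)
    (hf : AnalyticOnNhd ℂ f {0}ᶜ) (htop : ∀ z, z ≠ 0 → analyticOrderAt f z ≠ ⊤)
    (hcount : ∀ A : Set ℂ, (0 : ℂ) ∉ A → count A = ∑ᶠ z ∈ A, analyticOrderAt f z)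
    (hspec : ∀ z, z ≠ 0 → f z = 0 → P.IsSpecial z) {n₀ : ℕ}
    (hn₀ : ∀ m n : ℤ, ((n₀ : ℤ) ≤ m ∨ m < -n₀) → ((n₀ : ℤ) ≤ n ∨ n < -n₀) → m < n →
      ∑ᶠ z ∈ {z : ℂ | bd m < ‖z‖ ∧ ‖z‖ < bd n}, analyticOrderNatAt f z = r * (n - m).toNat) :
    AsymptoticallyAndTotally r count := by
  obtain ⟨n₁, B, hB, h1, h2, h3⟩ := P.exists_special_location
  refine ⟨max n₀ n₁, fun k hk => ?_, ?_⟩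
  · rw [hcount _ (zero_notMem_annulus k)]
    refine finsum_analyticOrderAt_eq hf htop (zero_notMem_annulus k)
      (fun z hz h0 => (h1 k (by omega) z (hspec z hz h0)).1) hr ?_
    have hk' := lt_abs.1 hk
    rw [hn₀ (k - 1) k (by omega) (by omega) (by omega)]
    rw [show k - (k - 1) = 1 by ring]; simp
  · have h0 : (0 : ℂ) ∉ ⋃ k : {k : ℤ // |k| ≤ ((max n₀ n₁ : ℕ) : ℤ)}, annulus k := by
      rw [mem_iUnion]
      rintro ⟨k, hk⟩
      exact zero_notMem_annulus k hk
    rw [hcount _ h0]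
    refine finsum_analyticOrderAt_eq hf htop h0
      (fun z hz hz0 => h2 _ (le_max_right _ _) z (hspec z hz hz0)) (by positivity) ?_
    rw [hn₀ _ _ (by omega) (by omega) (by omega)]
    congr 1
    omega

end Pot

end SinhGordon

/-! ### The theorem -/

theorem theoremT (P : SinhGordon.Pot) :
    -- the zeros of `Δ² - 4`
    (SinhGordon.AsymptoticallyAndTotally 2 P.zeroCount ∧
      (∀ z : ℂ, z ≠ 0 →
        (P.Delta z ^ 2 - 4 = 0 ↔ P.IsBranchValue z ∨ ∃ μ : ℂ, P.IsSingularPoint (z, μ)) ∧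
        (P.IsBranchValue z ↔ Odd (analyticOrderNatAt (fun w => P.Delta w ^ 2 - 4) z)) ∧
        ((∃ μ : ℂ, P.IsSingularPoint (z, μ)) ↔
          2 ≤ analyticOrderAt (fun w => P.Delta w ^ 2 - 4) z)) ∧
      (∃ κ : ℤ → Fin 2 → ℂ, P.EnumeratesZeros κ) ∧
      (∀ κ : ℤ → Fin 2 → ℂ, P.EnumeratesZeros κ →
        ∀ ν, SinhGordon.MemEll (-1) 3 (fun k => κ k ν - SinhGordon.lamVac k))) ∧
    -- the spectral divisor
    (SinhGordon.AsymptoticallyAndTotally 1 P.divisorCount ∧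
      (∃ pt : ℤ → ℂ × ℂ, P.EnumeratesDivisor pt) ∧
      (∀ pt : ℤ → ℂ × ℂ, P.EnumeratesDivisor pt →
        SinhGordon.MemEll (-1) 3 (fun k => (pt k).1 - SinhGordon.lamVac k) ∧
        SinhGordon.MemEll 0 0 (fun k => (pt k).2 - SinhGordon.muVac k))) := by
  classical
  open SinhGordon in
  obtain ⟨n₀, hn₀⟩ := P.exists_count
  obtain ⟨n₁, B, hB, hloc, hmid, hcov⟩ := P.exists_special_location
  set N := max n₀ n₁ with hN
  have hD := analyticOnNhd_disc P
  have hc := analyticOnNhd_monodromy P 1 0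
  have hD0 : ∀ z, z ≠ 0 → analyticOrderAt (fun w => P.Delta w ^ 2 - 4) z ≠ 0 →
      P.Delta z ^ 2 - 4 = 0 := fun z hz h => by
    by_contra h1
    exact h ((hD z hz).analyticOrderAt_eq_zero.2 h1)
  have hc0 : ∀ z, z ≠ 0 → analyticOrderAt (fun w => P.monodromy w 1 0) z ≠ 0 →
      P.monodromy z 1 0 = 0 := fun z hz h => by
    by_contra h1
    exact h ((hc z hz).analyticOrderAt_eq_zero.2 h1)
  have hdiv : ∀ p ∈ P.curve, P.spectralDivisor p ≠ 0 →
      p.2 = P.monodromy p.1 0 0 ∧ P.IsSpecial p.1 := fun p hp h => by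
    rw [P.spectralDivisor_eq hp] at h
    split_ifs at h with h1
    · exact ⟨h1, hp.1, Or.inl (hc0 _ hp.1 h)⟩
    · exact absurd rfl h
  refine ⟨⟨?_, fun z hz => ⟨?_, P.isBranchValue_iff hz, P.exists_isSingularPoint_iff hz⟩, ?_, ?_⟩,
    ?_, ?_, ?_⟩
  · exact P.asymptoticallyAndTotally two_ne_zero hD (fun z hz => P.disc_order_ne_top hz)
      (fun A _ => rfl) (fun z hz h => ⟨hz, Or.inr h⟩) fun m n h1 h2 h3 => (hn₀ m n h1 h2 h3).2
  · rw [P.isBranchValue_iff hz, P.exists_isSingularPoint_iff hz, ← not_iff_not,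
      ← ne_eq, ← (hD z hz).analyticOrderAt_eq_zero, ← Nat.cast_analyticOrderNatAt (P.disc_order_ne_top hz)]
    generalize analyticOrderNatAt (fun w => P.Delta w ^ 2 - 4) z = n
    norm_cast
    rw [not_or, Nat.not_odd_iff_even, not_le]
    exact ⟨fun h => by subst h; simp, fun ⟨⟨j, hj⟩, h2⟩ => by omega⟩
  -- The multiplicity is set to 0 at the origin, which does not belong to ℂ*.
  · obtain ⟨e, he, hcell⟩ := exists_enumeration
      (fun z : ℂ => if z = 0 then 0 else analyticOrderNatAt (fun w => P.Delta w ^ 2 - 4) z)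
      (fun z => ‖z‖) N 2 two_ne_zero (fun z hz => by
        rw [ne_eq, ite_eq_left_iff, not_forall] at hz
        obtain ⟨h0, h1⟩ := hz
        refine hcov N (le_max_right _ _) z ⟨h0, Or.inr (hD0 z h0 fun h2 => h1 ?_)⟩
        rw [analyticOrderNatAt, h2]; rfl)
      (fun k hk => by
        rw [finsum_mem_congr rfl fun z hz => if_neg (norm_pos_iff.1 ((bd_pos _).trans hz.1)),
          (hn₀ (k - 1) k (by have := lt_abs.1 hk; omega) (by have := lt_abs.1 hk; omega) (by omega)).2, show k - (k - 1) = 1 by ring]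
        rfl)
      (by
        rw [finsum_mem_congr rfl fun z hz => if_neg (norm_pos_iff.1 ((bd_pos _).trans hz.1)),
          (hn₀ _ _ (by omega) (by omega) (by omega)).2]
        congr 1
        omega)
    have hmem : ∀ i, e i ≠ 0 ∧ analyticOrderAt (fun w => P.Delta w ^ 2 - 4) (e i) ≠ 0 := fun i => by
      have h1 := he (e i)
      have h2 : {j | e j = e i}.encard ≠ 0 := by
        rw [Set.encard_ne_zero]; exact ⟨i, rfl⟩
      rw [h1] at h2
      by_cases h0 : e i = 0
      · rw [if_pos h0] at h2; exact absurd rfl h2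
      · rw [if_neg h0, Nat.cast_analyticOrderNatAt (P.disc_order_ne_top h0)] at h2
        exact ⟨h0, h2⟩
    refine ⟨fun k ν => e (k, ν), fun k ν => (hmem _).1, fun z hz => ?_, N, fun k hk ν => ?_⟩
    · rw [← Nat.cast_analyticOrderNatAt (P.disc_order_ne_top hz)]
      have := he z
      rwa [if_neg hz] at this
    · exact (hloc k (by omega) _ ⟨(hmem _).1, Or.inr (hD0 _ (hmem _).1 (hmem _).2)⟩).1.2
        (hcell (k, ν) hk)
  · rintro κ ⟨h0, h1, N', h2⟩ ν
    -- The bound holds for every zero in S_k, so the choice of the enumeration does not matter.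
    refine memEll_of_bound (N := max N' n₁) hB fun k hk => ?_
    have hord : analyticOrderAt (fun w => P.Delta w ^ 2 - 4) (κ k ν) ≠ 0 := by
      rw [← h1 _ (h0 k ν), Set.encard_ne_zero]
      exact ⟨(k, ν), rfl⟩
    exact ((hloc k (by omega) _ ⟨h0 k ν, Or.inr (hD0 _ (h0 k ν) hord)⟩).2 (h2 k (by omega) ν)).1
  · exact P.asymptoticallyAndTotally one_ne_zero hc (fun z hz => P.c_order_ne_top hz)
      (fun A hA => P.divisorCount_eq hA) (fun z hz h => ⟨hz, Or.inl h⟩)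
      fun m n h1 h2 h3 => by rw [(hn₀ m n h1 h2 h3).1, one_mul]
  -- The zeros of c are enumerated; μ is then a(λ).
  · obtain ⟨e, he, hcell⟩ := exists_enumeration
      (fun z : ℂ => if z = 0 then 0 else analyticOrderNatAt (fun w => P.monodromy w 1 0) z)
      (fun z => ‖z‖) N 1 one_ne_zero (fun z hz => by
        rw [ne_eq, ite_eq_left_iff, not_forall] at hz
        obtain ⟨h0, h1⟩ := hz
        refine hcov N (le_max_right _ _) z ⟨h0, Or.inl (hc0 z h0 fun h2 => h1 ?_)⟩
        rw [analyticOrderNatAt, h2]; rfl)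
      (fun k hk => by
        rw [finsum_mem_congr rfl fun z hz => if_neg (norm_pos_iff.1 ((bd_pos _).trans hz.1)),
          (hn₀ (k - 1) k (by have := lt_abs.1 hk; omega) (by have := lt_abs.1 hk; omega) (by omega)).1, show k - (k - 1) = 1 by ring]
        rfl)
      (by
        rw [finsum_mem_congr rfl fun z hz => if_neg (norm_pos_iff.1 ((bd_pos _).trans hz.1)),
          (hn₀ _ _ (by omega) (by omega) (by omega)).1, one_mul]
        omega)
    have hmem : ∀ i, e i ≠ 0 ∧ analyticOrderAt (fun w => P.monodromy w 1 0) (e i) ≠ 0 := fun i => by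
      have h1 := he (e i)
      have h2 : {j | e j = e i}.encard ≠ 0 := by
        rw [Set.encard_ne_zero]; exact ⟨i, rfl⟩
      rw [h1] at h2
      by_cases h0 : e i = 0
      · rw [if_pos h0] at h2; exact absurd rfl h2
      · rw [if_neg h0, Nat.cast_analyticOrderNatAt (P.c_order_ne_top h0)] at h2
        exact ⟨h0, h2⟩
    refine ⟨fun k => (e (k, 0), P.monodromy (e (k, 0)) 0 0), fun k => ?_, fun p hp => ?_, N, fun k hk => ?_⟩
    · refine (P.mem_curve_iff_mul _).2 ⟨(hmem _).1, ?_⟩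
      simp only
      rw [hc0 _ (hmem (k, 0)).1 (hmem (k, 0)).2]; ring
    · rw [P.spectralDivisor_eq hp]
      split_ifs with h1
      · have h2 := he p.1
        rw [if_neg hp.1, Nat.cast_analyticOrderNatAt (P.c_order_ne_top hp.1)] at h2
        rw [← h2]
        have himg : {i : ℤ × Fin 1 | e i = p.1} =
            (fun k : ℤ => (k, (0 : Fin 1))) '' {k | (e (k, 0), P.monodromy (e (k, 0)) 0 0) = p} := by
          ext ⟨k, ν⟩
          simp only [mem_image, mem_ofPred_eq, Prod.mk.injEq]
          constructor
          · intro h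
            obtain rfl : ν = 0 := Subsingleton.elim _ _
            exact ⟨k, Prod.ext h (by simp only [h]; exact h1.symm), rfl, rfl⟩
          · rintro ⟨l, h, rfl, rfl⟩
            exact congrArg Prod.fst h
        rw [himg, Function.Injective.encard_image fun k l h => congrArg Prod.fst h]
      · rw [Set.encard_eq_zero]
        refine eq_empty_of_forall_notMem fun k hk => h1 ?_
        rw [← hk]
    · exact (hloc k (by omega) _ ⟨(hmem _).1, Or.inl (hc0 _ (hmem _).1 (hmem _).2)⟩).1.2
        (hcell (k, 0) hk)
  · rintro pt ⟨h0, h1, N', h2⟩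
    have hspec : ∀ k, (pt k).2 = P.monodromy (pt k).1 0 0 ∧ P.IsSpecial (pt k).1 := fun k => by
      refine hdiv _ (h0 k) ?_
      rw [← h1 _ (h0 k), Set.encard_ne_zero]
      exact ⟨k, rfl⟩
    refine ⟨memEll_of_bound (N := max N' n₁) hB fun k hk => ?_,
      memEll_of_bound (N := max N' n₁) hB fun k hk => ?_⟩
    · exact ((hloc k (by omega) _ (hspec k).2).2 (h2 k (by omega))).1
    · have hw : ellWeight 0 0 k = 1 := by unfold ellWeight; simp
      -- On the divisor μ = a(λ), so the estimate of a - (-1)^k is the one of μ.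
      rw [hw, one_mul, (hspec k).1]
      exact ((hloc k (by omega) _ (hspec k).2).2 (h2 k (by omega))).2
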